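/- **Setting.** Let $K$ be a field of characteristic $0$ (for instance $\mathbb{C}((\sqrt\hbar))$) with a nonzero element $s=\sqrt\hbar$, $\hbar=s^2$. Put $a_n=\frac1{(2n+1)!!}$ and $b_n=(2n-1)!!$ with $b_0=1$. For $\tau\in K[[q_0,q_1,\dots]]$ let $$\Gamma(\lambda)=\Gamma_+(\lambda)\Gamma_-(\lambda),\qquad \Gamma_+(\lambda)=\exp\Big(s^{-1}\sum_{n\ge0}a_n\lambda^{2n+1}q_n\Big),\qquad \Gamma_-(\lambda)=\exp\Big(-s\sum_{n\ge0}b_n\lambda^{-2n-1}\partial_{q_n}\Big).$$ A *KdV tau function* is a $\tau$ with nonzero constant term that satisfies the Hirota quadratic equations $\operatorname{Res}_\lambda \lambda^{2n}(\Gamma(\lambda)\tau)(q)\,(\Gamma(-\lambda)\tau)(q')\,d\lambda=0$ for all $n\ge0$, coefficient by coefficient in the independent variables $q,q'$. Let $I$ be a finite index set, let $\tau_\gamma$ ($\gamma\in I$) be KdV tau functions, and $\tau=\prod_\gamma\tau_\gamma(q_{\gamma,0},q_{\gamma,1},\dots)$ the corresponding tau function of $N=|I|$ copies of KdV. Let $\ell\ge1$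 and let $r=(r_{\alpha\beta})$ be a matrix over $K$ with $r_{\alpha\beta}=(-1)^{\ell+1}r_{\beta\alpha}$. Up to a factor $(-1)^{\ell-1}$, which is omitted, the quantization of $r\,z^\ell$ is $$\hat r=\sum_{\alpha,\beta}r_{\alpha\beta}\Big(\sum_{i\ge0}q_{\alpha,i}\frac{\partial}{\partial q_{\beta,\ell+i}}+\frac\hbar2\sum_{i+j=\ell-1}(-1)^{i+1}\frac{\partial^2}{\partial q_{\alpha,i}\partial q_{\beta,j}}\Big),$$ and we work over $K[\varepsilon]/(\varepsilon^2)$, with $\tau_R=\tau+\varepsilon\,\hat r\tau$. Introduce $x$ through $q_{\gamma,0}\mapsto q_{\gamma,0}+x$ for all $\gamma$; let $T,T_R$ be the resulting functions of $(x,q)$, and write $\partial=\partial_x$. All functions are formal power series, and operators are pseudo-differential operators in $\partial$, whose order may grow with the monomial in the $q_{\gamma,n}$. For $T$ put $\Omega_{\alpha,i;\beta,j}=\hbar\,\partial_{q_{\alpha,i}}\partial_{q_{\beta,j}}\log T$, let $P_\alpha(s\partial)$ be the operator with symbol $P_\alpha(\lambda)=T^{-1}\exp\big(-s\sum_n b_n\lambda^{-2n-1}\partial_{q_{\alpha,n}}\big)T$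 (coefficients to the left of the powers of $\lambda=s\partial$), and put $L_\alpha^{n/2}=P_\alpha(s\partial)^nP_\alpha^{-1}$ and $u_\alpha=\frac12\,\cdot$ the coefficient of $\partial^0$ in $L_\alpha$. The same objects for $T_R$ are denoted $\Omega^R_{\alpha,i;\beta,j}$, $P_{\alpha,R}$, $L_{\alpha,R}^{n/2}$, $u^R_\alpha$. Write $A_+$ for the differential part of $A$, $A_-=A-A_+$, and $\operatorname{Res}A$ for the coefficient of $\partial^{-1}$. **The deformed Sato–Wilson equation.** Let $d_\ell=\frac12\sum_{i+j=\ell-1}(-1)^{j+1}a_ia_j$, $D_{\beta,n}=\frac{\partial P_\alpha}{\partial q_{\beta,n}}+\frac{\partial\log T}{\partial q_{\beta,n}}P_\alpha$, and $$Q_\alpha=r_{\alpha\alpha}d_\ell\,P_\alpha(s\partial)^{2\ell}+s\sum_\beta r_{\alpha\beta}\Big(\sum_{n=0}^{\ell-1}(-1)^{n+1}a_nD_{\beta,\ell-1-n}(s\partial)^{2n+1}+\sum_{n\ge0}b_nD_{\beta,n+\ell}(s\partial)^{-2n-1}\Big)+(-1)^{\ell-1}s^{-1}\sum_\beta r_{\alpha\beta}\sum_{n\ge\ell}a_n(q_{\beta,n-\ell}+\delta_{n,\ell}x)P_\alpha(s\partial)^{2n+1}.$$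 (The symbol of $P_\alpha+\varepsilon Q_\alpha$ arises from applying to $T$ the factors $R_{\alpha,\pm}$ by which the vertex operator of the $\alpha$-th copy is deformed under conjugation with $\exp(\varepsilon\hat r)$.) Let $$S_{\alpha;\beta,p}=-\delta_{\alpha\beta}\frac{a_p}{s}\big(L_{\alpha,R}^{p+1/2}\big)_--\varepsilon\Big(\frac{\partial (Q_\alpha P_\alpha^{-1})}{\partial q_{\beta,p}}-\delta_{\alpha\beta}\frac{a_p}{s}\big[(L_\alpha^{p+1/2})_+,\,Q_\alpha P_\alpha^{-1}\big]\Big)_- .$$ **Hamiltonian deformation formula.** Let $\Omega_p$ be the differential polynomial $s\,a_p\operatorname{Res}(\hbar\partial^2+2u)^{p+1/2}$ in $u$, where $(\hbar\partial^2+2u)^{1/2}=s\partial+\dots$, and let $F_{\alpha\beta,p}=\delta_{\alpha\beta}\Omega_p[u_\alpha]$, a polynomial in the variables $u_{\gamma,n}=\partial_x^nu_\gamma$. Put $\Omega_{\alpha,i;\mathbb 1,0}=\sum_\nu\Omega_{\alpha,i;\nu,0}$. Define $$\begin{aligned} H_{\alpha;\beta,p}={}&\sum_\mu r_{\mu\alpha}\Omega_{\mu,\ell;\beta,p}+\sum_\mu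 r_{\mu\beta}\Omega_{\alpha,0;\mu,p+\ell}+\sum_{i+j=\ell-1}(-1)^{i+1}\sum_{\mu,\nu}r_{\nu\mu}\Omega_{\alpha,0;\mu,i}\Omega_{\nu,j;\beta,p}\\ &-\sum_{\gamma,n}\frac{\partial F_{\alpha\beta,p}}{\partial u_{\gamma,n}}\Big(\sum_\mu r_{\mu\gamma}\,\partial_x^n\Omega_{\mu,\ell;\mathbb1,0}+(n+1)\sum_{\mu,\nu}r_{\mu\nu}\,\partial_x^n\Omega_{\gamma,0;\mu,\ell}\\ &\qquad+\sum_{i+j=\ell-1}(-1)^{i+1}\sum_{\mu,\nu}r_{\nu\mu}\sum_{k=0}^{n-1}\binom nk\,\partial_x^{k+1}\Omega_{\gamma,0;\mu,i}\,\partial_x^{n-1-k}\Omega_{\nu,j;\mathbb1,0}\\ &\qquad+\sum_{i+j=\ell-1}(-1)^{i+1}\sum_{\mu,\nu}r_{\nu\mu}\,\partial_x^n\big(\Omega_{\gamma,0;\mu,i}\Omega_{\nu,j;\mathbb1,0}\big)\Big)\\ &+\frac\hbar2\sum_{\gamma,n}\sum_{\delta,m}\frac{\partial^2F_{\alpha\beta,p}}{\partial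 u_{\gamma,n}\partial u_{\delta,m}}\sum_{i+j=\ell-1}(-1)^{i+1}\sum_{\mu,\nu}r_{\nu\mu}\,\partial_x^{n+1}\Omega_{\gamma,0;\mu,i}\;\partial_x^{m+1}\Omega_{\nu,j;\delta,0}, \end{aligned}$$ all evaluated on $T$ (this is the Buryak–Posthuma–Shadrin formula for the deformation of $\Omega_{\alpha,0;\beta,p}$). **Theorem.** For all $\alpha,\beta\in I$ and $p\ge0$, modulo $\varepsilon^2$: 1. the deformed Sato–Wilson equation holds: $\displaystyle\frac{\partial P_{\alpha,R}}{\partial q_{\beta,p}}P_{\alpha,R}^{-1}=S_{\alpha;\beta,p}$; 2. its residue gives the deformed two-point function: $\Omega^R_{\alpha,0;\beta,p}=-\hbar\operatorname{Res}S_{\alpha;\beta,p}$; 3. this coincides, up to the omitted sign $(-1)^{\ell-1}$, with the Hamiltonian deformation formula: $$-\hbar\operatorname{Res}S_{\alpha;\beta,p}=\delta_{\alpha\beta}\,\Omega_p[u^R_\alpha]+\varepsilon\,(-1)^{\ell-1}H_{\alpha;\beta,p}.$$ -/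

import Mathlib

/-!
# Infinitesimal Givental deformations of several copies of the KdV hierarchy

Formal pseudo-differential operators, vertex operators and tau functions of KdV, the
upper triangular Givental deformation, the deformed Sato-Wilson equations, and the
deformation formula in Hamiltonian form.
-/

namespace KdVGivental

open scoped Differential
open Finset

/-! ## Formal pseudo-differential operators

`PDO R` is the ring of formal sums `∑ c_k ∂^k`, `k ≤ M` for some integer `M`, with
coefficients in a commutative differential ring `R`, multiplied by the rule
`∂^i b = ∑_{l ≥ 0} binom(i, l) b^{(l)} ∂^{i-l}` for every integer `i`. -/

/-- Two-sided sequences which vanish in all large degrees. -/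
def PDO.submodule (R : Type*) [CommRing R] : Submodule R (ℤ → R) where
  carrier := {f | ∃ M : ℤ, ∀ k, M < k → f k = 0}
  add_mem' := by
    rintro f g ⟨M, hM⟩ ⟨N, hN⟩
    exact ⟨max M N, fun k hk => by
      rw [Pi.add_apply, hM k (lt_of_le_of_lt (le_max_left _ _) hk),
        hN k (lt_of_le_of_lt (le_max_right _ _) hk), add_zero]⟩
  zero_mem' := ⟨0, fun _ _ => rfl⟩
  smul_mem' := by
    rintro c f ⟨M, hM⟩
    exact ⟨M, fun k hk => by rw [Pi.smul_apply, hM k hk, smul_zero]⟩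

/-- Formal pseudo-differential operators over `R`. -/
def PDO (R : Type*) [CommRing R] : Type _ := PDO.submodule R

namespace PDO

instance (R : Type*) [CommRing R] : AddCommGroup (PDO R) :=
  inferInstanceAs (AddCommGroup (PDO.submodule R))

instance (K R : Type*) [CommRing K] [CommRing R] [Algebra K R] : Module K (PDO R) :=
  inferInstanceAs (Module K (PDO.submodule R))

section
variable {R : Type*} [CommRing R]

/-- The coefficient of `∂^k`, written to the left of `∂^k`. -/
def coeff (A : PDO R) (k : ℤ) : R := A.1 k

theorem ext {A B : PDO R} (h : ∀ k, A.coeff k = B.coeff k) : A = B :=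
  Subtype.ext (funext h)

theorem bdd (A : PDO R) : ∃ M : ℤ, ∀ k, M < k → A.coeff k = 0 := A.2

@[simp] theorem coeff_add (A B : PDO R) (k : ℤ) :
    (A + B).coeff k = A.coeff k + B.coeff k := rfl

@[simp] theorem coeff_zero (k : ℤ) : (0 : PDO R).coeff k = 0 := rfl

/-- The operator `a ∂^n`. -/
noncomputable def mono (n : ℤ) (a : R) : PDO R :=
  ⟨fun k => if k = n then a else 0, n, fun _ hk => if_neg (ne_of_gt hk)⟩

theorem coeff_mono (n : ℤ) (a : R) (k : ℤ) : (mono n a).coeff k = if k = n then a else 0 := rfl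

end

theorem sum_eq_antidiagonal {S : Type*} [AddCommMonoid S] {H : Finset ℤ} (N : ℕ) (o : ℤ) (f : ℤ → S)
    (hH : Icc (o - N) o ⊆ H) (h0 : ∀ h, h ∉ Icc (o - N) o → f h = 0) :
    ∑ h ∈ H, f h = ∑ p ∈ antidiagonal N, f (o - p.1) := by
  rw [← sum_subset hH fun x _ hx => h0 x hx]
  refine (Finset.sum_bij' (s := antidiagonal N) (t := Icc (o - N) o)
    (f := fun p : ℕ × ℕ => f (o - p.1)) (g := f) (fun p _ => o - (p.1 : ℤ))
    (fun h _ => ((o - h).toNat, (h - (o - N)).toNat)) ?_ ?_ ?_ ?_ ?_).symm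
  · rintro ⟨a, b⟩ h
    simp only [HasAntidiagonal.mem_antidiagonal, mem_Icc] at h ⊢
    omega
  · intro h hh
    simp only [HasAntidiagonal.mem_antidiagonal, mem_Icc] at hh ⊢
    omega
  · rintro ⟨a, b⟩ h
    simp only [HasAntidiagonal.mem_antidiagonal] at h
    ext
    · simp
    · simp only; omega
  · intro h hh
    simp only [mem_Icc] at hh
    simp only
    omega
  · intro p _; rfl

section Mul
variable {R : Type*} [CommRing R] [Differential R]

/-- The coefficient of `∂^k` in the product of `a ∂^i` and `b ∂^j`. -/
noncomputable def mulTerm (a b : R) (i j k : ℤ) : R :=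
  if k ≤ i + j then
    Ring.choose i (i + j - k).toNat • (a * (fun c : R => c′)^[(i + j - k).toNat] b)
  else 0

/-- The coefficient of `∂^k` in the product of `∑ A_i ∂^i` and `∑ B_j ∂^j`; only finitely many
pairs `(i, j)` contribute if `A` and `B` vanish in large degrees. -/
noncomputable def mulCoeff (A B : ℤ → R) (k : ℤ) : R :=
  ∑ᶠ p : ℤ × ℤ, mulTerm (A p.1) (B p.2) p.1 p.2 k

theorem iter_add (n : ℕ) (b c : R) :
    (fun c : R => c′)^[n] (b + c) = (fun c : R => c′)^[n] b + (fun c : R => c′)^[n] c := by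
  induction n generalizing b c with
  | zero => rfl
  | succ n ih => simp

theorem iter_zero (n : ℕ) : (fun c : R => c′)^[n] (0 : R) = 0 := by
  induction n with
  | zero => rfl
  | succ n ih => simp

theorem iter_smul (n : ℕ) (z : ℤ) (b : R) :
    (fun c : R => c′)^[n] (z • b) = z • (fun c : R => c′)^[n] b := by
  induction n generalizing b with
  | zero => rfl
  | succ n ih => simp only [Function.iterate_succ, Function.comp, map_zsmul, ih]

theorem iter_sum {ι : Type*} (n : ℕ) (s : Finset ι) (f : ι → R) :
    (fun c : R => c′)^[n] (∑ i ∈ s, f i) = ∑ i ∈ s, (fun c : R => c′)^[n] (f i) := by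
  classical
  induction s using Finset.induction_on with
  | empty => simp
  | insert a s ha ih => rw [sum_insert ha, sum_insert ha, iter_add, ih]

theorem iter_one (n : ℕ) (hn : n ≠ 0) : (fun c : R => c′)^[n] (1 : R) = 0 := by
  obtain ⟨m, rfl⟩ := Nat.exists_eq_succ_of_ne_zero hn
  simp

theorem iter_mul (n : ℕ) (b c : R) :
    (fun c : R => c′)^[n] (b * c) = ∑ p ∈ antidiagonal n,
      n.choose p.1 • ((fun c : R => c′)^[p.1] b * (fun c : R => c′)^[p.2] c) := by
  induction n with
  | zero => simp
  | succ n ih =>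
    rw [Function.iterate_succ_apply', ih, Finset.sum_antidiagonal_choose_succ_nsmul
      (fun i j => (fun c : R => c′)^[i] b * (fun c : R => c′)^[j] c) n, map_sum,
      ← sum_add_distrib]
    refine sum_congr rfl fun p hp => ?_
    have := HasAntidiagonal.mem_antidiagonal.mp hp
    have h2 : n.choose p.2 = n.choose p.1 := by
      rw [← this]; exact Nat.choose_symm_add.symm
    simp only [map_nsmul, Derivation.leibniz, smul_eq_mul, Function.iterate_succ_apply', h2,
      ← smul_add]
    ring

theorem mulTerm_zero_left (b : R) (i j k : ℤ) : mulTerm 0 b i j k = 0 := by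
  simp [mulTerm]

theorem mulTerm_zero_right (a : R) (i j k : ℤ) : mulTerm a 0 i j k = 0 := by
  simp [mulTerm]

theorem mulTerm_add_left (a a' b : R) (i j k : ℤ) :
    mulTerm (a + a') b i j k = mulTerm a b i j k + mulTerm a' b i j k := by
  unfold mulTerm; split_ifs <;> simp [add_mul, smul_add]

theorem mulTerm_add_right (a b b' : R) (i j k : ℤ) :
    mulTerm a (b + b') i j k = mulTerm a b i j k + mulTerm a b' i j k := by
  unfold mulTerm; split_ifs <;> simp [mul_add, smul_add]

theorem mulTerm_sum_left {ι : Type*} (s : Finset ι) (f : ι → R) (b : R) (i j k : ℤ) :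
    mulTerm (∑ x ∈ s, f x) b i j k = ∑ x ∈ s, mulTerm (f x) b i j k := by
  unfold mulTerm; split_ifs <;> simp [sum_mul, smul_sum]

theorem mulTerm_sum_right {ι : Type*} (s : Finset ι) (a : R) (f : ι → R) (i j k : ℤ) :
    mulTerm a (∑ x ∈ s, f x) i j k = ∑ x ∈ s, mulTerm a (f x) i j k := by
  unfold mulTerm; split_ifs <;> simp [iter_sum, mul_sum, smul_sum]

theorem mulCoeff_eq {A B : ℤ → R} {M N : ℤ} (hA : ∀ k, M < k → A k = 0)
    (hB : ∀ k, N < k → B k = 0) (k : ℤ) (I J : Finset ℤ) (hI : Icc (k - N) M ⊆ I)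
    (hJ : Icc (k - M) N ⊆ J) :
    mulCoeff A B k = ∑ i ∈ I, ∑ j ∈ J, mulTerm (A i) (B j) i j k := by
  rw [mulCoeff, ← sum_product']
  apply finsum_eq_sum_of_support_subset
  intro p hp
  rw [Function.mem_support] at hp
  have h1 : p.1 ≤ M := by
    by_contra h
    exact hp (by rw [hA _ (not_le.mp h), mulTerm_zero_left])
  have h2 : p.2 ≤ N := by
    by_contra h
    exact hp (by rw [hB _ (not_le.mp h), mulTerm_zero_right])
  have h3 : k ≤ p.1 + p.2 := by
    by_contra h
    exact hp (by rw [mulTerm, if_neg h])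
  rw [mem_coe, mem_product]
  exact ⟨hI (mem_Icc.mpr ⟨by omega, h1⟩), hJ (mem_Icc.mpr ⟨by omega, h2⟩)⟩

theorem mulCoeff_eq_zero {A B : ℤ → R} {M N : ℤ} (hA : ∀ k, M < k → A k = 0)
    (hB : ∀ k, N < k → B k = 0) (k : ℤ) (hk : M + N < k) : mulCoeff A B k = 0 := by
  rw [mulCoeff_eq hA hB k ∅ ∅ (by rw [Icc_eq_empty (by omega)])
    (by rw [Icc_eq_empty (by omega)]), sum_empty]

noncomputable instance : Mul (PDO R) where
  mul A B := ⟨mulCoeff A.coeff B.coeff, by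
    obtain ⟨M, hM⟩ := A.bdd
    obtain ⟨N, hN⟩ := B.bdd
    exact ⟨M + N, mulCoeff_eq_zero hM hN⟩⟩

noncomputable instance : One (PDO R) := ⟨mono 0 1⟩

theorem coeff_mul (A B : PDO R) (k : ℤ) :
    (A * B).coeff k = ∑ᶠ p : ℤ × ℤ, mulTerm (A.coeff p.1) (B.coeff p.2) p.1 p.2 k := rfl

theorem assoc_nat (i j : ℤ) (N : ℕ) (b c : R) :
    ∑ p ∈ antidiagonal N, (Ring.choose i p.1 * Ring.choose (i + j - p.1) p.2) •
        ((fun c : R => c′)^[p.1] b * (fun c : R => c′)^[p.2] c) =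
      ∑ p ∈ antidiagonal N, (Ring.choose i p.1 * Ring.choose j p.2) •
        (fun c : R => c′)^[p.1] (b * (fun c : R => c′)^[p.2] c) := by
  have hV : ∀ p ∈ antidiagonal N, (Ring.choose i p.1 * Ring.choose (i + j - p.1) p.2) •
        ((fun c : R => c′)^[p.1] b * (fun c : R => c′)^[p.2] c) =
      ∑ r ∈ antidiagonal p.2, (Ring.choose i p.1 * (Ring.choose (i - p.1) r.1 *
        Ring.choose j r.2)) • ((fun c : R => c′)^[p.1] b *
          (fun c : R => c′)^[r.1 + r.2] c) := by
    intro p _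
    rw [show i + j - (p.1 : ℤ) = (i - p.1) + j by ring, Ring.add_choose_eq _ (Commute.all _ _),
      mul_sum, sum_smul]
    exact sum_congr rfl fun r hr => by rw [HasAntidiagonal.mem_antidiagonal.mp hr]
  rw [sum_congr rfl hV]
  have hL : ∀ p ∈ antidiagonal N, (Ring.choose i p.1 * Ring.choose j p.2) •
        (fun c : R => c′)^[p.1] (b * (fun c : R => c′)^[p.2] c) =
      ∑ r ∈ antidiagonal p.1, (Ring.choose i r.1 * (Ring.choose (i - r.1) r.2 *
        Ring.choose j p.2)) • ((fun c : R => c′)^[r.1] b *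
          (fun c : R => c′)^[r.2 + p.2] c) := by
    intro p _
    rw [iter_mul, smul_sum]
    refine sum_congr rfl fun r hr => ?_
    have hr' := HasAntidiagonal.mem_antidiagonal.mp hr
    have hc := Ring.choose_smul_choose i (n := p.1) (k := r.1) (by omega)
    rw [show p.1 - r.1 = r.2 by omega] at hc
    rw [← Function.iterate_add_apply, ← natCast_zsmul, smul_smul, ← mul_assoc, ← hc,
      nsmul_eq_mul]
    congr 1
    ring
  rw [sum_congr rfl hL, sum_sigma', sum_sigma']
  refine (Finset.sum_bij' (fun x _ => ⟨(x.1.1 + x.2.1, x.2.2), (x.1.1, x.2.1)⟩)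
    (fun x _ => ⟨(x.2.1, x.2.2 + x.1.2), (x.2.2, x.1.2)⟩) ?_ ?_ ?_ ?_ ?_)
  · rintro ⟨⟨a, b⟩, ⟨c, d⟩⟩ h
    simp only [mem_sigma, HasAntidiagonal.mem_antidiagonal] at h ⊢
    obtain ⟨h1, h2⟩ := h
    exact ⟨by omega, by dsimp only⟩
  · rintro ⟨⟨a, b⟩, ⟨c, d⟩⟩ h
    simp only [mem_sigma, HasAntidiagonal.mem_antidiagonal] at h ⊢
    obtain ⟨h1, h2⟩ := h
    exact ⟨by omega, by dsimp only⟩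
  · rintro ⟨⟨a, b⟩, ⟨c, d⟩⟩ h
    simp only [mem_sigma, HasAntidiagonal.mem_antidiagonal] at h
    obtain ⟨h1, h2⟩ := h
    subst h2; rfl
  · rintro ⟨⟨a, b⟩, ⟨c, d⟩⟩ h
    simp only [mem_sigma, HasAntidiagonal.mem_antidiagonal] at h
    obtain ⟨h1, h2⟩ := h
    subst h2; rfl
  · rintro ⟨⟨a, b⟩, ⟨c, d⟩⟩ h
    rfl

theorem mulTerm_assoc (a b c : R) (i j k n : ℤ) (H : Finset ℤ)
    (h1 : Icc (n - k) (i + j) ⊆ H) (h2 : Icc (n - i) (j + k) ⊆ H) :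
    ∑ h ∈ H, mulTerm (mulTerm a b i j h) c h k n =
      ∑ g ∈ H, mulTerm a (mulTerm b c j k g) i g n := by
  rcases lt_or_ge (i + j + k) n with hn | hn
  · rw [sum_eq_zero, sum_eq_zero]
    · intro g _
      unfold mulTerm
      split_ifs <;> first | omega | simp
    · intro g _
      unfold mulTerm
      split_ifs <;> first | omega | simp
  · obtain ⟨N, hN⟩ := Int.eq_ofNat_of_zero_le (show 0 ≤ i + j + k - n by omega)
    rw [sum_eq_antidiagonal N (i + j) _ (by rwa [show i + j - (N : ℤ) = n - k by omega]),
      sum_eq_antidiagonal N (j + k) _ (by rwa [show j + k - (N : ℤ) = n - i by omega])]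
    · have e := congrArg (fun z => a * z) (assoc_nat i j N b c)
      simp only [mul_sum] at e
      refine Eq.trans (sum_congr rfl fun p hp => ?_)
        (e.trans (Eq.trans (Finset.sum_equiv (Equiv.prodComm ℕ ℕ)
          (g := fun p : ℕ × ℕ => (Ring.choose i p.2 * Ring.choose j p.1) •
            (a * (fun c : R => c′)^[p.2] (b * (fun c : R => c′)^[p.1] c))) ?_ ?_)
        (sum_congr rfl fun p hp => ?_)))
      · have hp' := HasAntidiagonal.mem_antidiagonal.mp hp
        unfold mulTerm
        rw [if_pos (by omega), if_pos (by omega),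
          show (i + j - (i + j - (p.1 : ℤ))).toNat = p.1 by omega,
          show (i + j - (p.1 : ℤ) + k - n).toNat = p.2 by omega]
        rw [smul_mul_assoc, smul_smul, mul_smul_comm, mul_assoc, mul_comm (Ring.choose i p.1)]
      · rintro ⟨x, y⟩
        simp only [HasAntidiagonal.mem_antidiagonal, Equiv.prodComm_apply, Prod.swap_prod_mk]
        omega
      · rintro ⟨x, y⟩ _
        simp only [Equiv.prodComm_apply, Prod.swap_prod_mk, mul_smul_comm]
      · have hp' := HasAntidiagonal.mem_antidiagonal.mp hp
        unfold mulTerm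
        rw [if_pos (by omega), if_pos (by omega),
          show (j + k - (j + k - (p.1 : ℤ))).toNat = p.1 by omega,
          show (i + (j + k - (p.1 : ℤ)) - n).toNat = p.2 by omega]
        rw [iter_smul, mul_smul_comm, smul_smul]
    · intro h hh
      simp only [mem_Icc, not_and_or, not_le] at hh
      unfold mulTerm
      split_ifs <;> first | omega | simp
    · intro h hh
      simp only [mem_Icc, not_and_or, not_le] at hh
      unfold mulTerm
      split_ifs <;> first | omega | simp

protected theorem mul_assoc (A B C : PDO R) : A * B * C = A * (B * C) := by
  obtain ⟨MA, hA⟩ := A.bdd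
  obtain ⟨MB, hB⟩ := B.bdd
  obtain ⟨MC, hC⟩ := C.bdd
  set M := max (max MA MB) MC with hM
  replace hA : ∀ k, M < k → A.coeff k = 0 := fun k hk => hA k (by omega)
  replace hB : ∀ k, M < k → B.coeff k = 0 := fun k hk => hB k (by omega)
  replace hC : ∀ k, M < k → C.coeff k = 0 := fun k hk => hC k (by omega)
  have hAB : ∀ k, M + M < k → (A * B).coeff k = 0 := mulCoeff_eq_zero hA hB
  have hBC : ∀ k, M + M < k → (B * C).coeff k = 0 := mulCoeff_eq_zero hB hC
  refine PDO.ext fun n => ?_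
  set F := Icc (n - (M + M)) M with hF
  set H := Icc (n - M) (M + M) with hH
  have e1 : (A * B * C).coeff n = ∑ h ∈ H, ∑ k ∈ F, mulTerm ((A * B).coeff h) (C.coeff k) h k n :=
    mulCoeff_eq hAB hC n H F subset_rfl subset_rfl
  have e2 : (A * (B * C)).coeff n =
      ∑ i ∈ F, ∑ g ∈ H, mulTerm (A.coeff i) ((B * C).coeff g) i g n :=
    mulCoeff_eq hA hBC n F H subset_rfl subset_rfl
  have e3 : ∀ h ∈ H, (A * B).coeff h =
      ∑ i ∈ F, ∑ j ∈ F, mulTerm (A.coeff i) (B.coeff j) i j h := fun h hh => by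
    have := (mem_Icc.mp hh).1
    exact mulCoeff_eq hA hB h F F (Icc_subset_Icc (by omega) le_rfl)
      (Icc_subset_Icc (by omega) le_rfl)
  have e4 : ∀ g ∈ H, (B * C).coeff g =
      ∑ j ∈ F, ∑ k ∈ F, mulTerm (B.coeff j) (C.coeff k) j k g := fun h hh => by
    have := (mem_Icc.mp hh).1
    exact mulCoeff_eq hB hC h F F (Icc_subset_Icc (by omega) le_rfl)
      (Icc_subset_Icc (by omega) le_rfl)
  have l1 : (A * B * C).coeff n = ∑ i ∈ F, ∑ j ∈ F, ∑ k ∈ F, ∑ h ∈ H,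
      mulTerm (mulTerm (A.coeff i) (B.coeff j) i j h) (C.coeff k) h k n := by
    rw [e1, sum_congr rfl fun h hh => by rw [e3 h hh]]
    simp only [mulTerm_sum_left]
    rw [sum_comm, sum_congr rfl fun k _ => sum_comm, sum_comm]
    refine sum_congr rfl fun i _ => ?_
    rw [sum_congr rfl fun k _ => sum_comm, sum_comm]
  have l2 : (A * (B * C)).coeff n = ∑ i ∈ F, ∑ j ∈ F, ∑ k ∈ F, ∑ g ∈ H,
      mulTerm (A.coeff i) (mulTerm (B.coeff j) (C.coeff k) j k g) i g n := by
    rw [e2, sum_congr rfl fun i _ => sum_congr rfl fun g hg => by rw [e4 g hg]]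
    simp only [mulTerm_sum_right]
    refine sum_congr rfl fun i _ => ?_
    rw [sum_comm]
    refine sum_congr rfl fun j _ => ?_
    rw [sum_comm]
  rw [l1, l2]
  refine sum_congr rfl fun i hi => sum_congr rfl fun j hj => sum_congr rfl fun k hk => ?_
  have hi' := mem_Icc.mp hi
  have hj' := mem_Icc.mp hj
  have hk' := mem_Icc.mp hk
  exact mulTerm_assoc _ _ _ i j k n H (Icc_subset_Icc (by omega) (by omega))
    (Icc_subset_Icc (by omega) (by omega))

protected theorem one_mul (A : PDO R) : 1 * A = A := by
  refine PDO.ext fun k => ?_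
  rw [coeff_mul, finsum_eq_single _ (0, k)]
  · change mulTerm ((mono 0 (1 : R)).coeff 0) (A.coeff k) 0 k k = _
    simp [coeff_mono, mulTerm]
  · rintro ⟨i, j⟩ hp
    change mulTerm ((mono 0 (1 : R)).coeff i) (A.coeff j) i j k = 0
    rw [coeff_mono]
    split_ifs with hi
    · subst hi
      unfold mulTerm
      split_ifs with hk
      · have : (0 + j - k).toNat ≠ 0 := by
          intro h0
          apply hp
          ext <;> simp
          omega
        rw [Ring.choose_zero_pos ℤ (Nat.pos_of_ne_zero this), zero_smul]
      · rfl
    · exact mulTerm_zero_left _ _ _ _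

protected theorem mul_one (A : PDO R) : A * 1 = A := by
  refine PDO.ext fun k => ?_
  rw [coeff_mul, finsum_eq_single _ (k, 0)]
  · change mulTerm (A.coeff k) ((mono 0 (1 : R)).coeff 0) k 0 k = _
    simp [coeff_mono, mulTerm]
  · rintro ⟨i, j⟩ hp
    change mulTerm (A.coeff i) ((mono 0 (1 : R)).coeff j) i j k = 0
    rw [coeff_mono]
    split_ifs with hj
    · subst hj
      unfold mulTerm
      split_ifs with hk
      · have : (i + 0 - k).toNat ≠ 0 := by
          intro h0
          apply hp
          ext <;> simp
          omega
        rw [iter_one _ this, mul_zero, smul_zero]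
      · rfl
    · exact mulTerm_zero_right _ _ _ _

protected theorem left_distrib (A B C : PDO R) : A * (B + C) = A * B + A * C := by
  obtain ⟨MA, hA⟩ := A.bdd
  obtain ⟨MB, hB⟩ := B.bdd
  obtain ⟨MC, hC⟩ := C.bdd
  set N := max MB MC with hN
  replace hB : ∀ k, N < k → B.coeff k = 0 := fun k hk => hB k (by omega)
  replace hC : ∀ k, N < k → C.coeff k = 0 := fun k hk => hC k (by omega)
  have hS : ∀ k, N < k → (B + C).coeff k = 0 := fun k hk => by
    rw [coeff_add, hB k hk, hC k hk, add_zero]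
  refine PDO.ext fun k => ?_
  change mulCoeff A.coeff (B + C).coeff k = mulCoeff A.coeff B.coeff k + mulCoeff A.coeff C.coeff k
  rw [mulCoeff_eq hA hS k _ _ subset_rfl subset_rfl, mulCoeff_eq hA hB k _ _ subset_rfl subset_rfl,
    mulCoeff_eq hA hC k _ _ subset_rfl subset_rfl]
  simp only [coeff_add, mulTerm_add_right, sum_add_distrib]

protected theorem right_distrib (A B C : PDO R) : (A + B) * C = A * C + B * C := by
  obtain ⟨MA, hA⟩ := A.bdd
  obtain ⟨MB, hB⟩ := B.bdd
  obtain ⟨MC, hC⟩ := C.bdd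
  set N := max MA MB with hN
  replace hA : ∀ k, N < k → A.coeff k = 0 := fun k hk => hA k (by omega)
  replace hB : ∀ k, N < k → B.coeff k = 0 := fun k hk => hB k (by omega)
  have hS : ∀ k, N < k → (A + B).coeff k = 0 := fun k hk => by
    rw [coeff_add, hA k hk, hB k hk, add_zero]
  refine PDO.ext fun k => ?_
  change mulCoeff (A + B).coeff C.coeff k = mulCoeff A.coeff C.coeff k + mulCoeff B.coeff C.coeff k
  rw [mulCoeff_eq hS hC k _ _ subset_rfl subset_rfl, mulCoeff_eq hA hC k _ _ subset_rfl subset_rfl,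
    mulCoeff_eq hB hC k _ _ subset_rfl subset_rfl]
  simp only [coeff_add, mulTerm_add_left, sum_add_distrib]

protected theorem zero_mul (A : PDO R) : 0 * A = 0 := by
  have := PDO.right_distrib (0 : PDO R) 0 A
  rwa [add_zero, left_eq_add] at this

protected theorem mul_zero (A : PDO R) : A * 0 = 0 := by
  have := PDO.left_distrib A (0 : PDO R) 0
  rwa [add_zero, left_eq_add] at this

noncomputable instance : Ring (PDO R) where
  __ := (inferInstance : AddCommGroup (PDO R))
  left_distrib := PDO.left_distrib
  right_distrib := PDO.right_distrib
  zero_mul := PDO.zero_mul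
  mul_zero := PDO.mul_zero
  mul_assoc := PDO.mul_assoc
  one_mul := PDO.one_mul
  mul_one := PDO.mul_one

end Mul

end PDO

namespace PDO

variable {R : Type*} [CommRing R]

/-- The operator with prescribed coefficients (`0` if they do not vanish in large degrees). -/
noncomputable def ofCoeffs (f : ℤ → R) : PDO R :=
  open Classical in if h : ∃ M : ℤ, ∀ k, M < k → f k = 0 then ⟨f, h⟩ else 0

/-- The differential part `A₊`. -/
def plus (A : PDO R) : PDO R :=
  ⟨fun k => if 0 ≤ k then A.coeff k else 0, by
    obtain ⟨M, hM⟩ := A.bdd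
    exact ⟨M, fun k hk => by simp [hM k hk]⟩⟩

/-- The integral part `A₋ = A - A₊`. -/
def minus (A : PDO R) : PDO R := A - A.plus

/-- Apply a ring homomorphism to all coefficients. -/
def mapCoeffs {S : Type*} [CommRing S] (φ : R →+* S) (A : PDO R) : PDO S :=
  ⟨fun k => φ (A.coeff k), by
    obtain ⟨M, hM⟩ := A.bdd
    exact ⟨M, fun k hk => by simp [hM k hk]⟩⟩

end PDO

/-! ## Functions of `x` and of the times, and operators with such coefficients -/

/-- The differential ring given by an additive map satisfying the Leibniz rule. -/
@[reducible] def differentialOf {R : Type*} [CommRing R] (d : R →+ R)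
    (h : ∀ a b, d (a * b) = a * d b + b * d a) : Differential R :=
  ⟨Derivation.mk' d.toIntLinearMap h⟩

/-- `S⟦x⟧` with the derivation `d/dx`. -/
noncomputable instance (S : Type*) [CommRing S] : Differential (PowerSeries S) :=
  differentialOf (PowerSeries.derivative S).toLinearMap.toAddMonoidHom
    fun a b => (PowerSeries.derivative S).leibniz a b

/-- Formal power series in `x` and the times `q_{γ,n}`, as power series in the times with
coefficients in `S⟦x⟧`. -/
abbrev Fun (ι S : Type*) : Type _ := MvPowerSeries (ι × ℕ) (PowerSeries S)

/-- Formal power series in the times with coefficients in the pseudo-differential operators in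
`x`. The order of such an operator may grow with the monomial in the times, as it does for
`∑ n, q_{γ,n} ∂^n`. -/
abbrev Op (ι S : Type*) [CommRing S] : Type _ := MvPowerSeries (ι × ℕ) (PDO (PowerSeries S))

/-- A sum of a sequence of power series, coefficient by coefficient. -/
noncomputable def fsum {σ R : Type*} [Semiring R] (f : ℕ → MvPowerSeries σ R) :
    MvPowerSeries σ R :=
  fun m => ∑ᶠ n, MvPowerSeries.coeff m (f n)

section Operators

variable {ι S : Type*} [CommRing S]

/-- `∂/∂x` on functions. -/
noncomputable def dx (f : Fun ι S) : Fun ι S := fun m => (MvPowerSeries.coeff m f)′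

/-- Multiplication by a function, an operator of order zero. -/
noncomputable def ofFun (f : Fun ι S) : Op ι S := fun m => PDO.mono 0 (MvPowerSeries.coeff m f)

/-- The operator `(s ∂)^n`, `n ∈ ℤ`. -/
noncomputable def sd {K : Type*} [Field K] [Algebra K S] (s : K) (n : ℤ) : Op ι S :=
  (s ^ n) • MvPowerSeries.C (PDO.mono n 1)

/-- The coefficient of `∂^k`. -/
noncomputable def coeffD (k : ℤ) (A : Op ι S) : Fun ι S := fun m => (MvPowerSeries.coeff m A).coeff k

/-- The residue `Res_∂`, the coefficient of `∂^{-1}`. -/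
noncomputable def res (A : Op ι S) : Fun ι S := coeffD (-1) A

/-- `A₊`. -/
noncomputable def plus (A : Op ι S) : Op ι S := fun m => (MvPowerSeries.coeff m A).plus

/-- `A₋`. -/
noncomputable def minus (A : Op ι S) : Op ι S := fun m => (MvPowerSeries.coeff m A).minus

/-- A sum of a sequence of operators, coefficient by coefficient in the times and in `∂`. -/
noncomputable def opSum (G : ℕ → Op ι S) : Op ι S :=
  fun m => PDO.ofCoeffs fun k => ∑ᶠ n, (MvPowerSeries.coeff m (G n)).coeff k

end Operators

/-! ## Vertex operators and tau functions of the KdV hierarchy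

Throughout `s = √ħ`. -/

/-- `a_n = 1 / (2n+1)!!`. -/
noncomputable def ca (K : Type*) [Field K] (n : ℕ) : K := ((Nat.doubleFactorial (2 * n + 1) : ℕ) : K)⁻¹

/-- `b_n = (2n-1)!!`, with `b_0 = 1`. -/
def cb (K : Type*) [Field K] (n : ℕ) : K := (Nat.doubleFactorial (2 * n - 1) : ℕ)

/-- `exp f = ∑ j, f^j / j!` for a power series `f` without constant term. -/
noncomputable def expSeries (K : Type*) {B : Type*} [Field K] [Ring B] [Module K B]
    (f : PowerSeries B) : PowerSeries B :=
  PowerSeries.mk fun k => ∑ j ∈ range (k + 1), ((j.factorial : K)⁻¹) • PowerSeries.coeff k (f ^ j)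

/-- `Γ₋(λ) = exp(-s ∑ b_n λ^{-2n-1} ∂/∂q_{v n})` as a power series in `λ^{-1}` with coefficients in
the differential operators in the times, for the times `q_{v 0}, q_{v 1}, …`. -/
noncomputable def gammaMinus {K : Type*} [Field K] (s : K) {σ : Type*} (v : ℕ → σ)
    (R : Type*) [CommRing R] [Algebra K R] :
    PowerSeries (Module.End R (MvPowerSeries σ R)) :=
  expSeries K (PowerSeries.mk fun k =>
    if Odd k then (-(s * cb K (k / 2))) • (MvPowerSeries.pderiv R (v (k / 2))).toLinearMap else 0)

/-- `Γ₊(λ) = exp(s⁻¹ ∑ a_n λ^{2n+1} q_n)` as a power series in `λ`. -/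
noncomputable def gammaPlus {K : Type*} [Field K] (s : K) : PowerSeries (MvPowerSeries ℕ K) :=
  expSeries K (PowerSeries.mk fun k =>
    if Odd k then (s⁻¹ * ca K (k / 2)) • MvPowerSeries.X (k / 2) else 0)

/-- The coefficient of `λ^k` in `Γ₊(λ) Γ₋(λ) τ`. For a given monomial in the times only finitely
many terms contribute, and none if `k` is large. -/
noncomputable def wave {K : Type*} [Field K] (s : K) (τ : MvPowerSeries ℕ K) (k : ℤ) :
    MvPowerSeries ℕ K :=
  fun m => ∑ᶠ p : ℕ × ℕ, if (p.1 : ℤ) - p.2 = k then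
    MvPowerSeries.coeff m (PowerSeries.coeff p.1 (gammaPlus s) *
      PowerSeries.coeff p.2 (gammaMinus s id K) τ) else 0

/-- Tau functions of KdV: `τ` has a non-zero constant term and satisfies the Hirota quadratic
equations `Res_λ λ^{2n} (Γ(λ)τ)(q) (Γ(-λ)τ)(q') dλ = 0`, `n ≥ 0`, which are read coefficient by
coefficient in the two independent sets of times `q` and `q'`. -/
def IsKdVTau {K : Type*} [Field K] (s : K) (τ : MvPowerSeries ℕ K) : Prop :=
  MvPowerSeries.constantCoeff τ ≠ 0 ∧
    ∀ (n : ℕ) (m m' : ℕ →₀ ℕ), ∑ᶠ k : ℤ, MvPowerSeries.coeff m (wave s τ k) *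
      (((-1 - 2 * (n : ℤ) - k).negOnePow : ℤ) •
        MvPowerSeries.coeff m' (wave s τ (-1 - 2 * (n : ℤ) - k))) = 0

section Deformation

variable {K : Type*} [Field K] {ι : Type*} [Fintype ι]

/-- The tau function `∏ τ_γ(q_γ)` of several copies of KdV. -/
noncomputable def prodTau (τ : ι → MvPowerSeries ℕ K) : MvPowerSeries (ι × ℕ) K :=
  ∏ γ, MvPowerSeries.rename
    (⟨Prod.mk γ, fun _ _ h => (Prod.mk.inj h).2⟩ : ℕ ↪ ι × ℕ) (τ γ)

/-- The quantization of `r_ℓ z^ℓ`, up to the factor `(-1)^{ℓ-1}`: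
`∑_{α,β} (r_ℓ)_{αβ} (∑_i q_{α,i} ∂/∂q_{β,ℓ+i} + ħ/2 ∑_{i+j=ℓ-1} (-1)^{i+1} ∂²/∂q_{α,i}∂q_{β,j})`. -/
noncomputable def rHat (s : K) (ℓ : ℕ) (r : Matrix ι ι K) (τ : MvPowerSeries (ι × ℕ) K) :
    MvPowerSeries (ι × ℕ) K :=
  ∑ α, ∑ β, r α β •
    (fsum (fun i => MvPowerSeries.X (α, i) * MvPowerSeries.pderivFun (β, ℓ + i) τ) +
      (s ^ 2 / 2) • ∑ i ∈ range ℓ, ((-1 : K) ^ (i + 1)) •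
        MvPowerSeries.pderivFun (α, i) (MvPowerSeries.pderivFun (β, ℓ - 1 - i) τ))

/-- `exp(ε r̂) τ = τ + ε r̂ τ` over the dual numbers, that is, up to `O(ε²)`. -/
noncomputable def deformedTau (s : K) (ℓ : ℕ) (r : Matrix ι ι K) (τ : MvPowerSeries (ι × ℕ) K) :
    MvPowerSeries (ι × ℕ) (DualNumber K) :=
  MvPowerSeries.map (algebraMap K (DualNumber K)) τ +
    (DualNumber.eps : DualNumber K) •
      MvPowerSeries.map (algebraMap K (DualNumber K)) (rHat s ℓ r τ)

/-- The derivation `∑_γ ∂/∂q_{γ,0}`. -/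
noncomputable def shiftDeriv {S : Type*} [CommRing S] (f : MvPowerSeries (ι × ℕ) S) :
    MvPowerSeries (ι × ℕ) S :=
  ∑ γ, MvPowerSeries.pderivFun (γ, 0) f

/-- The function of `x` and the times obtained from `f` by the substitution
`q_{γ,0} ↦ q_{γ,0} + x` for all `γ`, through Taylor's formula. -/
noncomputable def shift (K : Type*) [Field K] {S : Type*} [CommRing S] [Algebra K S]
    (f : MvPowerSeries (ι × ℕ) S) : Fun ι S :=
  fun m => PowerSeries.mk fun k =>
    ((k.factorial : K)⁻¹) • MvPowerSeries.coeff m (shiftDeriv^[k] f)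

/-! ### Objects attached to a tau function `T(x, q)` -/

section Tau

variable {S : Type*} [CommRing S] [Algebra K S]

/-- `∂ log T / ∂q_v`. -/
noncomputable def logDeriv (T : Fun ι S) (v : ι × ℕ) : Fun ι S :=
  MvPowerSeries.pderivFun v T * Ring.inverse T

/-- The two-point function `Ω_{v;w} = ħ ∂² log T / ∂q_v ∂q_w`. -/
noncomputable def twoPoint (s : K) (T : Fun ι S) (v w : ι × ℕ) : Fun ι S :=
  (s ^ 2) • MvPowerSeries.pderivFun v (logDeriv T w)

/-- The dressing operator `P_α(s∂)`, whose symbol is `P_α(λ) = (Γ_{α,-}(λ) T) / T`. -/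
noncomputable def dressing (s : K) (T : Fun ι S) (α : ι) : Op ι S :=
  opSum fun k =>
    ofFun (PowerSeries.coeff k (gammaMinus s (fun n => (α, n)) (PowerSeries S)) T *
      Ring.inverse T) * sd s (-(k : ℤ))

/-- `L_α^{n/2} = P_α (s∂)^n P_α⁻¹`; in particular `L_α = P_α ħ∂² P_α⁻¹` is the Lax operator. -/
noncomputable def laxHalfPow (s : K) (T : Fun ι S) (α : ι) (n : ℤ) : Op ι S :=
  dressing s T α * sd s n * Ring.inverse (dressing s T α)

/-- The function `u_α`: the differential part of the Lax operator is `ħ∂² + 2 u_α`. -/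
noncomputable def potential (s : K) (T : Fun ι S) (α : ι) : Fun ι S :=
  (2⁻¹ : K) • coeffD 0 (laxHalfPow s T α 2)

end Tau

/-! ### The deformed Sato-Wilson equations -/

/-- `d_ℓ = 1/2 ∑_{i+j=ℓ-1} (-1)^{j+1} a_i a_j`. -/
noncomputable def cd (K : Type*) [Field K] (ℓ : ℕ) : K :=
  2⁻¹ * ∑ i ∈ range ℓ, (-1) ^ (ℓ - 1 - i + 1) * (ca K i * ca K (ℓ - 1 - i))

/-- The time `q_{β,j}`, with `q_{β,0}` replaced by `q_{β,0} + x`. -/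
noncomputable def time (K : Type*) [Field K] (β : ι) (j : ℕ) : Fun ι K :=
  MvPowerSeries.X (β, j) + if j = 0 then MvPowerSeries.C PowerSeries.X else 0

/-- The operator `Q_α`. The vertex operator `Γ_α = Γ_{α,+} Γ_{α,-}`, conjugated by `exp(ε r̂)`, is
`R_{α,+} Γ_{α,+} R_{α,-} Γ_{α,-}` up to `O(ε²)` with
`R_{α,+}(λ) = exp(ε (r_ℓ)_{αα} d_ℓ λ^{2ℓ}) ·
  exp(ε (-1)^{ℓ-1} s⁻¹ ∑_β (r_ℓ)_{αβ} ∑_{n ≥ ℓ} a_n λ^{2n+1} q_{β,n-ℓ})`,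
`R_{α,-}(λ) = exp(ε s ∑_β (r_ℓ)_{αβ} ∑_{n < ℓ} (-1)^{n+1} a_n λ^{2n+1} ∂/∂q_{β,ℓ-1-n}) ·
  exp(ε s ∑_β (r_ℓ)_{αβ} ∑_{n ≥ 0} b_n λ^{-2n-1} ∂/∂q_{β,n+ℓ})`,
and the symbol of `P_α + ε Q_α` is `R_{α,-}(P_α) · (R_{α,-}(T) / T) · R_{α,+}`, where
`q_{β,0}` is shifted by `x`. As `ε Q_α` only matters up to `O(ε²)`, the undeformed `T` and `P_α`
are used. -/
noncomputable def opQ (s : K) (ℓ : ℕ) (r : Matrix ι ι K) (T : Fun ι K) (α : ι) : Op ι K :=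
  let P := dressing s T α
  let D : ι × ℕ → Op ι K := fun v => MvPowerSeries.pderivFun v P + ofFun (logDeriv T v) * P
  (r α α * cd K ℓ) • (P * sd s (2 * ℓ)) +
  s • ∑ β, r α β • (∑ n ∈ range ℓ,
      ((-1) ^ (n + 1) * ca K n) • (D (β, ℓ - 1 - n) * sd s (2 * n + 1)) +
    opSum fun n => cb K n • (D (β, n + ℓ) * sd s (-(2 * n) - 1))) +
  ((-1) ^ (ℓ - 1) * s⁻¹) • ∑ β, r α β • opSum fun j =>
    ca K (ℓ + j) • (ofFun (time K β j) * P * sd s (2 * (ℓ + j) + 1))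

/-- `Q_α P_α⁻¹`. -/
noncomputable def opQP (s : K) (ℓ : ℕ) (r : Matrix ι ι K) (T : Fun ι K) (α : ι) : Op ι K :=
  opQ s ℓ r T α * Ring.inverse (dressing s T α)

/-- Extension of scalars from `K` to the dual numbers, for functions. -/
noncomputable def extFun (f : Fun ι K) : Fun ι (DualNumber K) :=
  MvPowerSeries.map (PowerSeries.map (algebraMap K (DualNumber K))) f

/-- Extension of scalars from `K` to the dual numbers, for operators. -/
noncomputable def extOp (A : Op ι K) : Op ι (DualNumber K) :=
  fun m => PDO.mapCoeffs (PowerSeries.map (algebraMap K (DualNumber K))) (MvPowerSeries.coeff m A)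

variable [DecidableEq ι]

/-- The operator to which the deformed Sato-Wilson equation equates
`(∂P_{α,R}/∂q_{β,p}) P_{α,R}⁻¹`:
`- δ_{αβ} (a_p/s) (L_{α,R}^{p+1/2})₋
  - ε (∂(Q_α P_α⁻¹)/∂q_{β,p} - δ_{αβ} (a_p/s) [(L_α^{p+1/2})₊, Q_α P_α⁻¹])₋`. -/
noncomputable def satoWilsonRHS (s : K) (ℓ : ℕ) (r : Matrix ι ι K) (τ : MvPowerSeries (ι × ℕ) K)
    (α β : ι) (p : ℕ) : Op ι (DualNumber K) :=
  let T := shift K τ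
  let TR := shift K (deformedTau s ℓ r τ)
  let δ : K := if α = β then 1 else 0
  let B := plus (laxHalfPow s T α (2 * p + 1))
  let W := opQP s ℓ r T α
  (-(δ * (ca K p * s⁻¹))) • minus (laxHalfPow s TR α (2 * p + 1)) -
    (DualNumber.eps : DualNumber K) • extOp (minus
      (MvPowerSeries.pderivFun (β, p) W - (δ * (ca K p * s⁻¹)) • (B * W - W * B)))

end Deformation

/-! ## Two-point functions as differential polynomials, and the Hamiltonian deformation formula -/

/-- The derivation `∂_x = ∑ n, u_{n+1} ∂/∂u_n` of polynomials in `u_0, u_1, …`. -/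
noncomputable def totalDeriv (K : Type*) [Field K] :
    Derivation K (MvPolynomial ℕ K) (MvPolynomial ℕ K) :=
  MvPolynomial.mkDerivation K fun n => MvPolynomial.X (n + 1)

/-- The ring of differential polynomials in one function `u`, with variables `u_n = ∂_x^n u`. -/
noncomputable instance (K : Type*) [Field K] : Differential (MvPolynomial ℕ K) :=
  differentialOf (totalDeriv K).toLinearMap.toAddMonoidHom fun a b => (totalDeriv K).leibniz a b

/-- The universal Lax operator `ħ∂² + 2u`. -/
noncomputable def univLax {K : Type*} [Field K] (s : K) : PDO (MvPolynomial ℕ K) :=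
  PDO.mono 2 (MvPolynomial.C (s ^ 2)) + PDO.mono 0 (2 * MvPolynomial.X 0)

/-- The square root of the universal Lax operator, the unique operator of the form
`s∂ + (lower order)` with square `ħ∂² + 2u`. -/
noncomputable def univSqrt {K : Type*} [Field K] (s : K) : PDO (MvPolynomial ℕ K) :=
  Classical.epsilon fun A => A * A = univLax s ∧ A.coeff 1 = MvPolynomial.C s ∧
    ∀ k, 1 < k → A.coeff k = 0

/-- The differential polynomial `s a_p Res_∂ (ħ∂² + 2u)^{p+1/2}` which expresses
`Ω_{α,0;α,p}` of one copy of KdV. -/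
noncomputable def omegaPoly {K : Type*} [Field K] (s : K) (p : ℕ) : MvPolynomial ℕ K :=
  (s * ca K p) • ((univSqrt s) ^ (2 * p + 1)).coeff (-1)

section Hamiltonian

variable {K : Type*} [Field K] {ι : Type*} [Fintype ι] [DecidableEq ι]

/-- `Ω_{α,0;β,p}` of several copies of KdV as a differential polynomial in the `u_γ`, with
variables `u_{γ,n} = ∂_x^n u_γ`; it vanishes for `α ≠ β`. -/
noncomputable def omegaMulti (s : K) (α β : ι) (p : ℕ) : MvPolynomial (ι × ℕ) K :=
  if α = β then MvPolynomial.rename (Prod.mk α) (omegaPoly s p) else 0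

/-- Substitution of `∂_x^n u_γ` for `u_{γ,n}`. -/
noncomputable def evalJet {S : Type*} [CommRing S] [Algebra K S] (u : ι → Fun ι S)
    (f : MvPolynomial (ι × ℕ) K) : Fun ι S :=
  MvPolynomial.aeval (fun v : ι × ℕ => dx^[v.2] (u v.1)) f

/-- The deformation formula for `Ω_{α,0;β,p}` in Hamiltonian form, evaluated on the tau function
`T` of several copies of KdV. Indices are raised and lowered by
`r^{βα} = r^α_β = r_{αβ}`, so `r_α^μ` is `r μ α` and `r^{μν}` is `r ν μ`; `one v` is
`Ω_{v;𝟙,0} = ∑_ν Ω_{v;ν,0}`. -/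
noncomputable def hamDeformation (s : K) (ℓ : ℕ) (r : Matrix ι ι K) (T : Fun ι K)
    (α β : ι) (p : ℕ) : Fun ι K :=
  let Ω : ι × ℕ → ι × ℕ → Fun ι K := twoPoint s T
  let one : ι × ℕ → Fun ι K := fun v => ∑ ν, Ω v (ν, 0)
  let u : ι → Fun ι K := potential s T
  let F := omegaMulti s α β p
  ∑ μ, r μ α • Ω (μ, ℓ) (β, p) + ∑ μ, r μ β • Ω (α, 0) (μ, p + ℓ)
  + ∑ i ∈ range ℓ, ∑ μ, ∑ ν, ((-1) ^ (i + 1) * r ν μ) •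
      (Ω (α, 0) (μ, i) * Ω (ν, ℓ - 1 - i) (β, p))
  - ∑ v ∈ F.vars, evalJet u (MvPolynomial.pderiv v F) *
      (∑ μ, r μ v.1 • dx^[v.2] (one (μ, ℓ))
      + ((v.2 : K) + 1) • ∑ μ, (∑ ν, r μ ν) • dx^[v.2] (Ω (v.1, 0) (μ, ℓ))
      + ∑ i ∈ range ℓ, ∑ k ∈ range v.2, ∑ μ, ∑ ν,
          ((v.2.choose k : K) * (-1) ^ (i + 1) * r ν μ) •
            (dx^[k + 1] (Ω (v.1, 0) (μ, i)) * dx^[v.2 - k - 1] (one (ν, ℓ - 1 - i)))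
      + ∑ i ∈ range ℓ, ∑ μ, ∑ ν, ((-1) ^ (i + 1) * r ν μ) •
          dx^[v.2] (Ω (v.1, 0) (μ, i) * one (ν, ℓ - 1 - i)))
  + (s ^ 2 / 2) • ∑ v ∈ F.vars, ∑ w ∈ F.vars,
      evalJet u (MvPolynomial.pderiv v (MvPolynomial.pderiv w F)) *
        ∑ i ∈ range ℓ, ∑ μ, ∑ ν, ((-1) ^ (i + 1) * r ν μ) •
          (dx^[v.2 + 1] (Ω (v.1, 0) (μ, i)) * dx^[w.2 + 1] (Ω (ν, ℓ - 1 - i) (w.1, 0)))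

end Hamiltonian

end KdVGivental

/-!
The three claims are statements about the dressing operators `P_α`, which carry all information on
the vertex operators: `T P_α` has the symbol `Γ_{α,-} T`.

**The undeformed hierarchy.** Conjugation of `∂/∂q_n` by `Γ₊` gives the operator
`∇_n A = ∂A/∂q_n + s⁻¹ a_n A (s∂)^{2n+1}` on symbols. The Hirota equations can be differentiated
with respect to `q` and `q'`, and on the diagonal `q = q'` the factors `Γ₊(λ)` and `Γ₊(-λ)` cancel.
Hence, for the operator `Φ = τ P` of one copy, all operators obtained from `Φ` by the `∇_n`,
possibly multiplied by `λ²`, are orthogonal to `Φ` under the pairing `Res_λ A(λ) B(-λ)`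
(`HirotaRel.pair_eq_zero`). As `∇_0` is composition with `∂`, this orthogonality forces `∇_n Φ` and
`Φ ∂²` to be differential operators times `Φ` (`PDO.isDiff_mul_inverse`). For several copies one
gets `∇_v P_α = B_v P_α` with differential operators `B_v`, which are the Sato-Wilson equations, and
`L_α` is a differential operator (`exists_satoWilson`).

**The deformed dressing operator.** The operator `Γ_{α,-}` commutes with the derivatives with respect
to the times and has a simple commutator with the times themselves. By the symmetry of `r`, this
leads to the identity `Γ_{α,-} (r̂ T) + T Q_α = r̂^∇ (T P_α)`, where `r̂^∇` is `r̂` with every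
derivative replaced by `∇` (`preDressing_rHatFun_add`). By the Sato-Wilson equations its right-hand
side is a differential operator times `P_α`. Write `P_{α,R} = (1 + ε N) P_α`, with a negative
operator `N`. Division by `T` and `P_α` shows that `N + W`, `W = Q_α P_α⁻¹`, is a differential
operator. Hence `N = -W₋` (`dressing_dualFun`), and the deformed Sato-Wilson equation follows by
differentiation (`deformed_satoWilson`). The two-point functions are the residues, because
`P_α = 1 - (∂ log T / ∂q_{α,0}) ∂⁻¹ + …` (`twoPoint_eq_res`).

**The Hamiltonian form.** As `L_α = ħ∂² + 2u_α` is a differential operator and its square root is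
unique, `Ω_{α,0;β,p}` is the differential polynomial `F_{αβ,p}` in the `u_γ` (`evalJet_omegaMulti`).
The logarithm of `T` is deformed by `r̂ T / T`, so that the deformations of `Ω_{v;w}` and of `u_γ` are
second derivatives of `r̂ T / T`. They are obtained by applying the second order operator `T⁻¹ r̂ T`
to the undeformed functions, up to terms which are linear or quadratic in the two-point functions
(`smul_pderivLin_pderivLin_rHatFun`). The commutator of this operator with `∂_x^n` is explicit
(`dxLin_conjOp`), and on the polynomial `F_{αβ,p}` it obeys a chain rule with a Hessian term
(`conjOp_aeval`). The comparison of the deformations of `Ω_{α,0;β,p}` and of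
`F_{αβ,p}[u]` gives the deformation formula (`smul_pderivFun_pderivFun_eq`).
-/

namespace KdVGivental

open scoped Differential
open Finset

/-! ### Pseudo-differential operators -/

namespace PDO

section Basic
variable {R : Type*} [CommRing R]

@[simp] theorem coeff_sub (A B : PDO R) (k : ℤ) : (A - B).coeff k = A.coeff k - B.coeff k := rfl

@[simp] theorem coeff_smul {K : Type*} [CommRing K] [Algebra K R] (c : K) (A : PDO R) (k : ℤ) :
    (c • A).coeff k = c • A.coeff k := rfl

/-- Taking a coefficient, as an additive map. -/
def coeffHom (k : ℤ) : PDO R →+ R where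
  toFun A := A.coeff k
  map_zero' := rfl
  map_add' _ _ := rfl

@[simp] theorem coeff_sum {ι : Type*} (t : Finset ι) (f : ι → PDO R) (k : ℤ) :
    (∑ i ∈ t, f i).coeff k = ∑ i ∈ t, (f i).coeff k :=
  map_sum (coeffHom k) f t

theorem coeff_plus (A : PDO R) (k : ℤ) : A.plus.coeff k = if 0 ≤ k then A.coeff k else 0 := rfl

theorem coeff_minus (A : PDO R) (k : ℤ) : A.minus.coeff k = if 0 ≤ k then 0 else A.coeff k := by
  rw [minus, coeff_sub, coeff_plus]; split_ifs <;> simp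

theorem coeff_ofCoeffs {f : ℤ → R} (h : ∃ M : ℤ, ∀ k, M < k → f k = 0) (k : ℤ) :
    (ofCoeffs f).coeff k = f k := by
  have e : ofCoeffs f = (⟨f, h⟩ : PDO.submodule R) := dif_pos h
  rw [e]
  rfl

@[simp] theorem coeff_mapCoeffs {S : Type*} [CommRing S] (φ : R →+* S) (A : PDO R) (k : ℤ) :
    (mapCoeffs φ A).coeff k = φ (A.coeff k) := rfl

/-- Differential operators: no negative powers of `∂`. -/
def IsDiff (A : PDO R) : Prop := ∀ k < 0, A.coeff k = 0

/-- Integral operators: only negative powers of `∂`. -/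
def IsNeg (A : PDO R) : Prop := ∀ k, 0 ≤ k → A.coeff k = 0

theorem isDiff_plus (A : PDO R) : A.plus.IsDiff := fun k hk => by
  rw [coeff_plus, if_neg (not_le.mpr hk)]

theorem isNeg_minus (A : PDO R) : A.minus.IsNeg := fun k hk => by
  rw [coeff_minus, if_pos hk]

theorem coeff_one (k : ℤ) : (1 : PDO R).coeff k = if k = 0 then 1 else 0 := rfl

/-- The pairing `Res_λ A(λ) B(-λ)` of the symbols of `A` and `B`. -/
noncomputable def pair (A B : PDO R) : R :=
  ∑ᶠ i : ℤ, (i.negOnePow : ℤ) • (A.coeff (-1 - i) * B.coeff i)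

theorem pair_support (A B : PDO R) :
    (Function.support fun i : ℤ =>
      ((i.negOnePow : ℤ) • (A.coeff (-1 - i) * B.coeff i))).Finite := by
  obtain ⟨M, hM⟩ := A.bdd
  obtain ⟨N, hN⟩ := B.bdd
  refine (Set.finite_Icc (-1 - M) N).subset fun i hi => ?_
  rw [Function.mem_support] at hi
  constructor
  · by_contra h
    exact hi (by rw [hM _ (by omega), zero_mul, smul_zero])
  · by_contra h
    exact hi (by rw [hN _ (by omega), mul_zero, smul_zero])

theorem pair_add_left (A A' B : PDO R) : pair (A + A') B = pair A B + pair A' B := by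
  rw [pair, pair, pair, ← finsum_add_distrib (pair_support _ _) (pair_support _ _)]
  simp only [coeff_add, add_mul, smul_add]

theorem pair_zero_left (B : PDO R) : pair 0 B = 0 := by simp [pair]

theorem pair_sum_left {ι : Type*} (t : Finset ι) (f : ι → PDO R) (B : PDO R) :
    pair (∑ i ∈ t, f i) B = ∑ i ∈ t, pair (f i) B := by
  classical
  induction t using Finset.induction_on with
  | empty => simp [pair_zero_left]
  | insert a s ha ih => rw [sum_insert ha, sum_insert ha, pair_add_left, ih]

end Basic

section Mul
variable {R : Type*} [CommRing R] [Differential R]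

theorem coeff_mul_eq {A B : PDO R} {M N : ℤ} (hA : ∀ k, M < k → A.coeff k = 0)
    (hB : ∀ k, N < k → B.coeff k = 0) (k : ℤ) (I J : Finset ℤ) (hI : Icc (k - N) M ⊆ I)
    (hJ : Icc (k - M) N ⊆ J) :
    (A * B).coeff k = ∑ i ∈ I, ∑ j ∈ J, mulTerm (A.coeff i) (B.coeff j) i j k :=
  mulCoeff_eq hA hB k I J hI hJ

theorem coeff_mul_eq_zero {A B : PDO R} {M N : ℤ} (hA : ∀ k, M < k → A.coeff k = 0)
    (hB : ∀ k, N < k → B.coeff k = 0) (k : ℤ) (hk : M + N < k) : (A * B).coeff k = 0 :=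
  mulCoeff_eq_zero hA hB k hk

/-- The leading coefficient of a product. -/
theorem coeff_mul_top {A B : PDO R} {M N : ℤ} (hA : ∀ k, M < k → A.coeff k = 0)
    (hB : ∀ k, N < k → B.coeff k = 0) (k : ℤ) (hk : k = M + N) :
    (A * B).coeff k = A.coeff M * B.coeff N := by
  subst hk
  rw [coeff_mul_eq hA hB _ {M} {N} (by simp) (by simp)]
  simp [mulTerm]

theorem coeff_mono_zero_mul (a : R) (B : PDO R) (k : ℤ) :
    (mono 0 a * B).coeff k = a * B.coeff k := by
  rw [coeff_mul, finsum_eq_single _ (0, k)]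
  · simp [coeff_mono, mulTerm]
  · rintro ⟨i, j⟩ hp
    simp only [coeff_mono]
    split_ifs with hi
    · subst hi
      unfold mulTerm
      split_ifs with hk
      · have : (0 + j - k).toNat ≠ 0 := by
          intro h0
          apply hp
          ext <;> simp
          omega
        rw [Ring.choose_zero_pos ℤ (Nat.pos_of_ne_zero this), zero_smul]
      · rfl
    · exact mulTerm_zero_left _ _ _ _

theorem iter_const (n : ℕ) (hn : n ≠ 0) {b : R} (hb : b′ = 0) : (fun c : R => c′)^[n] b = 0 := by
  obtain ⟨m, rfl⟩ := Nat.exists_eq_succ_of_ne_zero hn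
  rw [Function.iterate_succ_apply, hb, iter_zero]

/-- Multiplication by `b ∂^n` on the right for a constant `b`. -/
theorem coeff_mul_mono (A : PDO R) (n : ℤ) {b : R} (hb : b′ = 0) (k : ℤ) :
    (A * mono n b).coeff k = A.coeff (k - n) * b := by
  rw [coeff_mul, finsum_eq_single _ (k - n, n)]
  · simp [coeff_mono, mulTerm]
  · rintro ⟨i, j⟩ hp
    simp only [coeff_mono]
    split_ifs with hj
    · subst hj
      unfold mulTerm
      split_ifs with hk
      · have : (i + j - k).toNat ≠ 0 := by
          intro h0
          apply hp
          ext <;> simp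
          omega
        rw [iter_const _ this hb, mul_zero, smul_zero]
      · rfl
    · exact mulTerm_zero_right _ _ _ _

theorem deriv_one : (1 : R)′ = 0 := by simp

theorem coeff_mul_mono_one (A : PDO R) (n k : ℤ) :
    (A * mono n 1).coeff k = A.coeff (k - n) := by
  rw [coeff_mul_mono A n deriv_one, mul_one]

theorem mono_mul_mono_one (n m : ℤ) (a : R) : mono n a * mono m 1 = mono (n + m) a := by
  refine PDO.ext fun k => ?_
  rw [coeff_mul_mono_one, coeff_mono, coeff_mono]
  exact if_congr (by omega) rfl rfl

theorem mono_zero_mul_mono (a b : R) (n : ℤ) : mono 0 a * mono n b = mono n (a * b) := by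
  refine PDO.ext fun k => ?_
  rw [coeff_mono_zero_mul, coeff_mono, coeff_mono]
  split_ifs <;> simp

theorem mono_one_pow (n : ℕ) : (mono 1 1 : PDO R) ^ n = mono n 1 := by
  induction n with
  | zero => rfl
  | succ n ih => rw [pow_succ, ih, mono_mul_mono_one]; norm_cast

/-- `∂ ∘ A` in terms of coefficients. -/
theorem coeff_D_mul (A : PDO R) (k : ℤ) :
    (mono 1 1 * A).coeff k = A.coeff (k - 1) + (A.coeff k)′ := by
  rw [coeff_mul, finsum_eq_sum_of_support_subset (s := {(1, k - 1), (1, k)})]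
  · rw [sum_insert (by simp), sum_singleton]
    simp [mulTerm, coeff_mono]
  · rintro ⟨i, j⟩ hp
    rw [Function.mem_support] at hp
    simp only [coeff_mono] at hp
    have hi : i = 1 := by
      by_contra h
      rw [if_neg h, mulTerm_zero_left] at hp
      exact hp rfl
    subst hi
    rw [if_pos rfl, mulTerm] at hp
    have h1 : k ≤ 1 + j := by
      by_contra h
      rw [if_neg h] at hp
      exact hp rfl
    rw [if_pos h1] at hp
    have h2 : (1 + j - k).toNat ≤ 1 := by
      by_contra h
      have hc : Ring.choose (1 : ℤ) (1 + j - k).toNat = 0 := by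
        have := Ring.choose_natCast (R := ℤ) 1 (1 + j - k).toNat
        rw [Nat.cast_one] at this
        rw [this, Nat.choose_eq_zero_of_lt (by omega), Nat.cast_zero]
      rw [hc, zero_smul] at hp
      exact hp rfl
    simp only [coe_insert, coe_singleton, Set.mem_insert_iff, Set.mem_singleton_iff,
      Prod.mk.injEq, true_and]
    omega

theorem IsDiff.mul {A B : PDO R} (hA : A.IsDiff) (hB : B.IsDiff) : (A * B).IsDiff := by
  intro k hk
  rw [coeff_mul]
  refine finsum_eq_zero_of_forall_eq_zero ?_
  rintro ⟨i, j⟩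
  rcases lt_or_ge i 0 with hi | hi
  · rw [hA i hi, mulTerm_zero_left]
  rcases lt_or_ge j 0 with hj | hj
  · rw [hB j hj, mulTerm_zero_right]
  unfold mulTerm
  rw [if_pos (by dsimp only; omega)]
  have hc : Ring.choose (i : ℤ) (i + j - k).toNat = 0 := by
    have := Ring.choose_natCast (R := ℤ) i.toNat (i + j - k).toNat
    rw [Int.toNat_of_nonneg hi] at this
    rw [this, Nat.choose_eq_zero_of_lt (by omega), Nat.cast_zero]
  dsimp only
  rw [hc, zero_smul]

theorem IsNeg.mul {A B : PDO R} (hA : A.IsNeg) (hB : B.IsNeg) : (A * B).IsNeg := fun k hk =>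
  coeff_mul_eq_zero (M := -1) (N := -1) (fun k hk => hA k (by omega))
    (fun k hk => hB k (by omega)) k (by omega)

/-- If `B` and `B'` agree in degrees at least `k - M`, where `A` has order at most `M`, then `A B`
and `A B'` have the same coefficient of `∂^k`. -/
theorem coeff_mul_congr_right {A B B' : PDO R} {M : ℤ} (hA : ∀ k, M < k → A.coeff k = 0) (k : ℤ)
    (h : ∀ j, k - M ≤ j → B.coeff j = B'.coeff j) : (A * B).coeff k = (A * B').coeff k := by
  rw [← sub_eq_zero, ← coeff_sub, ← mul_sub]
  refine coeff_mul_eq_zero hA (N := k - M - 1) (fun j hj => ?_) k (by omega)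
  rw [coeff_sub, h j (by omega), sub_self]

theorem coeff_mul_congr_left {A A' B : PDO R} {M : ℤ} (hB : ∀ k, M < k → B.coeff k = 0) (k : ℤ)
    (h : ∀ j, k - M ≤ j → A.coeff j = A'.coeff j) : (A * B).coeff k = (A' * B).coeff k := by
  rw [← sub_eq_zero, ← coeff_sub, ← sub_mul]
  refine coeff_mul_eq_zero (M := k - M - 1) (fun j hj => ?_) hB k (by omega)
  rw [coeff_sub, h j (by omega), sub_self]

theorem coeff_pow_eq_zero {N : PDO R} (hN : N.IsNeg) (j : ℕ) (k : ℤ) (hk : -(j : ℤ) < k) :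
    (N ^ j).coeff k = 0 := by
  induction j generalizing k with
  | zero => rw [pow_zero, coeff_one, if_neg]; simp at hk; omega
  | succ j ih =>
    rw [pow_succ]
    exact coeff_mul_eq_zero (M := -j) (N := -1) ih (fun k hk => hN k (by omega)) k
      (by push_cast at hk; omega)

/-- `1 + (lower order)` is invertible, with an inverse of the same form, the geometric series. -/
theorem exists_inverse {A : PDO R} (h0 : A.coeff 0 = 1) (hA : ∀ k, 0 < k → A.coeff k = 0) :
    ∃ B : PDO R, A * B = 1 ∧ B * A = 1 ∧ B.coeff 0 = 1 ∧ ∀ k, 0 < k → B.coeff k = 0 := by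
  set N := 1 - A with hN
  have hneg : N.IsNeg := fun k hk => by
    rw [hN, coeff_sub, coeff_one]
    split_ifs with h
    · rw [h, h0, sub_self]
    · rw [hA k (by omega), sub_self]
  have hAN : A = 1 - N := by rw [hN]; abel
  -- in the geometric series `∑ N^j`, only `j ≤ -k` contribute to the coefficient of `∂^k`
  let B : PDO R := ⟨fun k => ∑ j ∈ range (1 - k).toNat, (N ^ j).coeff k, 0, fun k hk => by
    have h : (1 - k).toNat = 0 := by omega
    simp [h]⟩
  have hB : ∀ k, B.coeff k = ∑ j ∈ range (1 - k).toNat, (N ^ j).coeff k := fun k => rfl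
  have hB' : ∀ k l, k ≤ l → B.coeff l = (∑ j ∈ range (1 - k).toNat, N ^ j).coeff l := by
    intro k l hkl
    rw [hB, coeff_sum]
    refine sum_subset (fun x hx => ?_) fun x _ hx => coeff_pow_eq_zero hneg x l ?_
    · rw [mem_range] at *; omega
    · rw [mem_range] at hx; omega
  refine ⟨B, ?_, ?_, ?_, ?_⟩
  · refine PDO.ext fun k => ?_
    rw [coeff_mul_congr_right hA k (fun j hj => hB' k j (by omega)), hAN, mul_neg_geom_sum,
      coeff_sub, coeff_pow_eq_zero hneg _ k (by omega), sub_zero]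
  · refine PDO.ext fun k => ?_
    rw [coeff_mul_congr_left hA k (fun j hj => hB' k j (by omega)), hAN, geom_sum_mul_neg,
      coeff_sub, coeff_pow_eq_zero hneg _ k (by omega), sub_zero]
  · rw [hB]; simp [coeff_one]
  · intro k hk
    rw [hB, show (1 - k).toNat = 0 by omega, sum_range_zero]

/-- A differential operator is a finite sum of terms `c_i ∂^i`. -/
theorem IsDiff.eq_sum {C : PDO R} (hC : C.IsDiff) {M : ℕ} (hM : ∀ k, (M : ℤ) ≤ k → C.coeff k = 0) :
    C = ∑ i ∈ range M, mono 0 (C.coeff i) * mono 1 1 ^ i := by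
  refine PDO.ext fun k => ?_
  simp only [coeff_sum, mono_one_pow, coeff_mono_zero_mul, coeff_mono]
  rcases lt_or_ge k 0 with hk | hk
  · rw [hC k hk, sum_eq_zero]
    intro i _
    rw [if_neg (by omega), mul_zero]
  · lift k to ℕ using hk
    by_cases h : k < M
    · rw [sum_eq_single_of_mem k (mem_range.mpr h)]
      · simp
      · intro i _ hi
        rw [if_neg (by omega), mul_zero]
    · rw [hM k (by omega), sum_eq_zero]
      intro i hi
      rw [mem_range] at hi
      rw [if_neg (by omega), mul_zero]

theorem pair_mono_zero_mul (a : R) (A B : PDO R) : pair (mono 0 a * A) B = a * pair A B := by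
  rw [pair, pair, mul_finsum' _ _ (pair_support A B)]
  refine finsum_congr fun i => ?_
  rw [coeff_mono_zero_mul, mul_smul_comm, mul_assoc]

/-- If all `∂^k Φ` and all `∂^k A` are orthogonal to `Φ = t + (lower order)`, `t` invertible, then
`A` is a differential operator times `Φ`: the negative part `N` of `A Φ⁻¹` satisfies the same
orthogonality relations, and those determine its coefficients one after the other. -/
theorem isDiff_mul_inverse {Φ Ψ A : PDO R} (ht : IsUnit (Φ.coeff 0))
    (hΦ0 : ∀ k, 0 < k → Φ.coeff k = 0) (hΨ : Ψ * Φ = 1)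
    (hΦ : ∀ k : ℕ, pair (mono 1 1 ^ k * Φ) Φ = 0)
    (hA : ∀ k : ℕ, pair (mono 1 1 ^ k * A) Φ = 0) : (A * Ψ).IsDiff := by
  set N := (A * Ψ).minus with hN
  set C := (A * Ψ).plus with hC
  have hdec : A * Ψ = C + N := by rw [hN, hC, minus]; abel
  have hAC : A = C * Φ + N * Φ := by
    rw [← add_mul, ← hdec, mul_assoc, hΨ, mul_one]
  have hdiff : ∀ X : PDO R, X.IsDiff → pair (X * Φ) Φ = 0 := by
    intro X hX
    obtain ⟨M, hM⟩ := X.bdd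
    rw [hX.eq_sum (M := (M + 1).toNat) (fun k hk => hM k (by omega)), sum_mul, pair_sum_left]
    refine sum_eq_zero fun i _ => ?_
    rw [mul_assoc, pair_mono_zero_mul, hΦ, mul_zero]
  have hpow : ∀ k : ℕ, (mono 1 1 ^ k : PDO R).IsDiff := fun k i hi => by
    rw [mono_one_pow, coeff_mono, if_neg (by omega)]
  have hNk : ∀ k : ℕ, pair (mono 1 1 ^ k * (N * Φ)) Φ = 0 := by
    intro k
    have h1 := hA k
    rw [hAC, mul_add, pair_add_left, ← mul_assoc (_ ^ k) C,
      hdiff _ ((hpow k).mul (isDiff_plus _)), zero_add] at h1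
    exact h1
  -- if `N` has order at most `-1 - d`, then only leading coefficients contribute to the pairing of
  -- `∂^d N Φ` and `Φ`
  have hN0 : ∀ d : ℕ, N.coeff (-1 - d) = 0 := by
    intro d
    induction d using Nat.strong_induction_on with
    | _ d ih =>
      have hNd : ∀ k, -1 - (d : ℤ) < k → N.coeff k = 0 := by
        intro k hk
        rcases lt_or_ge k 0 with h | h
        · have := ih (-1 - k).toNat (by omega)
          rwa [show -1 - ((-1 - k).toNat : ℤ) = k by omega] at this
        · exact isNeg_minus _ k h
      have hNΦ : ∀ k, -1 - (d : ℤ) < k → (N * Φ).coeff k = 0 := fun k hk =>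
        coeff_mul_eq_zero hNd hΦ0 k (by omega)
      have hm : ∀ k, (d : ℤ) < k → (mono 1 1 ^ d : PDO R).coeff k = 0 := fun k hk => by
        rw [mono_one_pow, coeff_mono, if_neg (by omega)]
      have h1 := hNk d
      rw [pair, finsum_eq_single _ 0] at h1
      · rw [coeff_mul_top hm hNΦ _ (by omega), coeff_mul_top hNd hΦ0 _ (by omega), mono_one_pow,
          coeff_mono, if_pos rfl, one_mul, Int.negOnePow_zero, Units.val_one, one_smul,
          mul_assoc] at h1
        exact (ht.mul ht).mul_left_eq_zero.mp h1
      · intro i hi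
        rcases lt_or_ge i 0 with h | h
        · rw [coeff_mul_eq_zero hm hNΦ _ (by omega), zero_mul, smul_zero]
        · rw [hΦ0 i (by omega), mul_zero, smul_zero]
  intro k hk
  have h2 := hN0 (-1 - k).toNat
  rwa [show -1 - ((-1 - k).toNat : ℤ) = k by omega, hN, coeff_minus, if_neg (by omega)] at h2

end Mul

section Map
variable {R S : Type*} [CommRing R] [Differential R] [CommRing S] [Differential S]

theorem iter_map (φ : R →+* S) (h : ∀ a, φ a′ = (φ a)′) (n : ℕ) (a : R) :
    φ ((fun c : R => c′)^[n] a) = (fun c : S => c′)^[n] (φ a) := by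
  induction n generalizing a with
  | zero => rfl
  | succ n ih => rw [Function.iterate_succ_apply, Function.iterate_succ_apply, ih, h]

theorem map_mulTerm (φ : R →+* S) (h : ∀ a, φ a′ = (φ a)′) (a b : R) (i j k : ℤ) :
    φ (mulTerm a b i j k) = mulTerm (φ a) (φ b) i j k := by
  unfold mulTerm
  split_ifs
  · rw [map_zsmul, map_mul, iter_map φ h]
  · exact map_zero φ

/-- A homomorphism of differential rings induces a ring homomorphism between pseudo-differential
operators. -/
def mapHom (φ : R →+* S) (h : ∀ a, φ a′ = (φ a)′) : PDO R →+* PDO S where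
  toFun := mapCoeffs φ
  map_one' := PDO.ext fun k => by
    simp only [coeff_mapCoeffs, coeff_one]
    split_ifs <;> simp
  map_mul' A B := PDO.ext fun k => by
    obtain ⟨M, hM⟩ := A.bdd
    obtain ⟨N, hN⟩ := B.bdd
    rw [coeff_mapCoeffs, coeff_mul_eq hM hN k _ _ subset_rfl subset_rfl,
      coeff_mul_eq (M := M) (N := N) (fun k hk => by rw [coeff_mapCoeffs, hM k hk, map_zero])
        (fun k hk => by rw [coeff_mapCoeffs, hN k hk, map_zero]) k _ _ subset_rfl subset_rfl]
    simp only [map_sum, map_mulTerm φ h, coeff_mapCoeffs]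
  map_zero' := PDO.ext fun k => map_zero φ
  map_add' A B := PDO.ext fun k => map_add φ _ _

@[simp] theorem coeff_mapHom (φ : R →+* S) (h : ∀ a, φ a′ = (φ a)′) (A : PDO R) (k : ℤ) :
    (mapHom φ h A).coeff k = φ (A.coeff k) := rfl

end Map

end PDO

/-! ### Derivatives and scalar multiples of power series -/

theorem pderiv_eq_pderivFun {σ R : Type*} [CommSemiring R] (v : σ) (f : MvPowerSeries σ R) :
    MvPowerSeries.pderiv R v f = MvPowerSeries.pderivFun v f :=
  MvPowerSeries.ext fun m => by
    rw [MvPowerSeries.coeff_pderiv, MvPowerSeries.coeff_pderivFun]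

section NoncommPDeriv
variable {σ B : Type*}

theorem antidiagonal_add_single_sum [DecidableEq σ] {M : Type*} [AddCommMonoid M] (m : σ →₀ ℕ)
    (v : σ)
    (f : (σ →₀ ℕ) × (σ →₀ ℕ) → M) (hf : ∀ p, p.1 v = 0 → f p = 0) :
    ∑ p ∈ antidiagonal (m + Finsupp.single v 1), f p =
      ∑ p ∈ antidiagonal m, f (p.1 + Finsupp.single v 1, p.2) := by
  symm
  refine Finset.sum_of_injOn (fun p => (p.1 + Finsupp.single v 1, p.2)) ?_ ?_ ?_ ?_
  · intro p _ q _ h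
    rw [Prod.ext_iff] at h
    exact Prod.ext (add_right_cancel h.1) h.2
  · intro p hp
    rw [mem_coe, HasAntidiagonal.mem_antidiagonal] at *
    rw [add_right_comm, hp]
  · rintro ⟨a, b⟩ hp hne
    rw [HasAntidiagonal.mem_antidiagonal] at hp
    refine hf _ ?_
    by_contra h
    have hle : Finsupp.single v 1 ≤ a := by
      rw [Finsupp.single_le_iff]
      exact Nat.one_le_iff_ne_zero.mpr h
    refine hne ⟨(a - Finsupp.single v 1, b), ?_, ?_⟩
    · rw [mem_coe, HasAntidiagonal.mem_antidiagonal]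
      refine add_right_cancel (b := Finsupp.single v 1) ?_
      rw [add_right_comm, tsub_add_cancel_of_le hle, hp]
    · exact Prod.ext (tsub_add_cancel_of_le hle) rfl
  · intro p _
    rfl

/-- The Leibniz rule for power series in commuting variables over a noncommutative ring. -/
theorem pderivFun_mul [Ring B] (v : σ) (f g : MvPowerSeries σ B) :
    MvPowerSeries.pderivFun v (f * g) =
      MvPowerSeries.pderivFun v f * g + f * MvPowerSeries.pderivFun v g := by
  classical
  refine MvPowerSeries.ext fun m => ?_
  have hl := antidiagonal_add_single_sum m v (fun p => p.1 v •
    (MvPowerSeries.coeff p.1 f * MvPowerSeries.coeff p.2 g)) fun p hp => by rw [hp, zero_smul]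
  have hr := antidiagonal_add_single_sum m v (fun p => p.1 v •
    (MvPowerSeries.coeff p.2 f * MvPowerSeries.coeff p.1 g)) fun p hp => by rw [hp, zero_smul]
  rw [map_add, MvPowerSeries.coeff_pderivFun, MvPowerSeries.coeff_mul, MvPowerSeries.coeff_mul,
    MvPowerSeries.coeff_mul, sum_mul]
  have h1 : ∀ p ∈ antidiagonal (m + Finsupp.single v 1),
      MvPowerSeries.coeff p.1 f * MvPowerSeries.coeff p.2 g * ((m v : B) + 1) =
      p.1 v • (MvPowerSeries.coeff p.1 f * MvPowerSeries.coeff p.2 g) +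
      p.2 v • (MvPowerSeries.coeff p.1 f * MvPowerSeries.coeff p.2 g) := by
    intro p hp
    rw [HasAntidiagonal.mem_antidiagonal] at hp
    have h2 := DFunLike.congr_fun hp v
    simp only [Finsupp.add_apply, Finsupp.single_eq_same] at h2
    rw [← add_smul, h2, nsmul_eq_mul, ← Nat.cast_add_one]
    exact (Nat.cast_commute _ _).symm
  rw [sum_congr rfl h1, sum_add_distrib, hl]
  congr 1
  · refine sum_congr rfl fun p _ => ?_
    rw [MvPowerSeries.coeff_pderivFun]
    simp only [Finsupp.add_apply, Finsupp.single_eq_same, nsmul_eq_mul]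
    rw [← mul_assoc, (Nat.cast_commute (p.1 v + 1) _).eq]
    push_cast
    rfl
  · rw [← Finsupp.sum_antidiagonal_swap (m + Finsupp.single v 1) fun a b =>
        a v • (MvPowerSeries.coeff b f * MvPowerSeries.coeff a g), hr,
      Finsupp.sum_antidiagonal_swap m fun a b =>
        MvPowerSeries.coeff a f * MvPowerSeries.coeff b (MvPowerSeries.pderivFun v g)]
    refine sum_congr rfl fun p _ => ?_
    rw [MvPowerSeries.coeff_pderivFun]
    simp only [Finsupp.add_apply, Finsupp.single_eq_same, nsmul_eq_mul]
    rw [← mul_assoc, (Nat.cast_commute (p.1 v + 1) _).eq, mul_assoc,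
      (Nat.cast_commute (p.1 v + 1) _).eq]
    push_cast
    rfl

end NoncommPDeriv

section SMul

variable {k S : Type*} [CommRing k] [CommRing S] [Algebra k S]

theorem deriv_smul_ps (c : k) (b : PowerSeries S) : (c • b)′ = c • b′ :=
  LinearMap.map_smul_of_tower (PowerSeries.derivative S).toLinearMap c b

theorem iter_smul_ps (n : ℕ) (c : k) (b : PowerSeries S) :
    (fun c : PowerSeries S => c′)^[n] (c • b) = c • (fun c : PowerSeries S => c′)^[n] b := by
  induction n generalizing b with
  | zero => rfl
  | succ n ih => rw [Function.iterate_succ_apply, deriv_smul_ps, ih, Function.iterate_succ_apply]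

instance : IsScalarTower k (PDO (PowerSeries S)) (PDO (PowerSeries S)) where
  smul_assoc c A B := PDO.ext fun n => by
    obtain ⟨M, hM⟩ := A.bdd
    obtain ⟨N, hN⟩ := B.bdd
    rw [smul_eq_mul, smul_eq_mul, PDO.coeff_smul,
      PDO.coeff_mul_eq hM hN n _ _ subset_rfl subset_rfl,
      PDO.coeff_mul_eq (M := M) (N := N) (fun k hk => by rw [PDO.coeff_smul, hM k hk, smul_zero])
        hN n _ _ subset_rfl subset_rfl]
    simp only [smul_sum]
    refine sum_congr rfl fun i _ => sum_congr rfl fun j _ => ?_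
    unfold PDO.mulTerm
    split_ifs
    · rw [PDO.coeff_smul, smul_mul_assoc, smul_comm]
    · rw [smul_zero]

instance : SMulCommClass k (PDO (PowerSeries S)) (PDO (PowerSeries S)) where
  smul_comm c A B := PDO.ext fun n => by
    obtain ⟨M, hM⟩ := A.bdd
    obtain ⟨N, hN⟩ := B.bdd
    rw [smul_eq_mul, smul_eq_mul, PDO.coeff_smul,
      PDO.coeff_mul_eq hM hN n _ _ subset_rfl subset_rfl,
      PDO.coeff_mul_eq (M := M) (N := N) hM (fun k hk => by rw [PDO.coeff_smul, hN k hk, smul_zero])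
        n _ _ subset_rfl subset_rfl]
    simp only [smul_sum]
    refine sum_congr rfl fun i _ => sum_congr rfl fun j _ => ?_
    unfold PDO.mulTerm
    split_ifs
    · rw [PDO.coeff_smul, iter_smul_ps, mul_smul_comm, smul_comm]
    · rw [smul_zero]

theorem coeff_smul' {σ B : Type*} [Ring B] [Module k B] (c : k) (A : MvPowerSeries σ B)
    (m : σ →₀ ℕ) : MvPowerSeries.coeff m (c • A) = c • MvPowerSeries.coeff m A := rfl

instance {σ B : Type*} [Ring B] [Module k B] [IsScalarTower k B B] :
    IsScalarTower k (MvPowerSeries σ B) (MvPowerSeries σ B) where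
  smul_assoc c A B := MvPowerSeries.ext fun m => by
    classical
    rw [smul_eq_mul, smul_eq_mul, coeff_smul', MvPowerSeries.coeff_mul, MvPowerSeries.coeff_mul,
      smul_sum]
    exact sum_congr rfl fun p _ => by rw [coeff_smul', smul_mul_assoc]

instance {σ B : Type*} [Ring B] [Module k B] [SMulCommClass k B B] :
    SMulCommClass k (MvPowerSeries σ B) (MvPowerSeries σ B) where
  smul_comm c A B := MvPowerSeries.ext fun m => by
    classical
    rw [smul_eq_mul, smul_eq_mul, coeff_smul', MvPowerSeries.coeff_mul, MvPowerSeries.coeff_mul,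
      smul_sum]
    exact sum_congr rfl fun p _ => by rw [coeff_smul', mul_smul_comm]

theorem pderivFun_smul {σ B : Type*} [Ring B] [Module k B] [IsScalarTower k B B] (v : σ) (c : k)
    (A : MvPowerSeries σ B) :
    MvPowerSeries.pderivFun v (c • A) = c • MvPowerSeries.pderivFun v A :=
  MvPowerSeries.ext fun m => by
    rw [coeff_smul', MvPowerSeries.coeff_pderivFun, MvPowerSeries.coeff_pderivFun, coeff_smul',
      smul_mul_assoc]

end SMul

/-! ### Exponential series -/

section Exp

variable {K : Type*} [Field K]

theorem coeff_pow_eq_zero_of_lt {B : Type*} [Semiring B] {f : PowerSeries B}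
    (hf : PowerSeries.coeff 0 f = 0) (j k : ℕ) (hk : k < j) : PowerSeries.coeff k (f ^ j) = 0 := by
  induction j generalizing k with
  | zero => omega
  | succ j ih =>
    rw [pow_succ', PowerSeries.coeff_mul]
    refine sum_eq_zero fun p hp => ?_
    have hp' := HasAntidiagonal.mem_antidiagonal.mp hp
    rcases Nat.eq_zero_or_pos p.1 with h | h
    · rw [h, hf, zero_mul]
    · rw [ih _ (by omega), mul_zero]

theorem coeff_expSeries {B : Type*} [Ring B] [Module K B] {f : PowerSeries B}
    (hf : PowerSeries.coeff 0 f = 0) (k N : ℕ) (hN : k < N) :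
    PowerSeries.coeff k (expSeries K f) =
      ∑ j ∈ range N, ((j.factorial : K)⁻¹) • PowerSeries.coeff k (f ^ j) := by
  rw [expSeries, PowerSeries.coeff_mk]
  refine sum_subset (range_subset_range.mpr (by omega)) fun j _ hj => ?_
  rw [coeff_pow_eq_zero_of_lt hf j k (by rw [mem_range] at hj; omega), smul_zero]

/-- The chain rule `d (exp f) = (d f) exp f` for a derivation `d` of the coefficients, if `d f`
commutes with `f`. -/
theorem derivation_expSeries [CharZero K] {B : Type*} [Ring B] [Module K B] [SMulCommClass K B B]
    (d : B →+ B) (hmul : ∀ a b, d (a * b) = d a * b + a * d b)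
    (hsmul : ∀ (c : K) a, d (c • a) = c • d a)
    {f : PowerSeries B} (hf : PowerSeries.coeff 0 f = 0)
    (hcomm : ∀ i j, Commute (d (PowerSeries.coeff i f)) (PowerSeries.coeff j f)) (k : ℕ) :
    d (PowerSeries.coeff k (expSeries K f)) = ∑ p ∈ antidiagonal k,
      d (PowerSeries.coeff p.1 f) * PowerSeries.coeff p.2 (expSeries K f) := by
  set df : PowerSeries B := PowerSeries.mk fun i => d (PowerSeries.coeff i f) with hdf
  have hcommS : Commute df f := by
    refine PowerSeries.ext fun n => ?_
    rw [PowerSeries.coeff_mul, PowerSeries.coeff_mul, ← Finset.Nat.sum_antidiagonal_swap]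
    refine sum_congr rfl fun p _ => ?_
    rw [hdf, PowerSeries.coeff_mk, PowerSeries.coeff_mk]
    exact hcomm _ _
  have hone : d 1 = 0 := by
    have := hmul 1 1
    rwa [mul_one, one_mul, mul_one, left_eq_add] at this
  have hpow : ∀ j k, d (PowerSeries.coeff k (f ^ (j + 1))) =
      (j + 1) • PowerSeries.coeff k (df * f ^ j) := by
    intro j
    induction j with
    | zero => intro k; simp [hdf]
    | succ j ih =>
      intro k
      have e1 : PowerSeries.coeff k (f * (df * f ^ j)) = PowerSeries.coeff k (df * f ^ (j + 1)) := by
        rw [← mul_assoc, ← hcommS.eq, mul_assoc, ← pow_succ']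
      rw [pow_succ', PowerSeries.coeff_mul, map_sum,
        sum_congr rfl fun p _ => by rw [hmul, ih], sum_add_distrib]
      have e2 : ∑ p ∈ antidiagonal k, d (PowerSeries.coeff p.1 f) *
          PowerSeries.coeff p.2 (f ^ (j + 1)) = PowerSeries.coeff k (df * f ^ (j + 1)) := by
        rw [PowerSeries.coeff_mul]
        exact sum_congr rfl fun p _ => by rw [hdf, PowerSeries.coeff_mk]
      rw [e2, sum_congr rfl fun p _ => mul_smul_comm _ _ _, ← smul_sum, ← PowerSeries.coeff_mul, e1,
        add_smul (j + 1), one_smul, add_comm]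
  rw [coeff_expSeries hf k (k + 2) (by omega), map_sum, sum_range_succ']
  have h0 : d (((Nat.factorial 0 : K)⁻¹) • PowerSeries.coeff k (f ^ 0)) = 0 := by
    rw [pow_zero, PowerSeries.coeff_one, hsmul]
    split_ifs <;> simp [hone]
  rw [h0, add_zero]
  have e3 : ∀ j ∈ range (k + 1), d ((((j + 1).factorial : K)⁻¹) • PowerSeries.coeff k (f ^ (j + 1)))
      = ∑ p ∈ antidiagonal k, d (PowerSeries.coeff p.1 f) *
        (((j.factorial : K)⁻¹) • PowerSeries.coeff p.2 (f ^ j)) := by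
    intro j _
    rw [hsmul, hpow, ← Nat.cast_smul_eq_nsmul K, smul_smul, Nat.factorial_succ,
      PowerSeries.coeff_mul,
      smul_sum]
    refine sum_congr rfl fun p _ => ?_
    rw [hdf, PowerSeries.coeff_mk, mul_smul_comm]
    congr 1
    have : ((j : K) + 1) ≠ 0 := by exact_mod_cast Nat.succ_ne_zero j
    have h2 : (j.factorial : K) ≠ 0 := by exact_mod_cast Nat.factorial_ne_zero j
    push_cast
    field_simp
  rw [sum_congr rfl e3, sum_comm]
  refine sum_congr rfl fun p hp => ?_
  have hp' := HasAntidiagonal.mem_antidiagonal.mp hp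
  rw [coeff_expSeries hf p.2 (k + 1) (by omega), mul_sum]

/-- A relation between two rings that is compatible with all operations and holds between the
coefficients of two series holds between the coefficients of their exponentials. -/
theorem expSeries_rel {B B' : Type*} [Ring B] [Module K B] [Ring B'] [Module K B']
    (r : B → B' → Prop) (h0 : r 0 0) (h1 : r 1 1)
    (hadd : ∀ a b a' b', r a a' → r b b' → r (a + b) (a' + b'))
    (hmul : ∀ a b a' b', r a a' → r b b' → r (a * b) (a' * b'))
    (hsmul : ∀ (c : K) a a', r a a' → r (c • a) (c • a'))
    {f : PowerSeries B} {f' : PowerSeries B'}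
    (hf : ∀ k, r (PowerSeries.coeff k f) (PowerSeries.coeff k f')) (k : ℕ) :
    r (PowerSeries.coeff k (expSeries K f)) (PowerSeries.coeff k (expSeries K f')) := by
  have hsum : ∀ {α : Type} (t : Finset α) (g : α → B) (g' : α → B'),
      (∀ i ∈ t, r (g i) (g' i)) → r (∑ i ∈ t, g i) (∑ i ∈ t, g' i) := by
    classical
    intro α t g g'
    induction t using Finset.induction_on with
    | empty => intro _; simpa using h0
    | insert a t ha ih =>
      intro h
      rw [sum_insert ha, sum_insert ha]
      exact hadd _ _ _ _ (h a (mem_insert_self a t)) (ih fun i hi => h i (mem_insert_of_mem hi))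
  have hpow : ∀ j k, r (PowerSeries.coeff k (f ^ j)) (PowerSeries.coeff k (f' ^ j)) := by
    intro j
    induction j with
    | zero =>
      intro k
      rw [pow_zero, pow_zero, PowerSeries.coeff_one, PowerSeries.coeff_one]
      split_ifs
      · exact h1
      · exact h0
    | succ j ih =>
      intro k
      rw [pow_succ, pow_succ, PowerSeries.coeff_mul, PowerSeries.coeff_mul]
      exact hsum _ _ _ fun p _ => hmul _ _ _ _ (ih p.1) (hf p.2)
  rw [expSeries, expSeries, PowerSeries.coeff_mk, PowerSeries.coeff_mk]
  exact hsum _ _ _ fun j _ => hsmul _ _ _ (hpow j k)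

end Exp

/-! ### The vertex operator `Γ₊` -/

section GammaPlus

variable {K : Type*} [Field K]

theorem finsupp_add_single_induction {σ : Type*} {p : (σ →₀ ℕ) → Prop} (h0 : p 0)
    (hs : ∀ m i, p m → p (m + Finsupp.single i 1)) (m : σ →₀ ℕ) : p m := by
  classical
  induction hd : m.degree generalizing m with
  | zero => rw [Finsupp.degree_eq_zero_iff] at hd; rwa [hd]
  | succ d ih =>
    have hm : m ≠ 0 := by rintro rfl; simp at hd
    obtain ⟨i, hi⟩ := Finsupp.ne_iff.mp hm
    have hle : Finsupp.single i 1 ≤ m := by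
      rw [Finsupp.single_le_iff]
      exact Nat.one_le_iff_ne_zero.mpr hi
    have e := tsub_add_cancel_of_le hle
    rw [← e] at hd ⊢
    refine hs _ i (ih _ ?_)
    simpa using hd

theorem coeff_zero_gammaPlus_exponent (s : K) : PowerSeries.coeff 0 (PowerSeries.mk fun k : ℕ =>
    if Odd k then (s⁻¹ * ca K (k / 2)) • (MvPowerSeries.X (k / 2) : MvPowerSeries ℕ K) else 0) =
    0 := by
  simp

/-- `∂Γ₊/∂q_i = s⁻¹ a_i λ^{2i+1} Γ₊`. -/
theorem pderivFun_gammaPlus [CharZero K] (s : K) (i a : ℕ) :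
    MvPowerSeries.pderivFun i (PowerSeries.coeff a (gammaPlus s)) =
      if 2 * i + 1 ≤ a then (s⁻¹ * ca K i) • PowerSeries.coeff (a - (2 * i + 1)) (gammaPlus s)
      else 0 := by
  have key := derivation_expSeries (K := K)
    ((MvPowerSeries.pderiv K i).toLinearMap.toAddMonoidHom : MvPowerSeries ℕ K →+ MvPowerSeries ℕ K)
    (fun a b => by
      change MvPowerSeries.pderiv K i (a * b) = MvPowerSeries.pderiv K i a * b +
        a * MvPowerSeries.pderiv K i b
      simp only [pderiv_eq_pderivFun, pderivFun_mul])
    (fun c a => (MvPowerSeries.pderiv K i).map_smul c a)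
    (coeff_zero_gammaPlus_exponent s) (fun _ _ => Commute.all _ _) a
  change MvPowerSeries.pderiv K i _ = ∑ p ∈ _, MvPowerSeries.pderiv K i _ * _ at key
  rw [pderiv_eq_pderivFun] at key
  rw [gammaPlus, key]
  have hd : ∀ k : ℕ, MvPowerSeries.pderiv K i (if Odd k then (s⁻¹ * ca K (k / 2)) •
      (MvPowerSeries.X (k / 2) : MvPowerSeries ℕ K) else 0) =
      if k = 2 * i + 1 then (s⁻¹ * ca K i) • 1 else 0 := by
    intro k
    by_cases hk : k = 2 * i + 1
    · subst hk
      rw [if_pos ⟨i, rfl⟩, if_pos rfl, show (2 * i + 1) / 2 = i by omega, Derivation.map_smul,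
        MvPowerSeries.pderiv_X_self]
    · rw [if_neg hk]
      split_ifs with ho
      · have : k / 2 ≠ i := by
          obtain ⟨j, rfl⟩ := ho
          omega
        rw [Derivation.map_smul, MvPowerSeries.pderiv_X_of_ne this, smul_zero]
      · exact map_zero _
  simp only [PowerSeries.coeff_mk, hd]
  split_ifs with h
  · rw [sum_eq_single_of_mem (2 * i + 1, a - (2 * i + 1))
      (HasAntidiagonal.mem_antidiagonal.mpr (by dsimp only; omega))]
    · simp
    · rintro ⟨x, y⟩ hp hne
      have hp' := HasAntidiagonal.mem_antidiagonal.mp hp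
      rw [if_neg, zero_mul]
      rintro h
      apply hne
      ext <;> dsimp only at * <;> omega
  · refine sum_eq_zero fun p hp => ?_
    have hp' := HasAntidiagonal.mem_antidiagonal.mp hp
    rw [if_neg (by omega), zero_mul]

theorem constantCoeff_gammaPlus (s : K) (a : ℕ) :
    MvPowerSeries.constantCoeff (PowerSeries.coeff a (gammaPlus s)) = if a = 0 then 1 else 0 := by
  have key := expSeries_rel (K := K) (B := MvPowerSeries ℕ K) (B' := K)
    (fun x y => MvPowerSeries.constantCoeff x = y) (map_zero _) (map_one _)
    (fun _ _ _ _ h h' => by rw [map_add, h, h']) (fun _ _ _ _ h h' => by rw [map_mul, h, h'])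
    (fun c x y h => by rw [MvPowerSeries.constantCoeff_smul, h])
    (f' := 0) (f := PowerSeries.mk fun k : ℕ =>
      if Odd k then (s⁻¹ * ca K (k / 2)) • (MvPowerSeries.X (k / 2) : MvPowerSeries ℕ K) else 0)
    (fun k => by
      rw [PowerSeries.coeff_mk, map_zero]
      split_ifs
      · rw [MvPowerSeries.constantCoeff_smul, MvPowerSeries.constantCoeff_X, smul_zero]
      · exact map_zero _) a
  rw [gammaPlus, key, expSeries, PowerSeries.coeff_mk, sum_range_succ']
  simp [PowerSeries.coeff_one]

/-- For a given monomial, only finitely many powers of `λ` in `Γ₊(λ) f` contribute. -/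
theorem exists_bound_gammaPlus [CharZero K] (s : K) (m : ℕ →₀ ℕ) :
    ∃ N : ℕ, ∀ a, N < a → ∀ g : MvPowerSeries ℕ K,
      MvPowerSeries.coeff m (PowerSeries.coeff a (gammaPlus s) * g) = 0 := by
  induction m using finsupp_add_single_induction with
  | h0 =>
    refine ⟨0, fun a ha g => ?_⟩
    rw [MvPowerSeries.coeff_zero_eq_constantCoeff_apply, map_mul, constantCoeff_gammaPlus,
      if_neg (by omega), zero_mul]
  | hs m i ih =>
    obtain ⟨N, hN⟩ := ih
    refine ⟨N + (2 * i + 1), fun a ha g => ?_⟩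
    have h1 : MvPowerSeries.coeff m (MvPowerSeries.pderivFun i
        (PowerSeries.coeff a (gammaPlus s) * g)) = 0 := by
      rw [pderivFun_mul, pderivFun_gammaPlus, if_pos (by omega), map_add, hN a (by omega),
        smul_mul_assoc, LinearMap.map_smul_of_tower, hN _ (by omega), smul_zero, add_zero]
    rw [MvPowerSeries.coeff_pderivFun] at h1
    exact (mul_eq_zero.mp h1).resolve_right (by exact_mod_cast Nat.succ_ne_zero (m i))

end GammaPlus

/-! ### The Sato-Wilson equations of one copy of KdV -/

section Pair

theorem map_pair {R T : Type*} [CommRing R] [AddCommGroup T] (g : R →+ T) (A B : PDO R) :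
    g (PDO.pair A B) = ∑ᶠ i : ℤ, (i.negOnePow : ℤ) • g (A.coeff (-1 - i) * B.coeff i) := by
  rw [PDO.pair, g.map_finsum (PDO.pair_support A B)]
  simp only [map_zsmul]

variable {R : Type*} [CommRing R]

theorem PDO.pair_add_right (A B B' : PDO R) :
    PDO.pair A (B + B') = PDO.pair A B + PDO.pair A B' := by
  rw [PDO.pair, PDO.pair, PDO.pair,
    ← finsum_add_distrib (PDO.pair_support _ _) (PDO.pair_support _ _)]
  simp only [PDO.coeff_add, mul_add, smul_add]

theorem PDO.pair_smul_left {K : Type*} [CommRing K] [Algebra K R] (c : K) (A B : PDO R) :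
    PDO.pair (c • A) B = c • PDO.pair A B := by
  have := map_pair (DistribSMul.toAddMonoidHom R c) A B
  rw [DistribSMul.toAddMonoidHom_apply] at this
  rw [this, PDO.pair]
  simp only [PDO.coeff_smul, smul_mul_assoc, DistribSMul.toAddMonoidHom_apply]

theorem PDO.pair_smul_right {K : Type*} [CommRing K] [Algebra K R] (c : K) (A B : PDO R) :
    PDO.pair A (c • B) = c • PDO.pair A B := by
  have := map_pair (DistribSMul.toAddMonoidHom R c) A B
  rw [DistribSMul.toAddMonoidHom_apply] at this
  rw [this, PDO.pair]
  simp only [PDO.coeff_smul, mul_smul_comm, DistribSMul.toAddMonoidHom_apply]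

/-- Composition with `∂^n` on the right multiplies symbols by `λ^n`, and passing it to the other
factor of the pairing replaces `λ` by `-λ`. -/
theorem PDO.pair_mul_mono [Differential R] (A B : PDO R) (n : ℤ) :
    PDO.pair (A * PDO.mono n 1) B = (n.negOnePow : ℤ) • PDO.pair A (B * PDO.mono n 1) := by
  have h := map_pair (DistribSMul.toAddMonoidHom R (n.negOnePow : ℤ)) A (B * PDO.mono n 1)
  simp only [DistribSMul.toAddMonoidHom_apply] at h
  rw [h, PDO.pair, ← finsum_comp_equiv (Equiv.subRight n)]
  refine finsum_congr fun i => ?_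
  rw [PDO.coeff_mul_mono_one, PDO.coeff_mul_mono_one, Equiv.subRight_apply, smul_smul,
    ← Units.val_mul, ← Int.negOnePow_add, show -1 - (i - n) - n = -1 - i by ring,
    show i + n = (i - n) + 2 * n by ring, Int.negOnePow_add, Int.negOnePow_two_mul, mul_one]

end Pair

section Single

variable {K : Type*} [Field K]

/-- The ring `K⟦q_0, q_1, …⟧` with the derivation `∂/∂q_0`. -/
noncomputable instance : Differential (MvPowerSeries ℕ K) :=
  differentialOf (MvPowerSeries.pderiv K 0).toLinearMap.toAddMonoidHom
    fun a b => (MvPowerSeries.pderiv K 0).leibniz a b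

theorem deriv_single (f : MvPowerSeries ℕ K) : f′ = MvPowerSeries.pderivFun 0 f :=
  pderiv_eq_pderivFun 0 f

/-- The product of `Γ₊(λ)` with a series `∑ f_k λ^k`. -/
noncomputable def vert (s : K) (f : ℤ → MvPowerSeries ℕ K) (k : ℤ) : MvPowerSeries ℕ K :=
  fun m => ∑ᶠ a : ℕ, MvPowerSeries.coeff m (PowerSeries.coeff a (gammaPlus s) * f (k - a))

variable [CharZero K]

theorem coeff_vert (s : K) (m : ℕ →₀ ℕ) : ∃ N : ℕ, ∀ n, N ≤ n → ∀ f k,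
    MvPowerSeries.coeff m (vert s f k) =
      ∑ a ∈ range n, MvPowerSeries.coeff m (PowerSeries.coeff a (gammaPlus s) * f (k - a)) := by
  obtain ⟨N, hN⟩ := exists_bound_gammaPlus s m
  refine ⟨N + 1, fun n hn f k => ?_⟩
  rw [MvPowerSeries.coeff_apply]
  refine finsum_eq_sum_of_support_subset _ fun a ha => ?_
  rw [Function.mem_support] at ha
  rw [mem_coe, mem_range]
  by_contra h
  exact ha (hN a (by omega) _)

theorem constantCoeff_vert (s : K) (f : ℤ → MvPowerSeries ℕ K) (k : ℤ) :
    MvPowerSeries.coeff 0 (vert s f k) = MvPowerSeries.coeff 0 (f k) := by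
  obtain ⟨N, hN⟩ := coeff_vert s (0 : ℕ →₀ ℕ)
  rw [hN (N + 1) (by omega), sum_range_succ']
  simp only [MvPowerSeries.coeff_zero_eq_constantCoeff_apply, map_mul, constantCoeff_gammaPlus]
  simp

/-- Conjugation by `Γ₊` turns `∂/∂q_i` into `∂/∂q_i + s⁻¹ a_i λ^{2i+1}`. -/
theorem pderivFun_vert (s : K) (f : ℤ → MvPowerSeries ℕ K) (k : ℤ) (i : ℕ) :
    MvPowerSeries.pderivFun i (vert s f k) =
      vert s (fun j => MvPowerSeries.pderivFun i (f j) + (s⁻¹ * ca K i) • f (j - (2 * i + 1))) k := by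
  refine MvPowerSeries.ext fun m => ?_
  obtain ⟨N, hN⟩ := coeff_vert s m
  obtain ⟨N', hN'⟩ := coeff_vert s (m + Finsupp.single i 1)
  have hL : ∀ g : ℤ → MvPowerSeries ℕ K, ∑ a ∈ range (2 * i + 1 + (N + N')),
      MvPowerSeries.coeff m (PowerSeries.coeff a (gammaPlus s) * g (k - a)) =
      ∑ a ∈ range (N + N'),
        MvPowerSeries.coeff m (PowerSeries.coeff a (gammaPlus s) * g (k - a)) := fun g => by
    rw [← hN _ (by omega), ← hN _ (by omega)]
  rw [MvPowerSeries.coeff_pderivFun, hN' (2 * i + 1 + (N + N')) (by omega),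
    hN (2 * i + 1 + (N + N')) (by omega), sum_mul,
    sum_congr rfl fun a _ => (MvPowerSeries.coeff_pderivFun _ _).symm]
  simp only [pderivFun_mul, map_add, mul_add, sum_add_distrib]
  rw [add_comm]
  congr 1
  rw [hL fun j => (s⁻¹ * ca K i) • f (j - (2 * i + 1)), sum_range_add,
    sum_eq_zero (s := range (2 * i + 1)), zero_add]
  · refine sum_congr rfl fun a _ => ?_
    rw [pderivFun_gammaPlus, if_pos (by omega), show 2 * i + 1 + a - (2 * i + 1) = a by omega,
      smul_mul_assoc, mul_smul_comm]
    congr 4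
    push_cast
    ring
  · intro a ha
    rw [mem_range] at ha
    rw [pderivFun_gammaPlus, if_neg (by omega), zero_mul, map_zero]

/-- The coefficients of the symbol of `A`, with respect to `λ = s ∂`. -/
noncomputable def sym (s : K) (A : PDO (MvPowerSeries ℕ K)) (k : ℤ) : MvPowerSeries ℕ K :=
  (s ^ (-k)) • A.coeff k

/-- Coefficientwise derivation of an operator. -/
noncomputable def coeffDeriv (i : ℕ) (A : PDO (MvPowerSeries ℕ K)) : PDO (MvPowerSeries ℕ K) :=
  ⟨fun k => MvPowerSeries.pderiv K i (A.coeff k), by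
    obtain ⟨M, hM⟩ := A.bdd
    exact ⟨M, fun k hk => by simp [hM k hk]⟩⟩

/-- The operator obtained by conjugating `∂/∂q_i` with `Γ₊`, acting on symbols:
`∇_i A = ∂A/∂q_i + s⁻¹ a_i A (s∂)^{2i+1}`. -/
noncomputable def nabla (s : K) (i : ℕ) (A : PDO (MvPowerSeries ℕ K)) :
    PDO (MvPowerSeries ℕ K) :=
  coeffDeriv i A + (s ^ (2 * i) * ca K i) • (A * PDO.mono (2 * i + 1) 1)

omit [CharZero K] in
theorem coeff_coeffDeriv (i : ℕ) (A : PDO (MvPowerSeries ℕ K)) (k : ℤ) :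
    (coeffDeriv i A).coeff k = MvPowerSeries.pderivFun i (A.coeff k) := pderiv_eq_pderivFun _ _

omit [CharZero K] in
theorem coeff_nabla (s : K) (i : ℕ) (A : PDO (MvPowerSeries ℕ K)) (k : ℤ) :
    (nabla s i A).coeff k = MvPowerSeries.pderivFun i (A.coeff k) +
      (s ^ (2 * i) * ca K i) • A.coeff (k - (2 * i + 1)) := by
  rw [nabla, PDO.coeff_add, PDO.coeff_smul, PDO.coeff_mul_mono_one, coeff_coeffDeriv]

omit [CharZero K] in
theorem sym_nabla {s : K} (hs : s ≠ 0) (i : ℕ) (A : PDO (MvPowerSeries ℕ K)) (k : ℤ) :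
    sym s (nabla s i A) k =
      MvPowerSeries.pderivFun i (sym s A k) + (s⁻¹ * ca K i) • sym s A (k - (2 * i + 1)) := by
  rw [sym, sym, sym, coeff_nabla, smul_add, pderivFun_smul, smul_smul, smul_smul]
  congr 2
  rw [show -(k - (2 * (i : ℤ) + 1)) = -k + (2 * i : ℕ) + 1 by push_cast; ring, zpow_add₀ hs,
    zpow_add₀ hs, zpow_natCast, zpow_one]
  field_simp

/-- The bilinear equations `Res_λ λ^{2n} (Γ₊(λ) A(λ))(q) (Γ₊(-λ) B(-λ))(q') dλ = 0`, `n ≥ 0`, for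
the symbols of two operators `A` and `B`. -/
def HirotaRel (s : K) (A B : PDO (MvPowerSeries ℕ K)) : Prop :=
  ∀ (n : ℕ) (m m' : ℕ →₀ ℕ), ∑ᶠ k : ℤ, MvPowerSeries.coeff m (vert s (sym s A) k) *
    (((-1 - 2 * (n : ℤ) - k).negOnePow : ℤ) •
      MvPowerSeries.coeff m' (vert s (sym s B) (-1 - 2 * (n : ℤ) - k))) = 0

/-- Differentiating the bilinear equations with respect to `q_i` replaces `A` by `∇_i A`; the times
`q` and `q'` are independent. -/
theorem HirotaRel.nabla_left {s : K} (hs : s ≠ 0) {A B : PDO (MvPowerSeries ℕ K)}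
    (h : HirotaRel s A B) (i : ℕ) : HirotaRel s (nabla s i A) B := by
  intro n m m'
  have h1 := h n (m + Finsupp.single i 1) m'
  have h2 : ∀ k, MvPowerSeries.coeff m (vert s (sym s (nabla s i A)) k) =
      (m i + 1 : K) * MvPowerSeries.coeff (m + Finsupp.single i 1) (vert s (sym s A) k) := by
    intro k
    rw [show sym s (nabla s i A) = _ from funext (sym_nabla hs i A), ← pderivFun_vert,
      MvPowerSeries.coeff_pderivFun, mul_comm]
  simp only [h2, mul_assoc]
  have h3 := smul_finsum (m i + 1 : K) fun k : ℤ =>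
    MvPowerSeries.coeff (m + Finsupp.single i 1) (vert s (sym s A) k) *
    (((-1 - 2 * (n : ℤ) - k).negOnePow : ℤ) •
      MvPowerSeries.coeff m' (vert s (sym s B) (-1 - 2 * (n : ℤ) - k)))
  rw [h1, smul_zero] at h3
  exact h3.symm

theorem HirotaRel.nabla_right {s : K} (hs : s ≠ 0) {A B : PDO (MvPowerSeries ℕ K)}
    (h : HirotaRel s A B) (i : ℕ) : HirotaRel s A (nabla s i B) := by
  intro n m m'
  have h1 := h n m (m' + Finsupp.single i 1)
  have h2 : ∀ k, MvPowerSeries.coeff m' (vert s (sym s (nabla s i B)) k) =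
      (m' i + 1 : K) * MvPowerSeries.coeff (m' + Finsupp.single i 1) (vert s (sym s B) k) := by
    intro k
    rw [show sym s (nabla s i B) = _ from funext (sym_nabla hs i B), ← pderivFun_vert,
      MvPowerSeries.coeff_pderivFun, mul_comm]
  simp only [h2, ← mul_smul_comm, mul_left_comm _ (m' i + 1 : K)]
  have h3 := smul_finsum (m' i + 1 : K) fun k : ℤ =>
    MvPowerSeries.coeff m (vert s (sym s A) k) *
    (((-1 - 2 * (n : ℤ) - k).negOnePow : ℤ) •
      MvPowerSeries.coeff (m' + Finsupp.single i 1) (vert s (sym s B) (-1 - 2 * (n : ℤ) - k)))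
  rw [h1, smul_zero] at h3
  exact h3.symm

/-- At `q = q' = 0` the factors `Γ₊` disappear from the bilinear equations. -/
theorem HirotaRel.coeff_zero_pair {s : K} (hs : s ≠ 0) {A B : PDO (MvPowerSeries ℕ K)}
    (h : HirotaRel s A B) (n : ℕ) :
    MvPowerSeries.coeff 0 (PDO.pair (A * PDO.mono (2 * n) 1) B) = 0 := by
  have h1 := h n 0 0
  simp only [constantCoeff_vert] at h1
  have e := map_pair (MvPowerSeries.coeff (R := K) (0 : ℕ →₀ ℕ)).toAddMonoidHom
    (A * PDO.mono (2 * n) 1) B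
  simp only [LinearMap.toAddMonoidHom_coe] at e
  rw [e]
  have h2 : ∀ k : ℤ, MvPowerSeries.coeff (0 : ℕ →₀ ℕ) (sym s A k) *
      (((-1 - 2 * (n : ℤ) - k).negOnePow : ℤ) •
        MvPowerSeries.coeff (0 : ℕ →₀ ℕ) (sym s B (-1 - 2 * (n : ℤ) - k))) =
      s ^ (1 + 2 * (n : ℤ)) • (((-1 - 2 * (n : ℤ) - k).negOnePow : ℤ) •
        MvPowerSeries.coeff (0 : ℕ →₀ ℕ)
          (A.coeff k * B.coeff (-1 - 2 * (n : ℤ) - k))) := by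
    intro k
    simp only [sym, MvPowerSeries.coeff_zero_eq_constantCoeff_apply, map_mul,
      MvPowerSeries.constantCoeff_smul, smul_eq_mul, zsmul_eq_mul]
    rw [show 1 + 2 * (n : ℤ) = -k + -(-1 - 2 * (n : ℤ) - k) by ring, zpow_add₀ hs]
    ring
  simp only [h2] at h1
  rw [← smul_finsum, smul_eq_zero, or_iff_right (zpow_ne_zero _ hs),
    ← finsum_comp_equiv (Equiv.subLeft (-1 - 2 * (n : ℤ)))] at h1
  rw [← h1]
  refine finsum_congr fun i => ?_
  rw [PDO.coeff_mul_mono_one, Equiv.subLeft_apply]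
  congr 4
  · ring_nf
  · ring_nf
  · ring_nf

omit [CharZero K] in
/-- The extra terms of the two `∇_i` cancel, because `λ^{2i+1}` is odd. -/
theorem pderivFun_pair (s : K) (i : ℕ) (A B : PDO (MvPowerSeries ℕ K)) :
    MvPowerSeries.pderivFun i (PDO.pair A B) =
      PDO.pair (nabla s i A) B + PDO.pair A (nabla s i B) := by
  have e := map_pair (MvPowerSeries.pderiv K i).toLinearMap.toAddMonoidHom A B
  change MvPowerSeries.pderiv K i _ = ∑ᶠ j : ℤ, _ • MvPowerSeries.pderiv K i _ at e
  rw [pderiv_eq_pderivFun] at e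
  have e2 : MvPowerSeries.pderivFun i (PDO.pair A B) =
      PDO.pair (coeffDeriv i A) B + PDO.pair A (coeffDeriv i B) := by
    rw [e, PDO.pair, PDO.pair, ← finsum_add_distrib (PDO.pair_support _ _) (PDO.pair_support _ _)]
    refine finsum_congr fun j => ?_
    rw [pderiv_eq_pderivFun, pderivFun_mul, smul_add, coeff_coeffDeriv, coeff_coeffDeriv]
  rw [e2, nabla, nabla, PDO.pair_add_left, PDO.pair_add_right, PDO.pair_smul_left,
    PDO.pair_smul_right, PDO.pair_mul_mono, Int.negOnePow_two_mul_add_one]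
  simp only [Units.val_neg, Units.val_one, neg_smul, one_smul, smul_neg]
  abel

omit [CharZero K] in
theorem nabla_mul_mono (s : K) (i : ℕ) (A : PDO (MvPowerSeries ℕ K)) (n : ℤ) :
    nabla s i (A * PDO.mono n 1) = nabla s i A * PDO.mono n 1 := by
  refine PDO.ext fun k => ?_
  simp only [coeff_nabla, PDO.coeff_mul_mono_one]
  congr 3
  ring

omit [CharZero K] in
/-- `∇_0` is composition with `∂`. -/
theorem nabla_zero (s : K) (A : PDO (MvPowerSeries ℕ K)) :
    nabla s 0 A = PDO.mono 1 1 * A := by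
  refine PDO.ext fun k => ?_
  rw [PDO.coeff_D_mul, coeff_nabla, deriv_single]
  simp [ca, add_comm]

/-- On the diagonal `q = q'` the factors `Γ₊(λ)` and `Γ₊(-λ)` cancel. Every Taylor coefficient of
the pairing reduces to the constant term, since `∂/∂q_i` acts on the two factors by `∇_i`. -/
theorem HirotaRel.pair_eq_zero {s : K} (hs : s ≠ 0) {A B : PDO (MvPowerSeries ℕ K)}
    (h : HirotaRel s A B) (n : ℕ) : PDO.pair (A * PDO.mono (2 * n) 1) B = 0 := by
  refine MvPowerSeries.ext fun m => ?_
  rw [map_zero]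
  induction m using finsupp_add_single_induction generalizing A B with
  | h0 => exact h.coeff_zero_pair hs n
  | hs m i ih =>
    have h1 : MvPowerSeries.coeff m (MvPowerSeries.pderivFun i
        (PDO.pair (A * PDO.mono (2 * n) 1) B)) = 0 := by
      rw [pderivFun_pair s, map_add, nabla_mul_mono, ih (h.nabla_left hs i),
        ih (h.nabla_right hs i), add_zero]
    rw [MvPowerSeries.coeff_pderivFun] at h1
    exact (mul_eq_zero.mp h1).resolve_right (by exact_mod_cast Nat.succ_ne_zero (m i))

/-- The operator whose symbol is `Γ₋ τ`. -/
noncomputable def waveOp (s : K) (τ : MvPowerSeries ℕ K) : PDO (MvPowerSeries ℕ K) :=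
  ⟨fun k => if k ≤ 0 then (s ^ k) • PowerSeries.coeff (-k).toNat (gammaMinus s id K) τ else 0, 0,
    fun _ hk => if_neg (not_le.mpr hk)⟩

omit [CharZero K] in
theorem coeff_waveOp (s : K) (τ : MvPowerSeries ℕ K) (k : ℤ) : (waveOp s τ).coeff k =
    if k ≤ 0 then (s ^ k) • PowerSeries.coeff (-k).toNat (gammaMinus s id K) τ else 0 := rfl

/-- The series `Γ₊(λ) Γ₋(λ) τ`, as `Γ₊` applied to the symbol of the operator `waveOp s τ`. -/
theorem wave_eq_vert {s : K} (hs : s ≠ 0) (τ : MvPowerSeries ℕ K) (k : ℤ) :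
    wave s τ k = vert s (sym s (waveOp s τ)) k := by
  refine MvPowerSeries.ext fun m => ?_
  obtain ⟨N, hN⟩ := exists_bound_gammaPlus s m
  have hsym : ∀ j, sym s (waveOp s τ) j =
      if j ≤ 0 then PowerSeries.coeff (-j).toNat (gammaMinus s id K) τ else 0 := by
    intro j
    rw [sym, coeff_waveOp]
    split_ifs
    · rw [smul_smul, ← zpow_add₀ hs, neg_add_cancel, zpow_zero, one_smul]
    · rw [smul_zero]
  rw [MvPowerSeries.coeff_apply, MvPowerSeries.coeff_apply, wave, vert, finsum_curry]
  · refine finsum_congr fun a => ?_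
    rw [hsym]
    split_ifs with h
    · rw [finsum_eq_single _ (-(k - a)).toNat]
      · rw [if_pos (by omega)]
      · intro b hb
        rw [if_neg (by omega)]
    · rw [mul_zero, map_zero]
      refine finsum_eq_zero_of_forall_eq_zero fun b => if_neg (by omega)
  · refine ((range (N + 1)).finite_toSet.image fun a : ℕ => (a, (a - k).toNat)).subset ?_
    rintro ⟨a, b⟩ hp
    rw [Function.mem_support] at hp
    refine ⟨a, ?_, ?_⟩
    · rw [mem_coe, mem_range]
      by_contra h
      refine hp ?_
      split_ifs
      · exact hN a (by omega) _
      · rfl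
    · ext
      · rfl
      · dsimp only at hp ⊢
        by_contra h
        exact hp (if_neg (by omega))

theorem IsKdVTau.hirotaRel {s : K} (hs : s ≠ 0) {τ : MvPowerSeries ℕ K} (h : IsKdVTau s τ) :
    HirotaRel s (waveOp s τ) (waveOp s τ) := by
  intro n m m'
  simp only [← wave_eq_vert hs]
  exact h.2 n m m'

omit [CharZero K] in
theorem coeff_zero_gammaMinus (s : K) {σ : Type*} (v : ℕ → σ) (R : Type*) [CommRing R]
    [Algebra K R] : PowerSeries.coeff 0 (gammaMinus s v R) = 1 := by
  rw [gammaMinus, expSeries, PowerSeries.coeff_mk]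
  simp

/-- For a tau function, `∇_i` maps the dressing operator `Φ` to a differential operator times `Φ`,
and so does multiplication by `∂²` from the right. -/
theorem IsKdVTau.isDiff {s : K} (hs : s ≠ 0) {τ : MvPowerSeries ℕ K} (h : IsKdVTau s τ)
    {Ψ : PDO (MvPowerSeries ℕ K)} (hΨ : Ψ * waveOp s τ = 1) :
    (∀ i, (nabla s i (waveOp s τ) * Ψ).IsDiff) ∧ (waveOp s τ * PDO.mono 2 1 * Ψ).IsDiff := by
  have hiter : ∀ (A : PDO (MvPowerSeries ℕ K)) (k : ℕ), HirotaRel s A (waveOp s τ) →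
      HirotaRel s (PDO.mono 1 1 ^ k * A) (waveOp s τ) := by
    intro A k hA
    induction k with
    | zero => rwa [pow_zero, one_mul]
    | succ k ih =>
      rw [pow_succ', mul_assoc, ← nabla_zero s]
      exact ih.nabla_left hs 0
  have hunit : IsUnit ((waveOp s τ).coeff 0) := by
    rw [coeff_waveOp, if_pos le_rfl, zpow_zero, one_smul, neg_zero, Int.toNat_zero,
      coeff_zero_gammaMinus, Module.End.one_apply, MvPowerSeries.isUnit_iff_constantCoeff]
    exact isUnit_iff_ne_zero.mpr h.1
  have h0 : ∀ k, 0 < k → (waveOp s τ).coeff k = 0 := fun k hk => by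
    rw [coeff_waveOp, if_neg (by omega)]
  have hpair : ∀ (A : PDO (MvPowerSeries ℕ K)) (n : ℕ), HirotaRel s A (waveOp s τ) →
      ∀ k : ℕ, PDO.pair (PDO.mono 1 1 ^ k * (A * PDO.mono (2 * n) 1)) (waveOp s τ) = 0 := by
    intro A n hA k
    rw [← mul_assoc]
    exact (hiter A k hA).pair_eq_zero hs n
  have hone : ∀ A : PDO (MvPowerSeries ℕ K), A * PDO.mono (2 * (0 : ℕ)) 1 = A := fun A => mul_one A
  have hΦ := hpair _ 0 (h.hirotaRel hs)
  rw [hone] at hΦ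
  refine ⟨fun i => ?_, ?_⟩
  · refine PDO.isDiff_mul_inverse hunit h0 hΨ hΦ ?_
    have := hpair _ 0 ((h.hirotaRel hs).nabla_left hs i)
    rwa [hone] at this
  · exact PDO.isDiff_mul_inverse hunit h0 hΨ hΦ (hpair _ 1 (h.hirotaRel hs))

end Single

/-! ### Operators with coefficients in functions of `x` and the times -/

section FunDeriv

theorem deriv_mul' {R : Type*} [CommRing R] [Differential R] (a b : R) :
    (a * b)′ = a * b′ + b * a′ :=
  Derivation.leibniz _ a b

variable {ι S : Type*} [CommRing S]

theorem coeff_dx (f : Fun ι S) (m : ι × ℕ →₀ ℕ) :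
    MvPowerSeries.coeff m (dx f) = (MvPowerSeries.coeff m f)′ := rfl

theorem dx_add (f g : Fun ι S) : dx (f + g) = dx f + dx g :=
  MvPowerSeries.ext fun m => by simp only [coeff_dx, map_add]

theorem dx_mul (f g : Fun ι S) : dx (f * g) = f * dx g + g * dx f := by
  classical
  refine MvPowerSeries.ext fun m => ?_
  rw [coeff_dx, map_add, mul_comm g, MvPowerSeries.coeff_mul, MvPowerSeries.coeff_mul,
    MvPowerSeries.coeff_mul, map_sum, ← sum_add_distrib]
  refine sum_congr rfl fun p _ => ?_
  rw [deriv_mul', coeff_dx, coeff_dx, mul_comm (MvPowerSeries.coeff p.2 g)]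

theorem dx_smul {k : Type*} [CommRing k] [Algebra k S] (c : k) (f : Fun ι S) :
    dx (c • f) = c • dx f :=
  MvPowerSeries.ext fun _ => deriv_smul_ps c _

/-- `∂/∂x` as an additive map. -/
noncomputable def dxHom : Fun ι S →+ Fun ι S where
  toFun := dx
  map_zero' := MvPowerSeries.ext fun m => by simp only [coeff_dx, map_zero]
  map_add' := dx_add

/-- The functions of `x` and the times, with the derivation `∂/∂x`. -/
noncomputable instance : Differential (MvPowerSeries (ι × ℕ) (PowerSeries S)) :=
  differentialOf dxHom dx_mul

theorem deriv_fun (f : Fun ι S) : f′ = dx f := rfl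

theorem coeff_iter (n : ℕ) (f : Fun ι S) (m : ι × ℕ →₀ ℕ) :
    MvPowerSeries.coeff m ((fun c : Fun ι S => c′)^[n] f) =
      (fun c : PowerSeries S => c′)^[n] (MvPowerSeries.coeff m f) := by
  induction n generalizing f with
  | zero => rfl
  | succ n ih => rw [Function.iterate_succ_apply, ih]; rfl

/-- An additive map which expands products into a finite sum of products, by maps compatible with
the derivation on the second factor, expands the terms of products of operators in the same way. -/
theorem map_mulTerm_sum {R R' P : Type*} [CommRing R] [Differential R] [CommRing R']
    [Differential R'] (t : Finset P) (g : R →+ R') (g₁ g₂ : P → R → R')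
    (hg : ∀ a b, g (a * b) = ∑ p ∈ t, g₁ p a * g₂ p b)
    (hd : ∀ p n b, g₂ p ((fun c : R => c′)^[n] b) = (fun c : R' => c′)^[n] (g₂ p b))
    (a b : R) (i j k : ℤ) :
    g (PDO.mulTerm a b i j k) = ∑ p ∈ t, PDO.mulTerm (g₁ p a) (g₂ p b) i j k := by
  unfold PDO.mulTerm
  split_ifs
  · rw [map_zsmul, hg, smul_sum]
    simp only [hd]
  · simp

theorem coeff_mulTerm [DecidableEq ι] (f g : Fun ι S) (i j k : ℤ) (m : ι × ℕ →₀ ℕ) :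
    MvPowerSeries.coeff m (PDO.mulTerm f g i j k) = ∑ p ∈ antidiagonal m,
      PDO.mulTerm (MvPowerSeries.coeff p.1 f) (MvPowerSeries.coeff p.2 g) i j k :=
  map_mulTerm_sum (antidiagonal m) (MvPowerSeries.coeff (R := PowerSeries S) m).toAddMonoidHom
    (fun p f => MvPowerSeries.coeff p.1 f) (fun p f => MvPowerSeries.coeff p.2 f)
    (fun a b => MvPowerSeries.coeff_mul m a b) (fun p n b => coeff_iter n b p.2) f g i j k

end FunDeriv

section OpBasic

variable {ι S : Type*} [CommRing S]

theorem coeff_coeffD (k : ℤ) (A : Op ι S) (m : ι × ℕ →₀ ℕ) :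
    MvPowerSeries.coeff m (coeffD k A) = (MvPowerSeries.coeff m A).coeff k := rfl

theorem op_ext {A B : Op ι S} (h : ∀ k, coeffD k A = coeffD k B) : A = B :=
  MvPowerSeries.ext fun m => PDO.ext fun k => by rw [← coeff_coeffD, h, coeff_coeffD]

@[simp] theorem coeffD_add (k : ℤ) (A B : Op ι S) : coeffD k (A + B) = coeffD k A + coeffD k B :=
    rfl

@[simp] theorem coeffD_sub (k : ℤ) (A B : Op ι S) : coeffD k (A - B) = coeffD k A - coeffD k B :=
    rfl

@[simp] theorem coeffD_neg (k : ℤ) (A : Op ι S) : coeffD k (-A) = -coeffD k A := rfl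

@[simp] theorem coeffD_zero (k : ℤ) : coeffD k (0 : Op ι S) = 0 := rfl

@[simp] theorem coeffD_smul {K : Type*} [CommRing K] [Algebra K S] (k : ℤ) (c : K) (A : Op ι S) :
    coeffD k (c • A) = c • coeffD k A := rfl

/-- Taking the coefficient of `∂^k`, as an additive map. -/
noncomputable def coeffDHom (k : ℤ) : Op ι S →+ Fun ι S where
  toFun A := coeffD k A
  map_zero' := rfl
  map_add' _ _ := rfl

@[simp] theorem coeffD_sum {α : Type*} (t : Finset α) (f : α → Op ι S) (k : ℤ) :
    coeffD k (∑ i ∈ t, f i) = ∑ i ∈ t, coeffD k (f i) :=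
  map_sum (coeffDHom k) f t

theorem coeffD_pderivFun (k : ℤ) (v : ι × ℕ) (A : Op ι S) :
    coeffD k (MvPowerSeries.pderivFun v A) = MvPowerSeries.pderivFun v (coeffD k A) :=
  MvPowerSeries.ext fun m => by
    rw [coeff_coeffD, MvPowerSeries.coeff_pderivFun, MvPowerSeries.coeff_pderivFun, coeff_coeffD,
      ← Nat.cast_add_one, ← Nat.cast_add_one, (Nat.cast_commute _ _).eq.symm, ← nsmul_eq_mul,
      ← nsmul_eq_mul']
    exact map_nsmul (PDO.coeffHom k) _ _

theorem coeffD_plus (k : ℤ) (A : Op ι S) : coeffD k (plus A) = if 0 ≤ k then coeffD k A else 0 :=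
  MvPowerSeries.ext fun m => by
    rw [coeff_coeffD]
    change (MvPowerSeries.coeff m A).plus.coeff k = _
    rw [PDO.coeff_plus]
    split_ifs <;> rfl

theorem coeffD_minus (k : ℤ) (A : Op ι S) : coeffD k (minus A) = if 0 ≤ k then 0 else coeffD k A :=
  MvPowerSeries.ext fun m => by
    rw [coeff_coeffD]
    change (MvPowerSeries.coeff m A).minus.coeff k = _
    rw [PDO.coeff_minus]
    split_ifs <;> rfl

theorem plus_add_minus (A : Op ι S) : plus A + minus A = A :=
  op_ext fun k => by
    rw [coeffD_add, coeffD_plus, coeffD_minus]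
    split_ifs <;> simp

/-- Differential operators. -/
def IsDiffOp (A : Op ι S) : Prop := ∀ k < 0, coeffD k A = 0

/-- Operators with only negative powers of `∂`. -/
def IsNegOp (A : Op ι S) : Prop := ∀ k, 0 ≤ k → coeffD k A = 0

theorem isDiffOp_iff {A : Op ι S} : IsDiffOp A ↔ ∀ m, (MvPowerSeries.coeff m A).IsDiff :=
  ⟨fun h m k hk => by rw [← coeff_coeffD, h k hk, map_zero],
    fun h k hk => MvPowerSeries.ext fun m => h m k hk⟩

theorem isNegOp_iff {A : Op ι S} : IsNegOp A ↔ ∀ m, (MvPowerSeries.coeff m A).IsNeg :=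
  ⟨fun h m k hk => by rw [← coeff_coeffD, h k hk, map_zero],
    fun h k hk => MvPowerSeries.ext fun m => h m k hk⟩

theorem isDiffOp_plus (A : Op ι S) : IsDiffOp (plus A) := fun k hk => by
  rw [coeffD_plus, if_neg (not_le.mpr hk)]

theorem isNegOp_minus (A : Op ι S) : IsNegOp (minus A) := fun k hk => by
  rw [coeffD_minus, if_pos hk]

theorem IsDiffOp.minus_eq_zero {A : Op ι S} (h : IsDiffOp A) : minus A = 0 := op_ext fun k => by
  rw [coeffD_minus]
  split_ifs with hk
  · rfl
  · exact h k (not_le.mp hk)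

theorem IsNegOp.minus_eq {A : Op ι S} (h : IsNegOp A) : minus A = A := op_ext fun k => by
  rw [coeffD_minus]
  split_ifs with hk
  · exact (h k hk).symm
  · rfl

theorem minus_add (A B : Op ι S) : minus (A + B) = minus A + minus B := op_ext fun k => by
  simp only [coeffD_add, coeffD_minus]
  split_ifs <;> simp

theorem minus_sub (A B : Op ι S) : minus (A - B) = minus A - minus B := op_ext fun k => by
  simp only [coeffD_sub, coeffD_minus]
  split_ifs <;> simp

theorem minus_smul {K : Type*} [CommRing K] [Algebra K S] (c : K) (A : Op ι S) :
    minus (c • A) = c • minus A := op_ext fun k => by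
  simp only [coeffD_smul, coeffD_minus]
  split_ifs <;> simp

theorem minus_pderivFun (v : ι × ℕ) (A : Op ι S) :
    minus (MvPowerSeries.pderivFun v A) = MvPowerSeries.pderivFun v (minus A) := op_ext fun k => by
  simp only [coeffD_pderivFun, coeffD_minus]
  split_ifs
  · rw [← pderiv_eq_pderivFun, map_zero]
  · rfl

theorem IsDiffOp.add {A B : Op ι S} (hA : IsDiffOp A) (hB : IsDiffOp B) : IsDiffOp (A + B) :=
  fun k hk => by rw [coeffD_add, hA k hk, hB k hk, add_zero]

theorem IsDiffOp.smul {K : Type*} [CommRing K] [Algebra K S] (c : K) {A : Op ι S}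
    (hA : IsDiffOp A) : IsDiffOp (c • A) :=
  fun k hk => by rw [coeffD_smul, hA k hk, smul_zero]

theorem IsDiffOp.sum {α : Type*} {t : Finset α} {f : α → Op ι S} (h : ∀ i ∈ t, IsDiffOp (f i)) :
    IsDiffOp (∑ i ∈ t, f i) :=
  fun k hk => by rw [coeffD_sum, sum_eq_zero fun i hi => h i hi k hk]

theorem IsDiffOp.pderivFun {A : Op ι S} (h : IsDiffOp A) (v : ι × ℕ) :
    IsDiffOp (MvPowerSeries.pderivFun v A) :=
  fun k hk => by rw [coeffD_pderivFun, h k hk, ← pderiv_eq_pderivFun, map_zero]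

theorem IsDiffOp.mul {A B : Op ι S} (hA : IsDiffOp A) (hB : IsDiffOp B) : IsDiffOp (A * B) := by
  classical
  rw [isDiffOp_iff] at *
  intro m k hk
  rw [MvPowerSeries.coeff_mul, PDO.coeff_sum]
  exact sum_eq_zero fun p _ => (hA p.1).mul (hB p.2) k hk

theorem IsNegOp.mul {A B : Op ι S} (hA : IsNegOp A) (hB : IsNegOp B) : IsNegOp (A * B) := by
  classical
  rw [isNegOp_iff] at *
  intro m k hk
  rw [MvPowerSeries.coeff_mul, PDO.coeff_sum]
  exact sum_eq_zero fun p _ => (hA p.1).mul (hB p.2) k hk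

/-- Multiplication by a function acts on each coefficient. -/
theorem coeffD_ofFun_mul (f : Fun ι S) (A : Op ι S) (k : ℤ) :
    coeffD k (ofFun f * A) = f * coeffD k A := by
  classical
  refine MvPowerSeries.ext fun m => ?_
  rw [coeff_coeffD, MvPowerSeries.coeff_mul, MvPowerSeries.coeff_mul, PDO.coeff_sum]
  refine sum_congr rfl fun p _ => ?_
  rw [coeff_coeffD]
  exact PDO.coeff_mono_zero_mul _ _ _

theorem coeffD_ofFun (f : Fun ι S) (k : ℤ) : coeffD k (ofFun f) = if k = 0 then f else 0 :=
  MvPowerSeries.ext fun m => by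
    rw [coeff_coeffD]
    change (PDO.mono 0 (MvPowerSeries.coeff m f)).coeff k = _
    rw [PDO.coeff_mono]
    split_ifs <;> rfl

/-- Functions as operators, as a ring homomorphism. -/
noncomputable def ofFunHom : Fun ι S →+* Op ι S where
  toFun := ofFun
  map_zero' := op_ext fun k => by rw [coeffD_ofFun]; split_ifs <;> rfl
  map_one' := by
    classical
    refine MvPowerSeries.ext fun m => ?_
    change PDO.mono 0 (MvPowerSeries.coeff m (1 : Fun ι S)) = _
    rw [MvPowerSeries.coeff_one, MvPowerSeries.coeff_one]
    split_ifs
    · rfl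
    · exact PDO.ext fun k => by rw [PDO.coeff_mono]; split_ifs <;> rfl
  map_add' f g := op_ext fun k => by
    simp only [coeffD_ofFun, coeffD_add]; split_ifs <;> simp
  map_mul' f g := op_ext fun k => by
    rw [coeffD_ofFun_mul, coeffD_ofFun, coeffD_ofFun]; split_ifs <;> simp

theorem ofFun_add (f g : Fun ι S) : ofFun (f + g) = ofFun f + ofFun g := map_add ofFunHom f g

theorem ofFun_mul (f g : Fun ι S) : ofFun (f * g) = ofFun f * ofFun g := map_mul ofFunHom f g

theorem ofFun_one : ofFun (1 : Fun ι S) = 1 := map_one ofFunHom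

theorem isDiffOp_ofFun (f : Fun ι S) : IsDiffOp (ofFun f) := fun k hk => by
  rw [coeffD_ofFun, if_neg (by omega)]

theorem pderivFun_ofFun (v : ι × ℕ) (f : Fun ι S) :
    MvPowerSeries.pderivFun v (ofFun f) = ofFun (MvPowerSeries.pderivFun v f) :=
  op_ext fun k => by
    rw [coeffD_pderivFun, coeffD_ofFun, coeffD_ofFun]
    split_ifs
    · rfl
    · rw [← pderiv_eq_pderivFun, map_zero]

theorem coeffD_one (k : ℤ) : coeffD k (1 : Op ι S) = if k = 0 then 1 else 0 := by
  rw [← ofFun_one, coeffD_ofFun]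

variable {K : Type*} [Field K] [Algebra K S]

theorem coeffD_mul_sd (A : Op ι S) (s : K) (n k : ℤ) :
    coeffD k (A * sd s n) = s ^ n • coeffD (k - n) A := by
  rw [sd, mul_smul_comm, coeffD_smul]
  congr 1
  refine MvPowerSeries.ext fun m => ?_
  rw [coeff_coeffD, coeff_coeffD, MvPowerSeries.coeff_mul_C, PDO.coeff_mul_mono_one]

theorem coeffD_sd (s : K) (n k : ℤ) :
    coeffD k (sd s n : Op ι S) = s ^ n • if k = n then 1 else 0 := by
  rw [← one_mul (sd s n), coeffD_mul_sd, coeffD_one]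
  congr 1
  exact if_congr (by omega) rfl rfl

theorem sd_mul_sd {s : K} (hs : s ≠ 0) (n m : ℤ) : (sd s n * sd s m : Op ι S) = sd s (n + m) :=
  op_ext fun k => by
    rw [coeffD_mul_sd, coeffD_sd, coeffD_sd, smul_smul, ← zpow_add₀ hs, add_comm m]
    congr 1
    exact if_congr (by omega) rfl rfl

theorem sd_zero (s : K) : (sd s 0 : Op ι S) = 1 := op_ext fun k => by
  rw [coeffD_sd, coeffD_one, zpow_zero, one_smul]

theorem pderivFun_sd (v : ι × ℕ) (s : K) (n : ℤ) :
    MvPowerSeries.pderivFun v (sd s n : Op ι S) = 0 := by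
  rw [sd, pderivFun_smul, MvPowerSeries.pderivFun_C, smul_zero]

end OpBasic

section ToOp
variable {ι S : Type*} [CommRing S]

/-- The function underlying `toOp`. -/
noncomputable def toOpFun (A : PDO (Fun ι S)) : Op ι S :=
  fun m => ⟨fun k => MvPowerSeries.coeff m (A.coeff k), by
    obtain ⟨M, hM⟩ := A.bdd
    exact ⟨M, fun k hk => by simp [hM k hk]⟩⟩

theorem coeff_toOpFun (A : PDO (Fun ι S)) (m : ι × ℕ →₀ ℕ) (k : ℤ) :
    (MvPowerSeries.coeff m (toOpFun A)).coeff k = MvPowerSeries.coeff m (A.coeff k) := rfl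

/-- Operators whose order is bounded independently of the monomial in the times, as operators. -/
noncomputable def toOp : PDO (Fun ι S) →+* Op ι S where
  toFun := toOpFun
  map_zero' := op_ext fun _ => rfl
  map_one' := op_ext fun k => by rw [coeffD_one, ← PDO.coeff_one]; rfl
  map_add' _ _ := op_ext fun _ => rfl
  map_mul' A B := MvPowerSeries.ext fun m => PDO.ext fun k => by
    classical
    obtain ⟨M, hM⟩ := A.bdd
    obtain ⟨N, hN⟩ := B.bdd
    rw [MvPowerSeries.coeff_mul, PDO.coeff_sum, coeff_toOpFun,
      PDO.coeff_mul_eq hM hN k _ _ subset_rfl subset_rfl, map_sum]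
    simp only [map_sum, coeff_mulTerm]
    rw [sum_congr rfl fun i _ => sum_comm, sum_comm]
    refine sum_congr rfl fun p _ => ?_
    rw [PDO.coeff_mul_eq (M := M) (N := N) ?_ ?_ k _ _ subset_rfl subset_rfl]
    · simp only [coeff_toOpFun]
    · intro k hk
      rw [coeff_toOpFun, hM k hk, map_zero]
    · intro k hk
      rw [coeff_toOpFun, hN k hk, map_zero]

@[simp] theorem coeffD_toOp (A : PDO (Fun ι S)) (k : ℤ) : coeffD k (toOp A) = A.coeff k := rfl

end ToOp

/-! ### Locally finite sums -/

section Fsum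

variable {σ τ ρ R R' R'' : Type*} [Ring R] [Ring R'] [Ring R'']

/-- A sequence of series each of whose coefficients vanishes for all but finitely many members. -/
def LocFin (g : ℕ → MvPowerSeries σ R) : Prop :=
  ∀ m, (Function.support fun n => MvPowerSeries.coeff m (g n)).Finite

theorem coeff_fsum (g : ℕ → MvPowerSeries σ R) (m : σ →₀ ℕ) :
    MvPowerSeries.coeff m (fsum g) = ∑ᶠ n, MvPowerSeries.coeff m (g n) := rfl

theorem fsum_add {g h : ℕ → MvPowerSeries σ R} (hg : LocFin g) (hh : LocFin h) :
    fsum (fun n => g n + h n) = fsum g + fsum h :=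
  MvPowerSeries.ext fun m => by
    rw [map_add, coeff_fsum, coeff_fsum, coeff_fsum, ← finsum_add_distrib (hg m) (hh m)]
    rfl

/-- Maps which commute with locally finite sums. -/
def FsumCompat (L : MvPowerSeries σ R → MvPowerSeries τ R') : Prop :=
  ∀ g, LocFin g → LocFin (fun n => L (g n)) ∧ L (fsum g) = fsum fun n => L (g n)

theorem FsumCompat.locFin {L : MvPowerSeries σ R → MvPowerSeries τ R'} (h : FsumCompat L)
    {g : ℕ → MvPowerSeries σ R} (hg : LocFin g) : LocFin fun n => L (g n) := (h g hg).1

theorem FsumCompat.eq {L : MvPowerSeries σ R → MvPowerSeries τ R'} (h : FsumCompat L)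
    {g : ℕ → MvPowerSeries σ R} (hg : LocFin g) : L (fsum g) = fsum fun n => L (g n) := (h g hg).2

theorem LocFin.add {g h : ℕ → MvPowerSeries σ R} (hg : LocFin g) (hh : LocFin h) :
    LocFin fun n => g n + h n := fun m => ((hg m).union (hh m)).subset fun n hn => by
  by_contra h0
  rw [Set.mem_union, not_or, Function.notMem_support, Function.notMem_support] at h0
  exact hn (by simp only [map_add, h0.1, h0.2, add_zero])

theorem FsumCompat.comp {L : MvPowerSeries σ R → MvPowerSeries τ R'}
    {L' : MvPowerSeries τ R' → MvPowerSeries ρ R''} (h' : FsumCompat L') (h : FsumCompat L) :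
    FsumCompat (fun f => L' (L f)) := fun g hg => by
  obtain ⟨h1, h2⟩ := h g hg
  obtain ⟨h3, h4⟩ := h' _ h1
  exact ⟨h3, by dsimp only; rw [h2, h4]⟩

theorem FsumCompat.add {L L' : MvPowerSeries σ R → MvPowerSeries τ R'} (h : FsumCompat L)
    (h' : FsumCompat L') : FsumCompat (fun f => L f + L' f) := fun g hg =>
  ⟨(h g hg).1.add (h' g hg).1, by
    dsimp only
    rw [fsum_add (h g hg).1 (h' g hg).1, (h g hg).2, (h' g hg).2]⟩

theorem fsumCompat_zero : FsumCompat (fun _ : MvPowerSeries σ R => (0 : MvPowerSeries τ R')) :=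
  fun g _ => ⟨fun m => by simp, MvPowerSeries.ext fun m => by simp [coeff_fsum]⟩

theorem fsumCompat_id : FsumCompat (fun f : MvPowerSeries σ R => f) := fun _ hg => ⟨hg, rfl⟩

theorem FsumCompat.sum {α : Type*} (t : Finset α) {L : α → MvPowerSeries σ R → MvPowerSeries τ R'}
    (h : ∀ i ∈ t, FsumCompat (L i)) : FsumCompat (fun f => ∑ i ∈ t, L i f) := by
  classical
  induction t using Finset.induction_on with
  | empty => simpa using fsumCompat_zero
  | insert a t ha ih =>
    simp only [sum_insert ha]
    exact (h a (mem_insert_self a t)).add (ih fun i hi => h i (mem_insert_of_mem hi))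

/-- It suffices that each coefficient of `L f` is a finite sum of additive functions of the
coefficients of `f`. -/
theorem fsumCompat_of_coeff {L : MvPowerSeries σ R → MvPowerSeries τ R'}
    (h : ∀ m, ∃ (t : Finset (σ →₀ ℕ)) (φ : (σ →₀ ℕ) → R →+ R'),
      ∀ f, MvPowerSeries.coeff m (L f) = ∑ i ∈ t, φ i (MvPowerSeries.coeff i f)) :
    FsumCompat L := by
  intro g hg
  refine ⟨fun m => ?_, MvPowerSeries.ext fun m => ?_⟩
  · obtain ⟨t, φ, hφ⟩ := h m
    refine (t.finite_toSet.biUnion fun i _ => hg i).subset fun n hn => ?_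
    by_contra h0
    simp only [Set.mem_iUnion, not_exists, Function.notMem_support] at h0
    exact hn (by dsimp only; rw [hφ]; exact sum_eq_zero fun i hi => by rw [h0 i hi, map_zero])
  · obtain ⟨t, φ, hφ⟩ := h m
    rw [hφ, coeff_fsum]
    simp only [hφ, coeff_fsum]
    rw [finsum_sum_comm]
    · exact sum_congr rfl fun i _ => (φ i).map_finsum (hg i)
    · intro i _
      refine (hg i).subset fun n hn h0 => hn ?_
      dsimp only at h0 ⊢
      rw [h0, map_zero]

theorem fsumCompat_pderivFun (v : σ) :
    FsumCompat (fun f : MvPowerSeries σ R => MvPowerSeries.pderivFun v f) :=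
  fsumCompat_of_coeff fun m => ⟨{m + Finsupp.single v 1},
    fun _ => AddMonoidHom.mulRight (m v + 1 : R),
    fun f => by rw [sum_singleton, MvPowerSeries.coeff_pderivFun]; rfl⟩

theorem fsumCompat_mulLeft (f : MvPowerSeries σ R) : FsumCompat (fun g => f * g) := by
  classical
  refine fsumCompat_of_coeff fun m => ⟨Finset.Iic m, fun i =>
    AddMonoidHom.mulLeft (MvPowerSeries.coeff (m - i) f), fun g => ?_⟩
  rw [MvPowerSeries.coeff_mul]
  refine Finset.sum_bij' (fun p _ => p.2) (fun i _ => (m - i, i)) ?_ ?_ ?_ ?_ ?_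
  · intro p hp
    rw [HasAntidiagonal.mem_antidiagonal] at hp
    rw [mem_Iic, ← hp]
    exact le_add_self
  · intro i hi
    rw [HasAntidiagonal.mem_antidiagonal]
    exact tsub_add_cancel_of_le (mem_Iic.mp hi)
  · intro p hp
    rw [HasAntidiagonal.mem_antidiagonal] at hp
    exact Prod.ext (by rw [← hp, add_tsub_cancel_right]) rfl
  · intro i _
    rfl
  · intro p hp
    rw [HasAntidiagonal.mem_antidiagonal] at hp
    rw [AddMonoidHom.coe_mulLeft, ← hp, add_tsub_cancel_right]

theorem fsumCompat_mulRight (f : MvPowerSeries σ R) : FsumCompat (fun g => g * f) := by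
  classical
  refine fsumCompat_of_coeff fun m => ⟨Finset.Iic m, fun i =>
    AddMonoidHom.mulRight (MvPowerSeries.coeff (m - i) f), fun g => ?_⟩
  rw [MvPowerSeries.coeff_mul]
  refine Finset.sum_bij' (fun p _ => p.1) (fun i _ => (i, m - i)) ?_ ?_ ?_ ?_ ?_
  · intro p hp
    rw [HasAntidiagonal.mem_antidiagonal] at hp
    rw [mem_Iic, ← hp]
    exact le_self_add
  · intro i hi
    rw [HasAntidiagonal.mem_antidiagonal]
    exact add_tsub_cancel_of_le (mem_Iic.mp hi)
  · intro p hp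
    rw [HasAntidiagonal.mem_antidiagonal] at hp
    exact Prod.ext rfl (by rw [← hp, add_tsub_cancel_left])
  · intro i _
    rfl
  · intro p hp
    rw [HasAntidiagonal.mem_antidiagonal] at hp
    rw [AddMonoidHom.coe_mulRight, ← hp, add_tsub_cancel_left]

theorem fsumCompat_smul {k : Type*} [CommRing k] [Module k R] (c : k) :
    FsumCompat (fun g : MvPowerSeries σ R => c • g) :=
  fsumCompat_of_coeff fun m => ⟨{m}, fun _ => DistribSMul.toAddMonoidHom R c, fun g => by
    rw [sum_singleton]; rfl⟩

/-- Products `X_{v n} g_n` with distinct variables form a locally finite sequence. -/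
theorem locFin_X_mul {v : ℕ → σ} (hv : Function.Injective v) (g : ℕ → MvPowerSeries σ R) :
    LocFin fun n => MvPowerSeries.X (v n) * g n := by
  classical
  intro m
  refine (m.support.finite_toSet.preimage hv.injOn).subset fun n hn => ?_
  rw [Set.mem_preimage, mem_coe, Finsupp.mem_support_iff]
  intro h0
  apply hn
  dsimp only
  rw [MvPowerSeries.X_def, MvPowerSeries.coeff_monomial_mul, if_neg]
  rw [Finsupp.single_le_iff]
  omega

end Fsum

section OpSum
variable {ι S : Type*} [CommRing S]

theorem fsumCompat_coeffD (k : ℤ) : FsumCompat (fun A : Op ι S => coeffD k A) :=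
  fsumCompat_of_coeff fun m => ⟨{m}, fun _ => PDO.coeffHom k, fun A => by
    rw [sum_singleton]; rfl⟩

/-- For each monomial, the orders of the members of the sequence are bounded. -/
def OrdBdd (G : ℕ → Op ι S) : Prop :=
  ∀ m, ∃ M : ℤ, ∀ n k, M < k → MvPowerSeries.coeff m (coeffD k (G n)) = 0

theorem coeffD_opSum {G : ℕ → Op ι S} (hG : OrdBdd G) (k : ℤ) :
    coeffD k (opSum G) = fsum fun n => coeffD k (G n) :=
  MvPowerSeries.ext fun m => by
    rw [coeff_coeffD, coeff_fsum]
    change (PDO.ofCoeffs _).coeff k = _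
    rw [PDO.coeff_ofCoeffs]
    · rfl
    · obtain ⟨M, hM⟩ := hG m
      refine ⟨M, fun k hk => finsum_eq_zero_of_forall_eq_zero fun n => hM n k hk⟩

theorem ordBdd_of_forall {G : ℕ → Op ι S} (M : ℤ) (h : ∀ n k, M < k → coeffD k (G n) = 0) :
    OrdBdd G := fun m => ⟨M, fun n k hk => by rw [h n k hk, map_zero]⟩

theorem LocFin.ordBdd {G : ℕ → Op ι S} (hG : LocFin G) : OrdBdd G := by
  intro m
  choose M hM using fun n => (MvPowerSeries.coeff m (G n)).bdd
  obtain ⟨B, hB⟩ := ((hG m).image M).bddAbove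
  refine ⟨B, fun n k hk => ?_⟩
  rw [coeff_coeffD]
  by_cases h : MvPowerSeries.coeff m (G n) = 0
  · rw [h, PDO.coeff_zero]
  · exact hM n k (lt_of_le_of_lt (hB ⟨n, h, rfl⟩) hk)

theorem LocFin.opSum_eq {G : ℕ → Op ι S} (hG : LocFin G) : opSum G = fsum G :=
  op_ext fun k => by rw [coeffD_opSum hG.ordBdd, (fsumCompat_coeffD k).eq hG]

theorem OrdBdd.ofFun_mul {G : ℕ → Op ι S} (hG : OrdBdd G) (f : Fun ι S) :
    OrdBdd fun n => ofFun f * G n := by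
  classical
  intro m
  choose M hM using hG
  obtain ⟨B, hB⟩ := ((Finset.Iic m).finite_toSet.image M).bddAbove
  refine ⟨B, fun n k hk => ?_⟩
  rw [coeffD_ofFun_mul, MvPowerSeries.coeff_mul]
  refine sum_eq_zero fun p hp => ?_
  rw [HasAntidiagonal.mem_antidiagonal] at hp
  rw [hM p.2 n k (lt_of_le_of_lt (hB ⟨p.2, ?_, rfl⟩) hk), mul_zero]
  rw [mem_coe, mem_Iic, ← hp]
  exact le_add_self

theorem ofFun_mul_opSum {G : ℕ → Op ι S} (hG : OrdBdd G) (hk : ∀ k, LocFin fun n => coeffD k (G n))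
    (f : Fun ι S) : ofFun f * opSum G = opSum fun n => ofFun f * G n :=
  op_ext fun k => by
    rw [coeffD_ofFun_mul, coeffD_opSum hG, coeffD_opSum (hG.ofFun_mul f),
      (fsumCompat_mulLeft f).eq (hk k)]
    simp only [coeffD_ofFun_mul]

theorem isDiffOp_fsum {G : ℕ → Op ι S} (hG : LocFin G) (h : ∀ n, IsDiffOp (G n)) :
    IsDiffOp (fsum G) := fun k hk => by
  rw [(fsumCompat_coeffD k).eq hG]
  simp only [h _ k hk]
  exact MvPowerSeries.ext fun m => by simp [coeff_fsum]

end OpSum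

/-! ### The vertex operator `Γ₋` -/

section GammaMinus

variable {K : Type*} [Field K]

theorem coeff_zero_gammaMinus_exponent (s : K) {σ : Type*} (v : ℕ → σ) (R : Type*) [CommRing R]
    [Algebra K R] : PowerSeries.coeff 0 (PowerSeries.mk fun k : ℕ => if Odd k then
      (-(s * cb K (k / 2))) • (MvPowerSeries.pderiv R (v (k / 2))).toLinearMap else 0) = 0 := by
  simp

/-- `Γ₋` commutes with every map which intertwines the derivatives with respect to the times. -/
theorem gammaMinus_intertwine (s : K) {σ σ' : Type*} (v : ℕ → σ) (v' : ℕ → σ') {R R' : Type*}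
    [CommRing R] [Algebra K R] [CommRing R'] [Algebra K R']
    (Ψ : MvPowerSeries σ R →ₗ[K] MvPowerSeries σ' R')
    (h : ∀ n f, Ψ (MvPowerSeries.pderivFun (v n) f) = MvPowerSeries.pderivFun (v' n) (Ψ f))
    (k : ℕ) (f : MvPowerSeries σ R) :
    Ψ (PowerSeries.coeff k (gammaMinus s v R) f) = PowerSeries.coeff k (gammaMinus s v' R')
    (Ψ f) := by
  refine expSeries_rel (K := K)
    (fun (E : Module.End R (MvPowerSeries σ R)) (E' : Module.End R' (MvPowerSeries σ' R')) =>
      ∀ f, Ψ (E f) = E' (Ψ f)) (fun f => by simp) (fun f => rfl)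
    (fun a b a' b' ha hb f => by rw [LinearMap.add_apply, map_add, ha, hb, LinearMap.add_apply])
    (fun a b a' b' ha hb f => by rw [Module.End.mul_apply, ha, hb, Module.End.mul_apply])
    (fun c a a' ha f => by rw [LinearMap.smul_apply, map_smul, ha, LinearMap.smul_apply])
    (fun k f => ?_) k f
  rw [PowerSeries.coeff_mk, PowerSeries.coeff_mk]
  split_ifs
  · rw [LinearMap.smul_apply, LinearMap.smul_apply, map_smul]
    congr 1
    change Ψ (MvPowerSeries.pderiv R _ f) = MvPowerSeries.pderiv R' _ (Ψ f)
    rw [pderiv_eq_pderivFun, pderiv_eq_pderivFun, h]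
  · simp

theorem fsumCompat_gammaMinus (s : K) {σ : Type*} (v : ℕ → σ) {R : Type*} [CommRing R]
    [Algebra K R] (k : ℕ) :
    FsumCompat (fun f => PowerSeries.coeff k (gammaMinus s v R) f) := by
  refine expSeries_rel (K := K)
    (fun (E _ : Module.End R (MvPowerSeries σ R)) => FsumCompat (fun f => E f))
    fsumCompat_zero fsumCompat_id
    (fun a b a' b' ha hb => ha.add hb) (fun a b a' b' ha hb => ha.comp hb)
    (fun c a a' ha => by simpa only [LinearMap.smul_apply] using (fsumCompat_smul c).comp ha) (fun k => ?_) k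
    (f' := PowerSeries.mk fun k : ℕ => if Odd k then
      (-(s * cb K (k / 2))) • (MvPowerSeries.pderiv R (v (k / 2))).toLinearMap else 0)
  rw [PowerSeries.coeff_mk]
  split_ifs
  · refine (fsumCompat_smul _).comp (L := fun f => MvPowerSeries.pderiv R (v (k / 2)) f) ?_
    simp only [pderiv_eq_pderivFun]
    exact fsumCompat_pderivFun _
  · exact fsumCompat_zero

theorem pderivFun_comm {σ R : Type*} [CommRing R] (v w : σ) (f : MvPowerSeries σ R) :
    MvPowerSeries.pderivFun v (MvPowerSeries.pderivFun w f) =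
      MvPowerSeries.pderivFun w (MvPowerSeries.pderivFun v f) := by
  classical
  refine MvPowerSeries.ext fun m => ?_
  simp only [MvPowerSeries.coeff_pderivFun, add_right_comm m, Finsupp.add_apply]
  by_cases h : v = w
  · rw [h]
  · rw [Finsupp.single_eq_of_ne h, Finsupp.single_eq_of_ne (Ne.symm h)]
    push_cast
    ring

/-- Multiplication by a function `t` which is affine linear in the times `q_{v n}` does not
commute with `Γ₋`: `Γ₋ t = (t - s ∑ b_n λ^{-2n-1} ∂t/∂q_{v n}) Γ₋`. -/
theorem gammaMinus_mul [CharZero K] (s : K) {σ : Type*} (v : ℕ → σ) {R : Type*} [CommRing R]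
    [Algebra K R]
    (t : MvPowerSeries σ R) (c : ℕ → R)
    (hc : ∀ n, MvPowerSeries.pderivFun (v n) t = MvPowerSeries.C (c n)) (k : ℕ)
    (g : MvPowerSeries σ R) :
    PowerSeries.coeff k (gammaMinus s v R) (t * g) =
      t * PowerSeries.coeff k (gammaMinus s v R) g + ∑ p ∈ antidiagonal k, if Odd p.1 then
        (-(s * cb K (p.1 / 2))) • (c (p.1 / 2) • PowerSeries.coeff p.2 (gammaMinus s v R) g)
        else 0 := by
  set M : Module.End R (MvPowerSeries σ R) := LinearMap.mulLeft R t with hM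
  have hd : ∀ k, PowerSeries.coeff k (PowerSeries.mk fun k : ℕ => if Odd k then
      (-(s * cb K (k / 2))) • (MvPowerSeries.pderiv R (v (k / 2))).toLinearMap else 0) * M -
      M * PowerSeries.coeff k (PowerSeries.mk fun k : ℕ => if Odd k then
      (-(s * cb K (k / 2))) • (MvPowerSeries.pderiv R (v (k / 2))).toLinearMap else 0) =
      if Odd k then (-(s * cb K (k / 2))) • (c (k / 2) • (1 : Module.End R (MvPowerSeries σ R)))
      else 0 := by
    intro k
    rw [PowerSeries.coeff_mk]
    split_ifs
    · refine LinearMap.ext fun f => ?_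
      simp only [LinearMap.sub_apply, Module.End.mul_apply, LinearMap.smul_apply,
        Module.End.one_apply, hM, LinearMap.mulLeft_apply, Derivation.coeFn_coe,
        pderiv_eq_pderivFun, pderivFun_mul, hc, mul_smul_comm, ← smul_sub]
      rw [MvPowerSeries.smul_eq_C_mul]
      congr 1
      ring
    · simp
  -- the commutator with `M` is a derivation which maps the exponent of `Γ₋` to scalars
  have key := derivation_expSeries (K := K) (B := Module.End R (MvPowerSeries σ R))
    (AddMonoidHom.mulRight M - AddMonoidHom.mulLeft M)
    (fun a b => by
      simp only [AddMonoidHom.sub_apply, AddMonoidHom.coe_mulRight, AddMonoidHom.coe_mulLeft]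
      rw [sub_mul, mul_sub]
      simp only [mul_assoc]
      abel)
    (fun c a => by
      simp only [AddMonoidHom.sub_apply, AddMonoidHom.coe_mulRight, AddMonoidHom.coe_mulLeft]
      rw [smul_mul_assoc, mul_smul_comm, smul_sub])
    (coeff_zero_gammaMinus_exponent s v R)
    (fun i j => by
      simp only [AddMonoidHom.sub_apply, AddMonoidHom.coe_mulRight, AddMonoidHom.coe_mulLeft, hd]
      split_ifs
      · exact (((Commute.one_left _).smul_left _).smul_left _)
      · exact Commute.zero_left _) k
  simp only [AddMonoidHom.sub_apply, AddMonoidHom.coe_mulRight, AddMonoidHom.coe_mulLeft, hd] at key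
  have key2 := LinearMap.congr_fun key g
  rw [LinearMap.sub_apply, Module.End.mul_apply, Module.End.mul_apply, hM, LinearMap.mulLeft_apply,
    LinearMap.mulLeft_apply, sub_eq_iff_eq_add'] at key2
  rw [gammaMinus, key2, LinearMap.sum_apply]
  congr 1
  refine sum_congr rfl fun p _ => ?_
  split_ifs
  · rw [smul_mul_assoc, smul_mul_assoc, one_mul, LinearMap.smul_apply, LinearMap.smul_apply]
  · simp

end GammaMinus

/-! ### Extension of scalars to the dual numbers -/

section Ext
variable {K : Type*} [Field K] {ι : Type*}

theorem map_deriv_ps {S S' : Type*} [CommRing S] [CommRing S'] (φ : S →+* S') (f : PowerSeries S) :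
    PowerSeries.map φ f′ = (PowerSeries.map φ f)′ := by
  refine PowerSeries.ext fun n => ?_
  rw [PowerSeries.coeff_map]
  change φ (PowerSeries.coeff n (PowerSeries.derivative S f)) =
    PowerSeries.coeff n (PowerSeries.derivative S' (PowerSeries.map φ f))
  rw [PowerSeries.coeff_derivative, PowerSeries.coeff_derivative, PowerSeries.coeff_map, map_mul]
  simp

/-- Extension of scalars of functions, as a ring homomorphism. -/
noncomputable def extFunHom : Fun ι K →+* Fun ι (DualNumber K) :=
  MvPowerSeries.map (PowerSeries.map (algebraMap K (DualNumber K)))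

/-- Extension of scalars of operators, as a ring homomorphism. -/
noncomputable def extOpHom : Op ι K →+* Op ι (DualNumber K) :=
  MvPowerSeries.map (PDO.mapHom (PowerSeries.map (algebraMap K (DualNumber K)))
    (fun f => map_deriv_ps _ f))

theorem extFunHom_apply (f : Fun ι K) : extFunHom f = extFun f := rfl

theorem extOpHom_apply (A : Op ι K) : extOpHom A = extOp A := rfl

theorem coeffD_extOp (k : ℤ) (A : Op ι K) : coeffD k (extOp A) = extFun (coeffD k A) := rfl

theorem extOp_mul (A B : Op ι K) : extOp (A * B) = extOp A * extOp B := map_mul extOpHom A B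

theorem extOp_add (A B : Op ι K) : extOp (A + B) = extOp A + extOp B := map_add extOpHom A B

theorem extOp_sub (A B : Op ι K) : extOp (A - B) = extOp A - extOp B := map_sub extOpHom A B

theorem extOp_one : extOp (1 : Op ι K) = 1 := map_one extOpHom

theorem extFun_mul (f g : Fun ι K) : extFun (f * g) = extFun f * extFun g := map_mul extFunHom f g

theorem extFun_add (f g : Fun ι K) : extFun (f + g) = extFun f + extFun g := map_add extFunHom f g

theorem extFun_one : extFun (1 : Fun ι K) = 1 := map_one extFunHom

theorem extFun_zero : extFun (0 : Fun ι K) = 0 := map_zero extFunHom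

theorem map_algebraMap_smul (c : K) (f : PowerSeries K) :
    PowerSeries.map (algebraMap K (DualNumber K)) (c • f) =
      c • PowerSeries.map (algebraMap K (DualNumber K)) f := by
  refine PowerSeries.ext fun n => ?_
  rw [PowerSeries.coeff_map, LinearMap.map_smul_of_tower, LinearMap.map_smul_of_tower,
    PowerSeries.coeff_map, Algebra.smul_def, Algebra.smul_def, map_mul]
  rfl

theorem extFun_smul (c : K) (f : Fun ι K) : extFun (c • f) = c • extFun f :=
  MvPowerSeries.ext fun _ => map_algebraMap_smul c _

theorem extOp_smul (c : K) (A : Op ι K) : extOp (c • A) = c • extOp A :=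
  op_ext fun k => by rw [coeffD_extOp, coeffD_smul, coeffD_smul, extFun_smul, coeffD_extOp]

theorem pderivFun_extFun (v : ι × ℕ) (f : Fun ι K) :
    MvPowerSeries.pderivFun v (extFun f) = extFun (MvPowerSeries.pderivFun v f) :=
  MvPowerSeries.ext fun m => by
    rw [MvPowerSeries.coeff_pderivFun]
    simp only [← extFunHom_apply, extFunHom, MvPowerSeries.coeff_map]
    rw [MvPowerSeries.coeff_pderivFun, map_mul, map_add, map_natCast, map_one]

theorem dx_extFun (f : Fun ι K) : dx (extFun f) = extFun (dx f) :=
  MvPowerSeries.ext fun m => by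
    rw [coeff_dx]
    exact (map_deriv_ps (algebraMap K (DualNumber K)) (MvPowerSeries.coeff m f)).symm

theorem pderivFun_extOp (v : ι × ℕ) (A : Op ι K) :
    MvPowerSeries.pderivFun v (extOp A) = extOp (MvPowerSeries.pderivFun v A) :=
  op_ext fun k => by
    simp only [coeffD_pderivFun, coeffD_extOp, pderivFun_extFun]

theorem minus_extOp (A : Op ι K) : minus (extOp A) = extOp (minus A) :=
  op_ext fun k => by
    simp only [coeffD_minus, coeffD_extOp]
    split_ifs
    · exact extFun_zero.symm
    · rfl

theorem extOp_ofFun (f : Fun ι K) : extOp (ofFun f) = ofFun (extFun f) :=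
  op_ext fun k => by
    simp only [coeffD_ofFun, coeffD_extOp]
    split_ifs
    · rfl
    · exact extFun_zero

theorem extOp_sd (s : K) (n : ℤ) : extOp (sd s n : Op ι K) = sd s n :=
  op_ext fun k => by
    simp only [coeffD_sd, coeffD_extOp, extFun_smul]
    split_ifs
    · rw [extFun_one]
    · rw [extFun_zero]

theorem eps_smul_eps_smul {M : Type*} [AddCommGroup M] [Module (DualNumber K) M] (x : M) :
    (DualNumber.eps : DualNumber K) • (DualNumber.eps : DualNumber K) • x = 0 := by
  rw [smul_smul, DualNumber.eps_mul_eps, zero_smul]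

end Ext

/-! ### The substitution `q_{γ,0} ↦ q_{γ,0} + x` -/

section Shift

variable {K : Type*} [Field K] {ι : Type*} [Fintype ι]

section Basic
variable {S : Type*} [CommRing S]

/-- `∑_γ ∂/∂q_{γ,0}` as a derivation. -/
noncomputable def shiftDer : Derivation S (MvPowerSeries (ι × ℕ) S) (MvPowerSeries (ι × ℕ) S) :=
  ∑ γ, MvPowerSeries.pderiv S (γ, 0)

theorem shiftDeriv_eq (f : MvPowerSeries (ι × ℕ) S) : shiftDeriv f = shiftDer f := by
  change _ = Derivation.coeFnAddMonoidHom (∑ γ, MvPowerSeries.pderiv S (γ, 0)) f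
  rw [map_sum, Finset.sum_apply, shiftDeriv]
  exact sum_congr rfl fun γ _ => (pderiv_eq_pderivFun _ _).symm

theorem shiftDeriv_iter_eq (k : ℕ) (f : MvPowerSeries (ι × ℕ) S) :
    shiftDeriv^[k] f = (shiftDer.toLinearMap ^ k : Module.End S (MvPowerSeries (ι × ℕ) S)) f := by
  rw [Module.End.pow_apply]
  have h : (shiftDeriv : MvPowerSeries (ι × ℕ) S → _) = fun f => shiftDer f := funext shiftDeriv_eq
  rw [h]
  rfl

theorem shiftDeriv_iter_mul (k : ℕ) (f g : MvPowerSeries (ι × ℕ) S) :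
    shiftDeriv^[k] (f * g) = ∑ p ∈ antidiagonal k,
      k.choose p.1 • (shiftDeriv^[p.1] f * shiftDeriv^[p.2] g) := by
  have e := @PDO.iter_mul (MvPowerSeries (ι × ℕ) S) _
    (differentialOf (shiftDer (ι := ι) (S := S)).toLinearMap.toAddMonoidHom
      fun a b => (shiftDer (ι := ι) (S := S)).leibniz a b) k f g
  have h : (shiftDeriv : MvPowerSeries (ι × ℕ) S → _) = fun f => shiftDer f := funext shiftDeriv_eq
  rw [h]
  exact e

theorem shiftDeriv_iter_pderivFun (k : ℕ) (v : ι × ℕ) (f : MvPowerSeries (ι × ℕ) S) :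
    shiftDeriv^[k] (MvPowerSeries.pderivFun v f) =
      MvPowerSeries.pderivFun v (shiftDeriv^[k] f) := by
  induction k generalizing f with
  | zero => rfl
  | succ k ih =>
    rw [Function.iterate_succ_apply, Function.iterate_succ_apply, ← ih]
    congr 1
    rw [shiftDeriv, shiftDeriv, ← pderiv_eq_pderivFun v (∑ γ, _), map_sum]
    exact sum_congr rfl fun γ _ => by
      rw [pderivFun_comm, ← pderiv_eq_pderivFun v (MvPowerSeries.pderivFun _ f)]

theorem fsumCompat_shiftDeriv_iter (k : ℕ) :
    FsumCompat (fun f : MvPowerSeries (ι × ℕ) S => shiftDeriv^[k] f) := by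
  induction k with
  | zero => exact fsumCompat_id
  | succ k ih =>
    simp only [Function.iterate_succ_apply]
    exact ih.comp (FsumCompat.sum univ fun γ _ => fsumCompat_pderivFun (γ, 0))

end Basic

variable {S : Type*} [CommRing S] [Algebra K S]

theorem coeff_shift (f : MvPowerSeries (ι × ℕ) S) (m : ι × ℕ →₀ ℕ) (k : ℕ) :
    PowerSeries.coeff k (MvPowerSeries.coeff m (shift K f)) =
      ((k.factorial : K)⁻¹) • MvPowerSeries.coeff m (shiftDeriv^[k] f) := by
  change PowerSeries.coeff k (PowerSeries.mk fun k => ((k.factorial : K)⁻¹) •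
    MvPowerSeries.coeff m (shiftDeriv^[k] f)) = _
  rw [PowerSeries.coeff_mk]

omit [Fintype ι] in
theorem shift_ext {f g : Fun ι S} (h : ∀ m k, PowerSeries.coeff k (MvPowerSeries.coeff m f) =
    PowerSeries.coeff k (MvPowerSeries.coeff m g)) : f = g :=
  MvPowerSeries.ext fun m => PowerSeries.ext fun k => h m k

theorem shift_add (f g : MvPowerSeries (ι × ℕ) S) : shift K (f + g) = shift K f + shift K g :=
  shift_ext fun m k => by
    rw [map_add, map_add, coeff_shift, coeff_shift, coeff_shift, shiftDeriv_iter_eq,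
      shiftDeriv_iter_eq, shiftDeriv_iter_eq, map_add, map_add, smul_add]

omit [Fintype ι] in
theorem coeff_coeff_smul {k : Type*} [CommRing k] [Algebra k S] (c : k) (f : Fun ι S)
    (m : ι × ℕ →₀ ℕ) (n : ℕ) : PowerSeries.coeff n (MvPowerSeries.coeff m (c • f)) =
      c • PowerSeries.coeff n (MvPowerSeries.coeff m f) := by
  rw [coeff_smul', LinearMap.map_smul_of_tower]

theorem shift_smul {k : Type*} [CommRing k] [Algebra k S] [SMulCommClass K k S] (c : k)
    (f : MvPowerSeries (ι × ℕ) S) :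
    shift K (c • f) = c • shift K f :=
  shift_ext fun m n => by
    rw [coeff_coeff_smul, coeff_shift, coeff_shift, shiftDeriv_iter_eq, shiftDeriv_iter_eq,
      LinearMap.map_smul_of_tower, coeff_smul', smul_comm]

theorem shift_zero : shift K (0 : MvPowerSeries (ι × ℕ) S) = 0 :=
  shift_ext fun m k => by
    rw [coeff_shift, shiftDeriv_iter_eq, map_zero, map_zero, smul_zero, map_zero, map_zero]

theorem shift_sum {α : Type*} (t : Finset α) (f : α → MvPowerSeries (ι × ℕ) S) :
    shift K (∑ i ∈ t, f i) = ∑ i ∈ t, shift K (f i) := by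
  classical
  induction t using Finset.induction_on with
  | empty => simpa using shift_zero
  | insert a t ha ih => rw [sum_insert ha, sum_insert ha, shift_add, ih]

theorem shift_mul [CharZero K] (f g : MvPowerSeries (ι × ℕ) S) :
    shift K (f * g) = shift K f * shift K g := by
  classical
  refine shift_ext fun m k => ?_
  rw [coeff_shift, shiftDeriv_iter_mul, MvPowerSeries.coeff_mul, map_sum, map_sum]
  simp only [PowerSeries.coeff_mul, coeff_shift, map_nsmul, MvPowerSeries.coeff_mul, smul_sum]
  rw [sum_comm]
  refine sum_congr rfl fun q _ => sum_congr rfl fun p hp => ?_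
  have hp' := HasAntidiagonal.mem_antidiagonal.mp hp
  rw [smul_mul_smul_comm, ← Nat.cast_smul_eq_nsmul K, smul_smul]
  congr 1
  have h1 : (p.1.factorial : K) ≠ 0 := by exact_mod_cast Nat.factorial_ne_zero _
  have h2 : (p.2.factorial : K) ≠ 0 := by exact_mod_cast Nat.factorial_ne_zero _
  have h3 : (k.factorial : K) ≠ 0 := by exact_mod_cast Nat.factorial_ne_zero _
  have h4 := Nat.choose_mul_factorial_mul_factorial (n := k) (k := p.1) (by omega)
  rw [show k - p.1 = p.2 by omega] at h4
  field_simp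
  rw [← h4]
  push_cast
  ring

theorem shift_one : shift K (1 : MvPowerSeries (ι × ℕ) S) = 1 := by
  classical
  refine shift_ext fun m k => ?_
  rw [coeff_shift, MvPowerSeries.coeff_one]
  cases k with
  | zero =>
    rw [Function.iterate_zero_apply, MvPowerSeries.coeff_one]
    split_ifs <;> simp
  | succ k =>
    rw [Function.iterate_succ_apply, shiftDeriv_eq, Derivation.map_one_eq_zero, shiftDeriv_iter_eq,
      map_zero, map_zero, smul_zero]
    split_ifs
    · rw [PowerSeries.coeff_one, if_neg (by omega)]
    · rw [map_zero]

/-- The substitution `q_{γ,0} ↦ q_{γ,0} + x` as a ring homomorphism. -/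
noncomputable def shiftHom (K : Type*) [Field K] [CharZero K] {ι : Type*} [Fintype ι]
    {S : Type*} [CommRing S] [Algebra K S] : MvPowerSeries (ι × ℕ) S →+* Fun ι S where
  toFun := shift K
  map_zero' := shift_zero
  map_one' := shift_one
  map_add' := shift_add
  map_mul' := shift_mul

theorem pderivFun_shift (v : ι × ℕ) (f : MvPowerSeries (ι × ℕ) S) :
    MvPowerSeries.pderivFun v (shift K f) = shift K (MvPowerSeries.pderivFun v f) :=
  shift_ext fun m k => by
    rw [MvPowerSeries.coeff_pderivFun, coeff_shift, shiftDeriv_iter_pderivFun,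
      MvPowerSeries.coeff_pderivFun, ← Nat.cast_add_one, ← Nat.cast_add_one, ← nsmul_eq_mul',
      ← nsmul_eq_mul', map_nsmul, coeff_shift, smul_comm]

theorem dx_shift_eq [CharZero K] (f : MvPowerSeries (ι × ℕ) S) :
    dx (shift K f) = shift K (shiftDeriv f) :=
  shift_ext fun m k => by
    rw [coeff_shift, coeff_dx]
    change PowerSeries.coeff k (PowerSeries.derivative S _) = _
    rw [PowerSeries.coeff_derivative, coeff_shift, Function.iterate_succ_apply, ← Nat.cast_add_one,
      ← nsmul_eq_mul', ← Nat.cast_smul_eq_nsmul K, smul_smul, Nat.factorial_succ]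
    congr 1
    have h1 : (k.factorial : K) ≠ 0 := by exact_mod_cast Nat.factorial_ne_zero _
    have h2 : ((k : K) + 1) ≠ 0 := by exact_mod_cast Nat.succ_ne_zero k
    push_cast
    field_simp

/-- On shifted functions, `∂/∂x` is the sum of the `∂/∂q_{γ,0}`. -/
theorem dx_shift [CharZero K] (f : MvPowerSeries (ι × ℕ) S) :
    dx (shift K f) = ∑ γ, MvPowerSeries.pderivFun (γ, 0) (shift K f) := by
  rw [dx_shift_eq, shiftDeriv, shift_sum]
  simp only [pderivFun_shift]

theorem shift_fsum {g : ℕ → MvPowerSeries (ι × ℕ) S} (hg : LocFin g)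
    (hs : LocFin fun n => shift K (g n)) : shift K (fsum g) = fsum fun n => shift K (g n) :=
  shift_ext fun m k => by
    have h1 := (fsumCompat_shiftDeriv_iter (ι := ι) (S := S) k).locFin hg
    have h2 := (PowerSeries.coeff (R := S) k).toAddMonoidHom.map_finsum (hs m)
    simp only [LinearMap.toAddMonoidHom_coe] at h2
    rw [coeff_shift, (fsumCompat_shiftDeriv_iter k).eq hg, coeff_fsum, coeff_fsum, h2]
    simp only [coeff_shift]
    exact (DistribSMul.toAddMonoidHom S ((k.factorial : K)⁻¹)).map_finsum (h1 m)

theorem isUnit_shift [CharZero K] {f : MvPowerSeries (ι × ℕ) S} (hf : IsUnit f) :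
    IsUnit (shift K f) := hf.map (shiftHom K)

theorem shift_X [CharZero K] (β : ι) (j : ℕ) :
    shift K (MvPowerSeries.X (β, j) : MvPowerSeries (ι × ℕ) K) = time K β j := by
  classical
  have hD : shiftDeriv (MvPowerSeries.X (β, j) : MvPowerSeries (ι × ℕ) K) =
      if j = 0 then 1 else 0 := by
    rw [shiftDeriv]
    simp only [← pderiv_eq_pderivFun]
    split_ifs with h
    · subst h
      rw [sum_eq_single_of_mem β (mem_univ _), MvPowerSeries.pderiv_X_self]
      intro γ _ hne
      exact MvPowerSeries.pderiv_X_of_ne fun h => hne (Prod.mk.inj h).1.symm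
    · refine sum_eq_zero fun γ _ => MvPowerSeries.pderiv_X_of_ne fun h' => h (Prod.mk.inj h').2
  have hD2 : ∀ k, shiftDeriv^[k + 2] (MvPowerSeries.X (β, j) : MvPowerSeries (ι × ℕ) K) = 0 := by
    intro k
    rw [Function.iterate_add_apply, Function.iterate_succ_apply, Function.iterate_one, hD,
      shiftDeriv_eq, shiftDeriv_iter_eq]
    split_ifs
    · rw [Derivation.map_one_eq_zero, map_zero]
    · rw [map_zero, map_zero]
  refine shift_ext fun m k => ?_
  rw [coeff_shift, time, map_add, map_add]
  match k with
  | 0 =>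
    rw [Function.iterate_zero_apply, Nat.factorial_zero, Nat.cast_one, inv_one, one_smul,
      MvPowerSeries.coeff_X, MvPowerSeries.coeff_X]
    by_cases hj : j = 0
    · rw [if_pos hj, MvPowerSeries.coeff_C]
      split_ifs <;> simp
    · rw [if_neg hj]
      split_ifs <;> simp
  | 1 =>
    rw [Function.iterate_one, hD, Nat.factorial_one, Nat.cast_one, inv_one, one_smul,
      MvPowerSeries.coeff_X]
    by_cases hj : j = 0
    · rw [if_pos hj, if_pos hj, MvPowerSeries.coeff_C, MvPowerSeries.coeff_one]
      split_ifs <;> simp [PowerSeries.coeff_one]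
    · rw [if_neg hj, if_neg hj]
      split_ifs <;> simp [PowerSeries.coeff_one]
  | k + 2 =>
    rw [hD2, map_zero, smul_zero, MvPowerSeries.coeff_X]
    by_cases hj : j = 0
    · rw [if_pos hj, MvPowerSeries.coeff_C]
      split_ifs <;> simp [PowerSeries.coeff_X, PowerSeries.coeff_one]
    · rw [if_neg hj]
      split_ifs <;> simp [PowerSeries.coeff_one]

omit [Fintype ι] in
theorem locFin_time_mul [CharZero K] (β : ι) (g : ℕ → Fun ι K) :
    LocFin fun n => time K β n * g n := by
  have h1 : LocFin fun n => (MvPowerSeries.X (β, n) : Fun ι K) * g n :=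
    locFin_X_mul (fun _ _ h => (Prod.mk.inj h).2) g
  have h2 : LocFin fun n => (if n = 0 then MvPowerSeries.C PowerSeries.X else 0 : Fun ι K) * g n := by
    intro m
    refine (Set.finite_singleton 0).subset fun n hn => ?_
    by_contra h
    rw [Set.mem_singleton_iff] at h
    exact hn (by dsimp only; rw [if_neg h, zero_mul, map_zero])
  have h3 := h1.add h2
  simp only [← add_mul] at h3
  exact h3

end Shift

/-! ### The Sato-Wilson equations of several copies of KdV -/

section Copy

variable {K : Type*} [Field K] {ι : Type*}

/-- The embedding of the times of one copy of KdV. -/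
def copyEmb (γ : ι) : ℕ ↪ ι × ℕ := ⟨Prod.mk γ, fun _ _ h => (Prod.mk.inj h).2⟩

/-- The identity `∂_{γ,p} f(q_γ) = (∂_p f)(q_γ)`, coefficient by coefficient. -/
theorem coeff_rename_copyEmb_add (γ : ι) (f : MvPowerSeries ℕ K) (m : ι × ℕ →₀ ℕ) (p : ℕ) :
    MvPowerSeries.coeff (m + Finsupp.single (γ, p) 1) (MvPowerSeries.rename (copyEmb γ) f) *
      (m (γ, p) + 1) =
    MvPowerSeries.coeff m (MvPowerSeries.rename (copyEmb γ) (MvPowerSeries.pderivFun p f)) := by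
  classical
  by_cases h : m ∈ Set.range (Finsupp.embDomain (copyEmb γ) : (ℕ →₀ ℕ) → _)
  · obtain ⟨x, rfl⟩ := h
    have e : Finsupp.embDomain (copyEmb γ) x + Finsupp.single (γ, p) 1 =
        Finsupp.embDomain (copyEmb γ) (x + Finsupp.single p 1) := by
      rw [Finsupp.embDomain_add, Finsupp.embDomain_single]
      rfl
    have e2 : (Finsupp.embDomain (copyEmb γ) x) (γ, p) = x p :=
      Finsupp.embDomain_apply_self (copyEmb γ) x p
    rw [e, MvPowerSeries.coeff_embDomain_rename, MvPowerSeries.coeff_embDomain_rename,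
      MvPowerSeries.coeff_pderivFun, e2]
  · have h1 : m ∉ Set.range (Finsupp.mapDomain (copyEmb γ) : (ℕ →₀ ℕ) → _) := by
      rintro ⟨x, hx⟩
      exact h ⟨x, by rw [Finsupp.embDomain_eq_mapDomain, hx]⟩
    rw [MvPowerSeries.coeff_rename_eq_zero _ _ h1, MvPowerSeries.coeff_rename_eq_zero, zero_mul]
    rintro ⟨x, hx⟩
    rw [← Finsupp.embDomain_eq_mapDomain] at hx
    have hp : 1 ≤ x p := by
      have := DFunLike.congr_fun hx (γ, p)
      rw [show ((γ, p) : ι × ℕ) = copyEmb γ p from rfl, Finsupp.embDomain_apply_self,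
        Finsupp.add_apply, Finsupp.single_eq_same] at this
      omega
    refine h ⟨x - Finsupp.single p 1, add_right_cancel (b := Finsupp.single (γ, p) 1) ?_⟩
    rw [← hx]
    conv_rhs => rw [← tsub_add_cancel_of_le (Finsupp.single_le_iff.mpr hp), Finsupp.embDomain_add,
      Finsupp.embDomain_single]
    rfl

theorem pderivFun_rename [DecidableEq ι] (γ : ι) (v : ι × ℕ) (f : MvPowerSeries ℕ K) :
    MvPowerSeries.pderivFun v (MvPowerSeries.rename (copyEmb γ) f) =
      if v.1 = γ then MvPowerSeries.rename (copyEmb γ) (MvPowerSeries.pderivFun v.2 f) else 0 := by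
  refine MvPowerSeries.ext fun m => ?_
  rw [MvPowerSeries.coeff_pderivFun]
  obtain ⟨β, p⟩ := v
  split_ifs with h
  · dsimp only at h
    subst h
    exact coeff_rename_copyEmb_add _ f m p
  · rw [MvPowerSeries.coeff_rename_eq_zero, zero_mul, map_zero]
    rintro ⟨x, hx⟩
    rw [← Finsupp.embDomain_eq_mapDomain] at hx
    have h1 := DFunLike.congr_fun hx (β, p)
    rw [Finsupp.embDomain_of_notMem_range, Finsupp.add_apply, Finsupp.single_eq_same] at h1
    · omega
    · rintro ⟨n, hn⟩
      exact h (Prod.mk.inj hn).1.symm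

variable [Fintype ι] [CharZero K]

/-- The inclusion of the functions of the times of one copy of KdV, shifted by `x`. -/
noncomputable def copyHom (γ : ι) : MvPowerSeries ℕ K →+* Fun ι K :=
  (shiftHom K).comp (MvPowerSeries.rename (copyEmb γ)).toRingHom

theorem copyHom_apply (γ : ι) (f : MvPowerSeries ℕ K) :
    copyHom γ f = shift K (MvPowerSeries.rename (copyEmb γ) f) := rfl

theorem copyHom_smul (γ : ι) (c : K) (f : MvPowerSeries ℕ K) :
    copyHom γ (c • f) = c • copyHom γ f := by
  rw [copyHom_apply, map_smul, shift_smul, copyHom_apply]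

theorem pderivFun_copyHom [DecidableEq ι] (γ : ι) (v : ι × ℕ) (f : MvPowerSeries ℕ K) :
    MvPowerSeries.pderivFun v (copyHom γ f) =
      if v.1 = γ then copyHom γ (MvPowerSeries.pderivFun v.2 f) else 0 := by
  rw [copyHom_apply, pderivFun_shift, pderivFun_rename]
  split_ifs
  · rfl
  · exact shift_zero

theorem copyHom_deriv (γ : ι) (f : MvPowerSeries ℕ K) : copyHom γ f′ = (copyHom γ f)′ := by
  classical
  rw [deriv_fun, copyHom_apply γ f, dx_shift, deriv_single]
  simp only [← copyHom_apply, pderivFun_copyHom]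
  rw [sum_ite_eq' univ γ, if_pos (mem_univ _)]

theorem shift_prodTau (τ : ι → MvPowerSeries ℕ K) :
    shift K (prodTau τ) = ∏ γ, copyHom γ (τ γ) := by
  change shiftHom K (prodTau τ) = _
  rw [prodTau, map_prod]
  rfl

theorem pderivFun_prod_eq_zero {σ R α : Type*} [CommRing R] (v : σ) (t : Finset α)
    (f : α → MvPowerSeries σ R) (h : ∀ i ∈ t, MvPowerSeries.pderivFun v (f i) = 0) :
    MvPowerSeries.pderivFun v (∏ i ∈ t, f i) = 0 := by
  classical
  induction t using Finset.induction_on with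
  | empty => rw [prod_empty, MvPowerSeries.pderivFun_one]
  | insert a t ha ih =>
    rw [prod_insert ha, pderivFun_mul, h a (mem_insert_self a t),
      ih fun i hi => h i (mem_insert_of_mem hi), zero_mul, mul_zero, add_zero]

/-- The vertex operator `Γ₋` of one copy acts on the tau function of several copies through the
corresponding factor. -/
theorem gammaMinus_prodTau [DecidableEq ι] (s : K) (τ : ι → MvPowerSeries ℕ K) (α : ι) (k : ℕ) :
    PowerSeries.coeff k (gammaMinus s (fun n => (α, n)) (PowerSeries K)) (shift K (prodTau τ)) =
      copyHom α (PowerSeries.coeff k (gammaMinus s id K) (τ α)) *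
        ∏ γ ∈ univ.erase α, copyHom γ (τ γ) := by
  set R := ∏ γ ∈ univ.erase α, copyHom γ (τ γ) with hR
  have hR0 : ∀ n, MvPowerSeries.pderivFun (α, n) R = 0 := fun n =>
    pderivFun_prod_eq_zero _ _ _ fun γ hγ => by
      rw [pderivFun_copyHom, if_neg (ne_of_mem_erase hγ).symm]
  let Ψ : MvPowerSeries ℕ K →ₗ[K] Fun ι K :=
    { toFun := fun f => copyHom α f * R
      map_add' := fun f g => by rw [map_add, add_mul]
      map_smul' := fun c f => by rw [copyHom_smul, smul_mul_assoc, RingHom.id_apply] }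
  have e : shift K (prodTau τ) = Ψ (τ α) := by
    rw [shift_prodTau, ← mul_prod_erase univ _ (mem_univ α)]
    rfl
  rw [e, ← gammaMinus_intertwine s id (fun n => (α, n)) Ψ]
  · rfl
  · intro n f
    change copyHom α _ * R = MvPowerSeries.pderivFun (α, n) (copyHom α f * R)
    rw [pderivFun_mul, hR0, mul_zero, add_zero, pderivFun_copyHom, if_pos rfl]
    rfl

end Copy

section Dressing

variable {K : Type*} [Field K] {ι S : Type*} [CommRing S] [Algebra K S]

theorem coeffD_opSum_sd (s : K) (f : ℕ → Fun ι S) (k : ℤ) :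
    coeffD k (opSum fun n => ofFun (f n) * sd s (-(n : ℤ))) =
      if k ≤ 0 then s ^ k • f (-k).toNat else 0 := by
  have hc : ∀ (n : ℕ) (k : ℤ), coeffD k (ofFun (f n) * sd s (-(n : ℤ))) =
      if k = -(n : ℤ) then s ^ k • f n else 0 := by
    intro n k
    rw [coeffD_mul_sd, coeffD_ofFun]
    by_cases h : k = -(n : ℤ)
    · rw [if_pos (by omega), if_pos h, h]
    · rw [if_neg (by omega), if_neg h, smul_zero]
  rw [coeffD_opSum (ordBdd_of_forall 0 fun n k hk => by rw [hc, if_neg (by omega)])]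
  simp only [hc]
  refine MvPowerSeries.ext fun m => ?_
  rw [coeff_fsum]
  split_ifs with h
  · rw [finsum_eq_single _ (-k).toNat]
    · rw [if_pos (by omega)]
    · intro n hn
      rw [if_neg (by omega), map_zero]
  · refine finsum_eq_zero_of_forall_eq_zero fun n => ?_
    rw [if_neg (by omega), map_zero]

theorem coeffD_dressing (s : K) (T : Fun ι S) (α : ι) (k : ℤ) :
    coeffD k (dressing s T α) = if k ≤ 0 then s ^ k •
      (PowerSeries.coeff (-k).toNat (gammaMinus s (fun n => (α, n)) (PowerSeries S)) T *
        Ring.inverse T) else 0 :=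
  coeffD_opSum_sd s _ k

/-- The operator whose symbol is `Γ_{α,-} g`. -/
noncomputable def preDressing (s : K) (α : ι) (g : Fun ι S) : Op ι S :=
  opSum fun n => ofFun (PowerSeries.coeff n (gammaMinus s (fun n => (α, n)) (PowerSeries S)) g) *
    sd s (-(n : ℤ))

theorem coeffD_preDressing (s : K) (α : ι) (g : Fun ι S) (k : ℤ) :
    coeffD k (preDressing s α g) = if k ≤ 0 then s ^ k •
      PowerSeries.coeff (-k).toNat (gammaMinus s (fun n => (α, n)) (PowerSeries S)) g else 0 :=
  coeffD_opSum_sd s _ k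

theorem ofFun_mul_dressing (s : K) {T : Fun ι S} (hT : IsUnit T) (α : ι) :
    ofFun T * dressing s T α = preDressing s α T :=
  op_ext fun k => by
    rw [coeffD_ofFun_mul, coeffD_dressing, coeffD_preDressing]
    split_ifs
    · rw [mul_smul_comm, mul_left_comm, Ring.mul_inverse_cancel _ hT, mul_one]
    · rw [mul_zero]

/-- The dressing operator is `1 + (lower order)`, and so is its inverse. -/
theorem exists_dressing_inverse (s : K) {T : Fun ι S} (hT : IsUnit T) (α : ι) :
    ∃ p q : PDO (Fun ι S), dressing s T α = toOp p ∧ Ring.inverse (dressing s T α) = toOp q ∧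
      p * q = 1 ∧ q * p = 1 ∧ p.coeff 0 = 1 ∧ (∀ k, 0 < k → p.coeff k = 0) ∧ q.coeff 0 = 1 ∧
      ∀ k, 0 < k → q.coeff k = 0 := by
  let p : PDO (Fun ι S) := ⟨fun k => coeffD k (dressing s T α), 0, fun k hk => by
    dsimp only
    rw [coeffD_dressing, if_neg (by omega)]⟩
  have hp : ∀ k, p.coeff k = coeffD k (dressing s T α) := fun k => rfl
  have h1 : p.coeff 0 = 1 := by
    rw [hp, coeffD_dressing, if_pos le_rfl, zpow_zero, one_smul, neg_zero, Int.toNat_zero,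
      coeff_zero_gammaMinus, Module.End.one_apply, Ring.mul_inverse_cancel _ hT]
  have h2 : ∀ k, 0 < k → p.coeff k = 0 := fun k hk => by
    rw [hp, coeffD_dressing, if_neg (by omega)]
  obtain ⟨q, hpq, hqp, hq1, hq2⟩ := PDO.exists_inverse h1 h2
  have e1 : toOp p * toOp q = 1 := by rw [← map_mul, hpq, map_one]
  have e2 : toOp q * toOp p = 1 := by rw [← map_mul, hqp, map_one]
  have e0 : dressing s T α = toOp p := op_ext fun k => rfl
  refine ⟨p, q, e0, ?_, hpq, hqp, h1, h2, hq1, hq2⟩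
  rw [e0]
  exact Ring.inverse_unit ⟨toOp p, toOp q, e1, e2⟩

theorem isUnit_dressing (s : K) {T : Fun ι S} (hT : IsUnit T) (α : ι) :
    IsUnit (dressing s T α) := by
  obtain ⟨p, q, hp, _, hpq, hqp, _⟩ := exists_dressing_inverse s hT α
  rw [hp]
  exact ⟨⟨toOp p, toOp q, by rw [← map_mul, hpq, map_one], by rw [← map_mul, hqp, map_one]⟩, rfl⟩

theorem dressing_mul_inverse (s : K) {T : Fun ι S} (hT : IsUnit T) (α : ι) :
    dressing s T α * Ring.inverse (dressing s T α) = 1 :=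
  Ring.mul_inverse_cancel _ (isUnit_dressing s hT α)

theorem inverse_mul_dressing (s : K) {T : Fun ι S} (hT : IsUnit T) (α : ι) :
    Ring.inverse (dressing s T α) * dressing s T α = 1 :=
  Ring.inverse_mul_cancel _ (isUnit_dressing s hT α)

/-- The operator `∇_v A = ∂A/∂q_v + δ s⁻¹ a_i A (s∂)^{2i+1}` with `v = (β, i)`, `δ = δ_{αβ}`,
obtained from `∂/∂q_v` by conjugation with `Γ_{α,+}`. -/
noncomputable def nablaOp [DecidableEq ι] (s : K) (α : ι) (v : ι × ℕ) (A : Op ι S) : Op ι S :=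
  MvPowerSeries.pderivFun v A + (if v.1 = α then s⁻¹ * ca K v.2 else 0) • (A * sd s (2 * v.2 + 1))

end Dressing

section SatoWilson

variable {K : Type*} [Field K] [CharZero K] {ι : Type*} [Fintype ι] [DecidableEq ι]

omit [DecidableEq ι] in
theorem isUnit_shift_prodTau {s : K} {τ : ι → MvPowerSeries ℕ K} (hτ : ∀ γ, IsKdVTau s (τ γ)) :
    IsUnit (shift K (prodTau τ)) := by
  rw [shift_prodTau]
  refine IsUnit.prod_univ_iff.mpr fun γ => IsUnit.map (copyHom γ) ?_
  rw [MvPowerSeries.isUnit_iff_constantCoeff]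
  exact isUnit_iff_ne_zero.mpr (hτ γ).1

/-- The Sato-Wilson equations for several copies of KdV: `∇_v P_α = B P_α` with a differential
operator `B`; moreover the Lax operator is a differential operator. -/
theorem exists_satoWilson {s : K} (hs : s ≠ 0) {τ : ι → MvPowerSeries ℕ K}
    (hτ : ∀ γ, IsKdVTau s (τ γ)) (α : ι) :
    (∃ B : ι × ℕ → Op ι K, (∀ v, IsDiffOp (B v)) ∧
      ∀ v, nablaOp s α v (dressing s (shift K (prodTau τ)) α) =
        B v * dressing s (shift K (prodTau τ)) α) ∧
      IsDiffOp (laxHalfPow s (shift K (prodTau τ)) α 2) := by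
  set T := shift K (prodTau τ) with hT
  set Φ := waveOp s (τ α) with hΦ
  have huτ : IsUnit (τ α) := by
    rw [MvPowerSeries.isUnit_iff_constantCoeff]
    exact isUnit_iff_ne_zero.mpr (hτ α).1
  obtain ⟨t, ht⟩ : ∃ t, τ α * t = 1 := huτ.exists_right_inv
  set p := PDO.mono 0 t * Φ with hp
  have hΦ0 : ∀ k, 0 < k → Φ.coeff k = 0 := fun k hk => by rw [coeff_waveOp, if_neg (by omega)]
  have hp1 : p.coeff 0 = 1 := by
    rw [hp, PDO.coeff_mono_zero_mul, hΦ, coeff_waveOp, if_pos le_rfl, zpow_zero, one_smul, neg_zero,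
      Int.toNat_zero, coeff_zero_gammaMinus, Module.End.one_apply, mul_comm, ht]
  have hp0 : ∀ k, 0 < k → p.coeff k = 0 := fun k hk => by
    rw [hp, PDO.coeff_mono_zero_mul, hΦ0 k hk, mul_zero]
  obtain ⟨q, hpq, hqp, -, -⟩ := PDO.exists_inverse hp1 hp0
  have hΨ : q * PDO.mono 0 t * Φ = 1 := by rw [mul_assoc, ← hp, hqp]
  obtain ⟨h1, h2⟩ := (hτ α).isDiff hs hΨ
  have hm : PDO.mono 0 t * PDO.mono 0 (τ α) = 1 := by
    rw [PDO.mono_zero_mul_mono, mul_comm, ht]; rfl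
  have hm' : PDO.mono 0 (τ α) * PDO.mono 0 t = 1 := by
    rw [PDO.mono_zero_mul_mono, ht]; rfl
  have hdiff0 : ∀ f : MvPowerSeries ℕ K, (PDO.mono 0 f).IsDiff := fun f k hk => by
    rw [PDO.coeff_mono, if_neg (by omega)]
  have hqΨ : q * PDO.mono 0 t * PDO.mono 0 (τ α) = q := by rw [mul_assoc, hm, mul_one]
  -- the operators `B` of one copy, from those for `Φ = τ P`
  have hB : ∀ i, (nabla s i p * q).IsDiff := by
    intro i
    have e : nabla s i p = PDO.mono 0 (MvPowerSeries.pderivFun i t * τ α) * p +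
        PDO.mono 0 t * nabla s i Φ := by
      have hpk : ∀ k, p.coeff k = t * Φ.coeff k := fun k => PDO.coeff_mono_zero_mul _ _ _
      refine PDO.ext fun k => ?_
      simp only [PDO.coeff_add, PDO.coeff_mono_zero_mul, coeff_nabla, hpk]
      rw [pderivFun_mul, mul_add,
        mul_assoc, ← mul_assoc (τ α), ht, one_mul, mul_smul_comm, add_assoc]
    have e2 : nabla s i p * q = PDO.mono 0 (MvPowerSeries.pderivFun i t * τ α) +
        PDO.mono 0 t * (nabla s i Φ * (q * PDO.mono 0 t)) * PDO.mono 0 (τ α) := by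
      rw [e, add_mul, mul_assoc _ p, hpq, mul_one, mul_assoc _ _ (PDO.mono 0 (τ α)),
        mul_assoc (nabla s i Φ), hqΨ, mul_assoc]
    intro k hk
    rw [e2, PDO.coeff_add, hdiff0 _ k hk, (((hdiff0 t).mul (h1 i)).mul (hdiff0 _)) k hk, add_zero]
  have hL : (p * PDO.mono 2 1 * q).IsDiff := by
    have e2 : p * PDO.mono 2 1 * q =
        PDO.mono 0 t * (Φ * PDO.mono 2 1 * (q * PDO.mono 0 t)) * PDO.mono 0 (τ α) := by
      rw [mul_assoc _ _ (PDO.mono 0 (τ α)), mul_assoc (Φ * _), hqΨ, hp]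
      simp only [mul_assoc]
    rw [e2]
    exact ((hdiff0 t).mul h2).mul (hdiff0 _)
  -- transport to several copies
  set Θ : PDO (MvPowerSeries ℕ K) →+* Op ι K :=
    toOp.comp (PDO.mapHom (copyHom α) (copyHom_deriv α)) with hΘ
  have hΘc : ∀ (A : PDO (MvPowerSeries ℕ K)) k, coeffD k (Θ A) = copyHom α (A.coeff k) :=
    fun A k => rfl
  have hΘd : ∀ A : PDO (MvPowerSeries ℕ K), A.IsDiff → IsDiffOp (Θ A) := fun A hA k hk => by
    rw [hΘc, hA k hk, map_zero]
  have hTu := isUnit_shift_prodTau hτ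
  have hP : dressing s T α = Θ p := by
    refine op_ext fun k => ?_
    rw [coeffD_dressing, hΘc, hp, PDO.coeff_mono_zero_mul, hΦ, coeff_waveOp]
    split_ifs
    · rw [gammaMinus_prodTau, map_mul, copyHom_smul, mul_smul_comm]
      congr 1
      refine hTu.mul_right_cancel ?_
      rw [mul_assoc, Ring.inverse_mul_cancel _ hTu, mul_one, shift_prodTau,
        ← mul_prod_erase univ _ (mem_univ α)]
      have : copyHom α t * copyHom α (τ α) = 1 := by rw [← map_mul, mul_comm, ht, map_one]
      linear_combination (-(copyHom α) ((PowerSeries.coeff (-k).toNat) (gammaMinus s id K) (τ α)) *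
        ∏ γ ∈ univ.erase α, copyHom γ (τ γ)) * this
    · rw [mul_zero, map_zero]
  have hinv : Ring.inverse (dressing s T α) = Θ q := by
    rw [hP]
    exact Ring.inverse_unit ⟨Θ p, Θ q, by rw [← map_mul, hpq, map_one],
      by rw [← map_mul, hqp, map_one]⟩
  refine ⟨⟨fun v => if v.1 = α then Θ (nabla s v.2 p * q) else 0, ?_, ?_⟩, ?_⟩
  · intro v
    dsimp only
    split_ifs
    · exact hΘd _ (hB _)
    · exact fun k _ => coeffD_zero k
  · intro v
    rw [hP]
    dsimp only
    refine op_ext fun k => ?_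
    rw [nablaOp, coeffD_add, coeffD_smul, coeffD_mul_sd, coeffD_pderivFun, hΘc, hΘc,
      pderivFun_copyHom]
    split_ifs with h
    · rw [← map_mul, mul_assoc, hqp, mul_one, hΘc, coeff_nabla, map_add, copyHom_smul, smul_smul]
      congr 2
      rw [show (2 * (v.2 : ℤ) + 1) = ((2 * v.2 : ℕ) : ℤ) + 1 by push_cast; ring, zpow_add₀ hs,
        zpow_natCast, zpow_one]
      field_simp
    · rw [zero_smul, zero_mul, add_zero, coeffD_zero]
  · have e : laxHalfPow s T α 2 = (s ^ (2 : ℤ)) • Θ (p * PDO.mono 2 1 * q) := by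
      have e3 : Θ (PDO.mono 2 1) = MvPowerSeries.C (PDO.mono 2 1) := op_ext fun k => by
        have h3 := coeffD_sd (ι := ι) (S := K) (1 : K) 2 k
        rw [sd, one_zpow, one_smul, one_smul] at h3
        rw [h3, hΘc, PDO.coeff_mono]
        split_ifs <;> simp
      rw [laxHalfPow, hinv, hP, sd, mul_smul_comm, smul_mul_assoc, map_mul Θ (p * _) q,
        map_mul Θ p, e3]
    rw [e]
    exact (hΘd _ hL).smul _

end SatoWilson

/-! ### The vertex operator and the quantized matrix -/

section Quantization

variable {K : Type*} [Field K] {ι : Type*}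

/-- The sign in the symmetry of `r` is the one produced by the reflection `i ↦ ℓ - 1 - i`. -/
theorem neg_one_pow_add_eq {ℓ i : ℕ} (hi : i < ℓ) :
    (-1 : K) ^ (ℓ + 1) * (-1) ^ (ℓ - 1 - i + 1) = (-1) ^ (i + 1) := by
  rw [← pow_add, show ℓ + 1 + (ℓ - 1 - i + 1) = 2 * (ℓ - 1 - i + 1) + (i + 1) by omega,
    pow_add _ (2 * _), pow_mul]
  simp

theorem preDressing_add (s : K) (α : ι) (f g : Fun ι K) :
    preDressing s α (f + g) = preDressing s α f + preDressing s α g :=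
  op_ext fun k => by
    simp only [coeffD_add, coeffD_preDressing]
    split_ifs
    · rw [map_add, smul_add]
    · rw [add_zero]

theorem preDressing_smul (s : K) (α : ι) (c : K) (f : Fun ι K) :
    preDressing s α (c • f) = c • preDressing s α f :=
  op_ext fun k => by
    simp only [coeffD_smul, coeffD_preDressing]
    split_ifs
    · rw [LinearMap.map_smul_of_tower, smul_comm]
    · rw [smul_zero]

theorem preDressing_zero (s : K) (α : ι) : preDressing s α (0 : Fun ι K) = 0 := by
  rw [← zero_smul K (0 : Fun ι K), preDressing_smul, zero_smul]

theorem preDressing_sum {A : Type*} (s : K) (α : ι) (t : Finset A) (f : A → Fun ι K) :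
    preDressing s α (∑ i ∈ t, f i) = ∑ i ∈ t, preDressing s α (f i) := by
  classical
  induction t using Finset.induction_on with
  | empty => simpa using preDressing_zero s α
  | insert a t ha ih => rw [sum_insert ha, sum_insert ha, preDressing_add, ih]

theorem pderivFun_preDressing (s : K) (α : ι) (v : ι × ℕ) (f : Fun ι K) :
    MvPowerSeries.pderivFun v (preDressing s α f) =
      preDressing s α (MvPowerSeries.pderivFun v f) :=
  op_ext fun k => by
    simp only [coeffD_pderivFun, coeffD_preDressing]
    split_ifs
    · rw [pderivFun_smul]
      congr 1
      let Ψ : Fun ι K →ₗ[K] Fun ι K :=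
        { toFun := fun f => MvPowerSeries.pderivFun v f
          map_add' := fun f g => by simp only [← pderiv_eq_pderivFun, map_add]
          map_smul' := fun c f => pderivFun_smul v c f }
      exact gammaMinus_intertwine s _ _ Ψ (fun n f => pderivFun_comm _ _ _) _ f
    · rw [← pderiv_eq_pderivFun, map_zero]

theorem pderivFun_time [DecidableEq ι] (v : ι × ℕ) (μ : ι) (i : ℕ) :
    MvPowerSeries.pderivFun v (time K μ i) = MvPowerSeries.C (if v = (μ, i) then 1 else 0) := by
  classical
  have h0 : MvPowerSeries.pderivFun v
      (if i = 0 then MvPowerSeries.C PowerSeries.X else 0 : Fun ι K) = 0 := by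
    rw [← pderiv_eq_pderivFun]
    split_ifs
    · rw [pderiv_eq_pderivFun, MvPowerSeries.pderivFun_C]
    · exact map_zero _
  rw [time, ← pderiv_eq_pderivFun, map_add, pderiv_eq_pderivFun, pderiv_eq_pderivFun, h0, add_zero]
  by_cases h : v = (μ, i)
  · rw [if_pos h, h, ← pderiv_eq_pderivFun, MvPowerSeries.pderiv_X_self, map_one]
  · rw [if_neg h, ← pderiv_eq_pderivFun, MvPowerSeries.pderiv_X_of_ne (Ne.symm h), map_zero]

/-- The commutator of `Γ_{α,-}` with a time of the `α`-th copy is `-s b_i λ^{-2i-1} Γ_{α,-}`. -/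
theorem preDressing_time_mul [CharZero K] [DecidableEq ι] {s : K} (hs : s ≠ 0) (α μ : ι) (i : ℕ)
    (g : Fun ι K) :
    preDressing s α (time K μ i * g) = ofFun (time K μ i) * preDressing s α g +
      (if μ = α then -s else 0) • cb K i • (preDressing s α g * sd s (-(2 * i) - 1)) :=
  op_ext fun k => by
    rw [coeffD_add, coeffD_ofFun_mul, coeffD_smul, coeffD_smul, coeffD_mul_sd]
    simp only [coeffD_preDressing]
    by_cases hk : k ≤ 0
    · rw [if_pos hk, if_pos hk, gammaMinus_mul s _ (time K μ i)
        (fun n => if (α, n) = (μ, i) then 1 else 0) (fun n => pderivFun_time _ _ _), smul_add,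
        mul_smul_comm]
      congr 1
      by_cases hμ : μ = α
      · subst hμ
        rw [if_pos rfl]
        split_ifs with h
        · obtain ⟨n, hn⟩ : ∃ n : ℕ, (-k).toNat = 2 * i + 1 + n :=
            ⟨(-k).toNat - (2 * i + 1), by omega⟩
          have hn' : (-(k - (-(2 * (i : ℤ)) - 1))).toNat = n := by omega
          rw [hn, hn', sum_eq_single (2 * i + 1, n)]
          · rw [if_pos ⟨i, rfl⟩, show (2 * i + 1) / 2 = i by omega, if_pos rfl, one_smul,
              smul_smul, smul_smul, smul_smul, smul_smul]
            congr 1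
            have : s ^ k = s ^ (-(2 * (i : ℤ)) - 1) * s ^ (k - (-(2 * (i : ℤ)) - 1)) := by
              rw [← zpow_add₀ hs]; congr 1; ring
            rw [this]
            ring
          · rintro ⟨a, b⟩ hab hne
            rw [HasAntidiagonal.mem_antidiagonal] at hab
            dsimp only at hab ⊢
            split_ifs with h1 h2
            · obtain ⟨c, rfl⟩ := h1
              have := (Prod.mk.inj h2).2
              exact absurd (Prod.ext (by dsimp only; omega) (by dsimp only; omega)) hne
            · rw [zero_smul, smul_zero]
            · rfl
          · intro h
            exact (h (HasAntidiagonal.mem_antidiagonal.mpr rfl)).elim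
        · rw [smul_zero, smul_zero, smul_zero, sum_eq_zero, smul_zero]
          rintro ⟨a, b⟩ hab
          rw [HasAntidiagonal.mem_antidiagonal] at hab
          dsimp only at hab ⊢
          split_ifs with h1 h2
          · obtain ⟨c, rfl⟩ := h1
            have := (Prod.mk.inj h2).2
            omega
          · rw [zero_smul, smul_zero]
          · rfl
      · rw [if_neg hμ, zero_smul, sum_eq_zero, smul_zero]
        rintro ⟨a, b⟩ _
        have : ∀ n : ℕ, ¬ ((α, n) : ι × ℕ) = (μ, i) := fun n h => hμ (Prod.mk.inj h).1.symm
        simp [this]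
    · have hk' : ¬ k - (-(2 * (i : ℤ)) - 1) ≤ 0 := by omega
      rw [if_neg hk, if_neg hk, if_neg hk', mul_zero, smul_zero, smul_zero, smul_zero, add_zero]

theorem locFin_ofFun_time_mul (β : ι) (g : ℕ → Op ι K) :
    LocFin fun n => ofFun (time K β n) * g n := by
  have e : ∀ n, ofFun (time K β n) * g n = MvPowerSeries.X (β, n) * g n +
      ofFun (if n = 0 then MvPowerSeries.C PowerSeries.X else 0 : Fun ι K) * g n := by
    intro n
    rw [time, ofFun_add, add_mul]
    congr 2
    classical
    refine MvPowerSeries.ext fun m => PDO.ext fun k => ?_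
    rw [← coeff_coeffD, coeffD_ofFun, MvPowerSeries.coeff_X]
    split_ifs with h1 h2 h2
    · subst h2; rw [MvPowerSeries.coeff_X, if_pos rfl, PDO.coeff_one, if_pos h1]
    · rw [MvPowerSeries.coeff_X, if_neg h2, PDO.coeff_zero]
    · rw [PDO.coeff_one, if_neg h1, map_zero]
    · rw [PDO.coeff_zero, map_zero]
  simp only [e]
  refine (locFin_X_mul (fun _ _ h => (Prod.mk.inj h).2) g).add fun m => ?_
  refine (Set.finite_singleton 0).subset fun n hn => ?_
  by_contra h
  apply hn
  rw [Set.mem_singleton_iff] at h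
  have h0 : ofFun (0 : Fun ι K) = 0 := map_zero ofFunHom
  dsimp only
  rw [if_neg h, h0, zero_mul, map_zero]

theorem locFin_coeffD_sd (s : K) (α : ι) (c : ℕ → K) (g : ℕ → Fun ι K) (k : ℤ) :
    LocFin fun n : ℕ => coeffD k (c n • (preDressing s α (g n) * sd s (-(2 * n) - 1))) := by
  intro m
  refine (Set.finite_Iic (-k).toNat).subset fun n hn => ?_
  by_contra h
  apply hn
  rw [Set.mem_Iic] at h
  dsimp only
  rw [coeffD_smul, coeffD_mul_sd, coeffD_preDressing, if_neg (by omega), smul_zero, smul_zero,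
    map_zero]

theorem ordBdd_preDressing_sd (s : K) (α : ι) (c : ℕ → K) (g : ℕ → Fun ι K) :
    OrdBdd fun n : ℕ => c n • (preDressing s α (g n) * sd s (-(2 * n) - 1)) :=
  ordBdd_of_forall 0 fun n k hk => by
    rw [coeffD_smul, coeffD_mul_sd, coeffD_preDressing, if_neg (by omega), smul_zero, smul_zero]

/-- The operator `Γ_{α,-}` applied to a combination `∑ q_{μ,i} g_i` of the times. -/
theorem preDressing_fsum_time [CharZero K] [DecidableEq ι] {s : K} (hs : s ≠ 0) (α μ : ι)
    (g : ℕ → Fun ι K) :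
    preDressing s α (fsum fun i => time K μ i * g i) =
      fsum (fun i => ofFun (time K μ i) * preDressing s α (g i)) +
      (if μ = α then -s else 0) • opSum fun i =>
        cb K i • (preDressing s α (g i) * sd s (-(2 * i) - 1)) := by
  refine op_ext fun k => ?_
  have e1 : coeffD k (preDressing s α (fsum fun i => time K μ i * g i)) =
      fsum fun i => coeffD k (preDressing s α (time K μ i * g i)) := by
    simp only [coeffD_preDressing]
    split_ifs
    · rw [(fsumCompat_gammaMinus s (fun n => (α, n)) _).eq (locFin_time_mul μ g),
        (fsumCompat_smul (s ^ k)).eq ((fsumCompat_gammaMinus s (fun n => (α, n)) _).locFin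
          (locFin_time_mul μ g))]
    · exact MvPowerSeries.ext fun m => by simp [coeff_fsum]
  rw [e1, coeffD_add, (fsumCompat_coeffD k).eq (locFin_ofFun_time_mul μ _), coeffD_smul,
    coeffD_opSum (ordBdd_preDressing_sd s α _ g),
    (fsumCompat_smul (if μ = α then -s else 0)).eq (locFin_coeffD_sd s α _ g k),
    ← fsum_add ((fsumCompat_coeffD k).locFin (locFin_ofFun_time_mul μ _))
      ((fsumCompat_smul (if μ = α then -s else 0)).locFin (locFin_coeffD_sd s α _ g k))]
  simp only [preDressing_time_mul hs, coeffD_add, coeffD_smul]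

variable [Fintype ι]

/-- The operator `r̂` in the functions of `x` and the times. -/
noncomputable def rHatFun (s : K) (ℓ : ℕ) (r : Matrix ι ι K) (f : Fun ι K) : Fun ι K :=
  ∑ μ, ∑ ν, r μ ν • (fsum (fun i => time K μ i * MvPowerSeries.pderivFun (ν, ℓ + i) f) +
    (s ^ 2 / 2) • ∑ i ∈ range ℓ, ((-1 : K) ^ (i + 1)) •
      MvPowerSeries.pderivFun (μ, i) (MvPowerSeries.pderivFun (ν, ℓ - 1 - i) f))

/-- The substitution `q_{γ,0} ↦ q_{γ,0} + x` commutes with the derivatives with respect to the times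
and maps `q_{γ,i}` to `time K γ i`. -/
theorem shift_rHat [CharZero K] (s : K) (ℓ : ℕ) (r : Matrix ι ι K) (τ : MvPowerSeries (ι × ℕ) K) :
    shift K (rHat s ℓ r τ) = rHatFun s ℓ r (shift K τ) := by
  rw [rHat, rHatFun, shift_sum]
  refine sum_congr rfl fun μ _ => ?_
  rw [shift_sum]
  refine sum_congr rfl fun ν _ => ?_
  rw [shift_smul, shift_add, shift_smul, shift_sum, shift_fsum]
  · simp only [shift_smul, pderivFun_shift, shift_mul, shift_X]
  · exact locFin_X_mul (fun _ _ h => (Prod.mk.inj h).2) _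
  · simp only [shift_mul, shift_X]
    exact locFin_time_mul _ _

variable [DecidableEq ι]

/-- The operator `r̂` with each `∂/∂q_v` replaced by `∇_v`. -/
noncomputable def rHatNabla (s : K) (ℓ : ℕ) (r : Matrix ι ι K) (α : ι) (A : Op ι K) : Op ι K :=
  ∑ μ, ∑ ν, r μ ν • (fsum (fun i => ofFun (time K μ i) * nablaOp s α (ν, ℓ + i) A) +
    (s ^ 2 / 2) • ∑ i ∈ range ℓ, ((-1 : K) ^ (i + 1)) •
      nablaOp s α (μ, i) (nablaOp s α (ν, ℓ - 1 - i) A))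

omit [Fintype ι] in
theorem nablaOp_nablaOp {s : K} (hs : s ≠ 0) (α : ι) (v w : ι × ℕ) (A : Op ι K) :
    nablaOp s α v (nablaOp s α w A) =
      MvPowerSeries.pderivFun v (MvPowerSeries.pderivFun w A) +
      (if w.1 = α then s⁻¹ * ca K w.2 else 0) • (MvPowerSeries.pderivFun v A * sd s (2 * w.2 + 1)) +
      (if v.1 = α then s⁻¹ * ca K v.2 else 0) • (MvPowerSeries.pderivFun w A * sd s (2 * v.2 + 1)) +
      ((if v.1 = α then s⁻¹ * ca K v.2 else 0) * (if w.1 = α then s⁻¹ * ca K w.2 else 0)) •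
        (A * sd s (2 * (w.2 + v.2 + 1))) := by
  simp only [nablaOp]
  rw [MvPowerSeries.pderivFun_add, pderivFun_smul, pderivFun_mul, pderivFun_sd, mul_zero, add_zero,
    add_mul,
    smul_add, smul_mul_assoc, mul_assoc, sd_mul_sd hs, smul_smul,
    show (2 * (w.2 : ℤ) + 1 + (2 * v.2 + 1)) = 2 * (w.2 + v.2 + 1) by ring]
  abel

omit [Fintype ι] in
/-- The second order part of `r̂` with `∇` in place of the derivatives. The products of two
multiplication terms add up to `d_ℓ (s∂)^{2ℓ}`. -/
theorem sum_nablaOp_nablaOp {s : K} (hs : s ≠ 0) {ℓ : ℕ} (α μ ν : ι) (A : Op ι K) :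
    (s ^ 2 / 2) • ∑ i ∈ range ℓ, ((-1 : K) ^ (i + 1)) •
      nablaOp s α (μ, i) (nablaOp s α (ν, ℓ - 1 - i) A) =
    (s ^ 2 / 2) • ∑ i ∈ range ℓ, ((-1 : K) ^ (i + 1)) •
      MvPowerSeries.pderivFun (μ, i) (MvPowerSeries.pderivFun (ν, ℓ - 1 - i) A) +
    (if ν = α then (-1) ^ (ℓ + 1) * (s / 2) else 0) • ∑ n ∈ range ℓ, ((-1) ^ (n + 1) * ca K n) •
      (MvPowerSeries.pderivFun (μ, ℓ - 1 - n) A * sd s (2 * n + 1)) +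
    (if μ = α then s / 2 else 0) • ∑ n ∈ range ℓ, ((-1) ^ (n + 1) * ca K n) •
      (MvPowerSeries.pderivFun (ν, ℓ - 1 - n) A * sd s (2 * n + 1)) +
    (if μ = α then if ν = α then cd K ℓ else 0 else 0) • (A * sd s (2 * ℓ)) := by
  have e2 : (if ν = α then (-1) ^ (ℓ + 1) * (s / 2) else 0) • ∑ n ∈ range ℓ,
      ((-1) ^ (n + 1) * ca K n) •
      (MvPowerSeries.pderivFun (μ, ℓ - 1 - n) A * sd s (2 * n + 1)) =
      ∑ i ∈ range ℓ, ((s ^ 2 / 2) * ((-1 : K) ^ (i + 1)) *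
        (if ν = α then s⁻¹ * ca K (ℓ - 1 - i) else 0)) • (MvPowerSeries.pderivFun (μ, i) A *
          sd s (2 * (ℓ - 1 - i : ℕ) + 1)) := by
    rw [← sum_range_reflect, smul_sum]
    refine sum_congr rfl fun i hi => ?_
    rw [mem_range] at hi
    rw [smul_smul, show ℓ - 1 - (ℓ - 1 - i) = i by omega]
    congr 1
    split_ifs
    · rw [← neg_one_pow_add_eq hi]
      field_simp
    · ring
  have e4 : (if μ = α then if ν = α then cd K ℓ else 0 else 0) • (A * sd s (2 * ℓ)) =
      ∑ i ∈ range ℓ, ((s ^ 2 / 2) * ((-1 : K) ^ (i + 1)) *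
        ((if μ = α then s⁻¹ * ca K i else 0) * (if ν = α then s⁻¹ * ca K (ℓ - 1 - i) else 0))) •
        (A * sd s (2 * ((ℓ - 1 - i : ℕ) + i + 1))) := by
    have e : ∀ i ∈ range ℓ, (sd s (2 * (((ℓ - 1 - i : ℕ) : ℤ) + i + 1)) : Op ι K) = sd s (2 * ℓ) := by
      intro i hi
      rw [mem_range] at hi
      congr 1
      omega
    rw [sum_congr rfl fun i hi => by rw [e i hi], ← sum_smul]
    congr 1
    split_ifs
    · rw [cd, ← sum_range_reflect, mul_sum]
      refine sum_congr rfl fun i hi => ?_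
      rw [mem_range] at hi
      rw [show ℓ - 1 - (ℓ - 1 - i) = i by omega]
      field_simp
    all_goals simp
  rw [e2, e4]
  simp only [smul_sum, smul_smul, ← sum_add_distrib, nablaOp_nablaOp hs, smul_add]
  refine sum_congr rfl fun i _ => ?_
  have e3 : (s ^ 2 / 2) * ((-1 : K) ^ (i + 1) * if μ = α then s⁻¹ * ca K i else 0) =
      (if μ = α then s / 2 else 0) * ((-1) ^ (i + 1) * ca K i) := by
    split_ifs
    · field_simp
    · ring
  rw [e3, mul_assoc, mul_assoc]

variable [CharZero K]

/-- Expansion of the `∇_v` in `rHatNabla`. By the symmetry of `r`, the mixed terms with `∂_{β,i}` on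
the left and on the right are equal and combine to the second sum of `Q_α`. -/
theorem rHatNabla_eq {s : K} (hs : s ≠ 0) {ℓ : ℕ} {r : Matrix ι ι K}
    (hr : ∀ α β, r α β = (-1) ^ (ℓ + 1) * r β α) (α : ι) (A : Op ι K) :
    rHatNabla s ℓ r α A =
      ∑ μ, ∑ ν, r μ ν • (fsum (fun i => ofFun (time K μ i) * MvPowerSeries.pderivFun (ν, ℓ + i) A) +
        (s ^ 2 / 2) • ∑ i ∈ range ℓ, ((-1 : K) ^ (i + 1)) •
          MvPowerSeries.pderivFun (μ, i) (MvPowerSeries.pderivFun (ν, ℓ - 1 - i) A)) +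
      ((r α α * cd K ℓ) • (A * sd s (2 * ℓ)) +
      s • ∑ β, r α β • ∑ n ∈ range ℓ, ((-1) ^ (n + 1) * ca K n) •
        (MvPowerSeries.pderivFun (β, ℓ - 1 - n) A * sd s (2 * n + 1)) +
      ((-1) ^ (ℓ + 1) * s⁻¹) • ∑ β, r α β • fsum fun j =>
        ofFun (time K β j) * (ca K (ℓ + j) • (A * sd s (2 * (ℓ + j) + 1)))) := by
  have e1 : ∀ μ ν, fsum (fun i => ofFun (time K μ i) * nablaOp s α (ν, ℓ + i) A) =
      fsum (fun i => ofFun (time K μ i) * MvPowerSeries.pderivFun (ν, ℓ + i) A) +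
      (if ν = α then s⁻¹ else 0) • fsum fun j =>
        ofFun (time K μ j) * (ca K (ℓ + j) • (A * sd s (2 * (ℓ + j) + 1))) := by
    intro μ ν
    rw [(fsumCompat_smul (if ν = α then s⁻¹ else 0)).eq (locFin_ofFun_time_mul μ _),
      ← fsum_add (locFin_ofFun_time_mul μ _)
        ((fsumCompat_smul (if ν = α then s⁻¹ else 0)).locFin (locFin_ofFun_time_mul μ _))]
    congr 1
    funext i
    rw [nablaOp, mul_add]
    congr 1
    rw [mul_smul_comm, mul_smul_comm, smul_smul]
    push_cast
    congr 1
    split_ifs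
    · rfl
    · rw [zero_mul]
  simp only [rHatNabla, e1, sum_nablaOp_nablaOp hs]
  set Y : ι → Op ι K := fun β => ∑ n ∈ range ℓ, ((-1) ^ (n + 1) * ca K n) •
      (MvPowerSeries.pderivFun (β, ℓ - 1 - n) A * sd s (2 * n + 1)) with hY
  set X : ι → Op ι K := fun β => fsum fun j =>
        ofFun (time K β j) * (ca K (ℓ + j) • (A * sd s (2 * (ℓ + j) + 1))) with hX
  have eX : ((-1) ^ (ℓ + 1) * s⁻¹) • ∑ β, r α β • X β =
      ∑ μ, ∑ ν, r μ ν • (if ν = α then s⁻¹ else 0) • X μ := by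
    rw [smul_sum]
    refine sum_congr rfl fun μ _ => ?_
    simp only [ite_smul, zero_smul, smul_ite, smul_zero]
    rw [sum_ite_eq' univ α, if_pos (mem_univ _), hr μ α, smul_smul, smul_smul]
    congr 1
    ring
  have eY1 : s • ∑ β, r α β • Y β =
      ∑ μ, ∑ ν, r μ ν • ((if ν = α then (-1) ^ (ℓ + 1) * (s / 2) else 0) • Y μ +
        (if μ = α then s / 2 else 0) • Y ν) := by
    simp only [smul_add, sum_add_distrib]
    rw [sum_comm (f := fun μ ν => r μ ν • (if μ = α then s / 2 else 0) • Y ν),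
      ← sum_add_distrib, smul_sum]
    refine sum_congr rfl fun μ _ => ?_
    simp only [ite_smul, zero_smul, smul_ite, smul_zero]
    rw [sum_ite_eq' univ α, if_pos (mem_univ _), sum_ite_eq' univ α, if_pos (mem_univ _), hr μ α,
      smul_smul, smul_smul, smul_smul, ← add_smul]
    congr 1
    have h : ((-1 : K) ^ (ℓ + 1)) * (-1) ^ (ℓ + 1) = 1 := by
      rw [← mul_pow]; simp
    linear_combination (-(s / 2) * r α μ) * h
  have eZ : (r α α * cd K ℓ) • (A * sd s (2 * ℓ)) =
      ∑ μ, ∑ ν, r μ ν • (if μ = α then if ν = α then cd K ℓ else 0 else 0) • (A * sd s (2 * ℓ)) := by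
    simp only [ite_smul, zero_smul, smul_ite, smul_zero]
    rw [sum_congr rfl (g := fun μ => if μ = α then (r α α * cd K ℓ) • (A * sd s (2 * ℓ)) else 0),
      sum_ite_eq' univ α, if_pos (mem_univ _)]
    intro μ _
    split_ifs with h
    · rw [sum_ite_eq' univ α, if_pos (mem_univ _), h, smul_smul]
    · exact sum_const_zero
  rw [eX, eY1, eZ]
  simp only [← sum_add_distrib, ← smul_add]
  refine sum_congr rfl fun μ _ => sum_congr rfl fun ν _ => ?_
  congr 1
  abel

/-- The commutator of `Γ_{α,-}` and `r̂`. As `Γ_{α,-}` commutes with the derivatives with respect to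
the times, only the coefficients `q_{α,i}` of `r̂` contribute. -/
theorem preDressing_rHatFun {s : K} (hs : s ≠ 0) {ℓ : ℕ} (r : Matrix ι ι K) (α : ι) (f : Fun ι K) :
    preDressing s α (rHatFun s ℓ r f) =
      ∑ μ, ∑ ν, r μ ν • (fsum (fun i => ofFun (time K μ i) *
          MvPowerSeries.pderivFun (ν, ℓ + i) (preDressing s α f)) +
        (s ^ 2 / 2) • ∑ i ∈ range ℓ, ((-1 : K) ^ (i + 1)) • MvPowerSeries.pderivFun (μ, i)
          (MvPowerSeries.pderivFun (ν, ℓ - 1 - i) (preDressing s α f))) -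
      s • ∑ β, r α β • opSum fun n => cb K n •
        (MvPowerSeries.pderivFun (β, n + ℓ) (preDressing s α f) * sd s (-(2 * n) - 1)) := by
  simp only [rHatFun, preDressing_sum, preDressing_smul, preDressing_add,
    preDressing_fsum_time hs, pderivFun_preDressing]
  have e : s • ∑ β, r α β • (opSum fun n => cb K n •
        (preDressing s α (MvPowerSeries.pderivFun (β, n + ℓ) f) * sd s (-(2 * n) - 1))) =
      ∑ μ, ∑ ν, r μ ν • (if μ = α then s else 0) • (opSum fun n => cb K n •
        (preDressing s α (MvPowerSeries.pderivFun (ν, ℓ + n) f) * sd s (-(2 * n) - 1))) := by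
    rw [sum_comm, smul_sum]
    refine sum_congr rfl fun ν _ => ?_
    simp only [ite_smul, zero_smul, smul_ite, smul_zero]
    rw [sum_ite_eq' univ α, if_pos (mem_univ _), smul_comm]
    simp only [add_comm ℓ]
  rw [e]
  simp only [← sum_sub_distrib, ← smul_sub]
  refine sum_congr rfl fun μ _ => sum_congr rfl fun ν _ => ?_
  congr 1
  split_ifs
  · rw [neg_smul]
    abel
  · rw [zero_smul]
    abel

omit [DecidableEq ι] [CharZero K] in
/-- The operator `T Q_α` in terms of `T P_α`, because `T D_{β,n} = ∂ (T P_α) / ∂q_{β,n}`. -/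
theorem ofFun_mul_opQ (s : K) {ℓ : ℕ} (r : Matrix ι ι K) (α : ι) {T : Fun ι K} (hT : IsUnit T) :
    ofFun T * opQ s ℓ r T α =
      (r α α * cd K ℓ) • (preDressing s α T * sd s (2 * ℓ)) +
      s • ∑ β, r α β • (∑ n ∈ range ℓ, ((-1) ^ (n + 1) * ca K n) •
        (MvPowerSeries.pderivFun (β, ℓ - 1 - n) (preDressing s α T) * sd s (2 * n + 1)) +
        opSum fun n => cb K n •
          (MvPowerSeries.pderivFun (β, n + ℓ) (preDressing s α T) * sd s (-(2 * n) - 1))) +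
      ((-1) ^ (ℓ - 1) * s⁻¹) • ∑ β, r α β • fsum fun j =>
        ofFun (time K β j) * (ca K (ℓ + j) • (preDressing s α T * sd s (2 * (ℓ + j) + 1))) := by
  have hD : ∀ v, ofFun T * (MvPowerSeries.pderivFun v (dressing s T α) +
      ofFun (logDeriv T v) * dressing s T α) = MvPowerSeries.pderivFun v (preDressing s α T) := by
    intro v
    rw [← ofFun_mul_dressing s hT, pderivFun_mul, pderivFun_ofFun, mul_add, ← mul_assoc (ofFun T),
      ← ofFun_mul, logDeriv, mul_left_comm, Ring.mul_inverse_cancel _ hT, mul_one, add_comm]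
  have hD' : ∀ v n, ofFun T * ((MvPowerSeries.pderivFun v (dressing s T α) +
      ofFun (logDeriv T v) * dressing s T α) * sd s n) =
        MvPowerSeries.pderivFun v (preDressing s α T) * sd s n := by
    intro v n
    rw [← mul_assoc, hD]
  have hP : ∀ n, ofFun T * (dressing s T α * sd s n) = preDressing s α T * sd s n := by
    intro n
    rw [← mul_assoc, ofFun_mul_dressing s hT]
  have hS : ∀ β, ofFun T * (opSum fun n => cb K n • ((MvPowerSeries.pderivFun (β, n + ℓ)
      (dressing s T α) + ofFun (logDeriv T (β, n + ℓ)) * dressing s T α) * sd s (-(2 * n) - 1))) =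
      opSum fun n => cb K n •
          (MvPowerSeries.pderivFun (β, n + ℓ) (preDressing s α T) * sd s (-(2 * n) - 1)) := by
    intro β
    have hz : ∀ (n : ℕ) k,
      -(2 * (n : ℤ)) - 1 < k → coeffD k (cb K n • ((MvPowerSeries.pderivFun (β, n + ℓ)
      (dressing s T α) + ofFun (logDeriv T (β, n + ℓ)) * dressing s T α) * sd s (-(2 * n) - 1))) =
        0 := by
      intro n k hk
      have h0 : coeffD (k - (-(2 * (n : ℤ)) - 1)) (dressing s T α) = 0 := by
        rw [coeffD_dressing, if_neg (by omega)]
      rw [coeffD_smul, coeffD_mul_sd, coeffD_add, coeffD_pderivFun, coeffD_ofFun_mul, h0, mul_zero,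
        ← pderiv_eq_pderivFun, map_zero, add_zero, smul_zero, smul_zero]
    rw [ofFun_mul_opSum]
    · simp only [mul_smul_comm, hD']
    · exact ordBdd_of_forall 0 fun n k hk => hz n k (by omega)
    · intro k m
      refine (Set.finite_Iic (-k).toNat).subset fun n hn => ?_
      by_contra h
      rw [Set.mem_Iic] at h
      exact hn (by dsimp only; rw [hz n k (by omega), map_zero])
  have hX : ∀ β, ofFun T * (opSum fun j => ca K (ℓ + j) •
      (ofFun (time K β j) * dressing s T α * sd s (2 * (ℓ + j) + 1))) =
      fsum fun j =>
        ofFun (time K β j) * (ca K (ℓ + j) • (preDressing s α T * sd s (2 * (ℓ + j) + 1))) := by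
    intro β
    have e : ∀ j : ℕ,
      ca K (ℓ + j) • (ofFun (time K β j) * dressing s T α * sd s (2 * (ℓ + j) + 1)) =
        ofFun (time K β j) * (ca K (ℓ + j) • (dressing s T α * sd s (2 * (ℓ + j) + 1))) :=
          fun j => by
      rw [mul_smul_comm, mul_assoc]
    simp only [e]
    rw [(locFin_ofFun_time_mul β _).opSum_eq, (fsumCompat_mulLeft _).eq (locFin_ofFun_time_mul β _)]
    congr 1
    funext j
    rw [← mul_assoc, ← ofFun_mul, mul_comm T, ofFun_mul, mul_assoc, mul_smul_comm, hP]
  simp only [opQ, mul_add (ofFun T), mul_smul_comm _ (ofFun T), mul_sum, hP, hD', hS, hX]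

/-- The infinitesimal deformation of the vertex operator, in terms of the dressing operator:
`Γ_{α,-} (r̂ T) + T Q_α` arises from `T P_α` by `r̂`, with `∇` in place of the derivatives. -/
theorem preDressing_rHatFun_add {s : K} (hs : s ≠ 0) {ℓ : ℕ} (hℓ : 0 < ℓ) {r : Matrix ι ι K}
    (hr : ∀ α β, r α β = (-1) ^ (ℓ + 1) * r β α) (α : ι) {T : Fun ι K} (hT : IsUnit T) :
    preDressing s α (rHatFun s ℓ r T) + ofFun T * opQ s ℓ r T α =
      rHatNabla s ℓ r α (preDressing s α T) := by
  rw [rHatNabla_eq hs hr, preDressing_rHatFun hs, ofFun_mul_opQ s r α hT,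
    show (-1 : K) ^ (ℓ + 1) = (-1) ^ (ℓ - 1) by
      rw [show ℓ + 1 = (ℓ - 1) + 2 by omega, pow_add]; simp]
  simp only [smul_add, sum_add_distrib]
  abel

end Quantization

/-! ### The deformed dressing operator -/

theorem pderivFun_neg {σ B : Type*} [Ring B] (v : σ) (f : MvPowerSeries σ B) :
    MvPowerSeries.pderivFun v (-f) = -MvPowerSeries.pderivFun v f :=
  MvPowerSeries.ext fun m => by
    rw [map_neg, MvPowerSeries.coeff_pderivFun, MvPowerSeries.coeff_pderivFun, map_neg, neg_mul]

instance {k k' R : Type*} [CommRing k] [CommRing k'] [CommRing R] [Algebra k R] [Algebra k' R] :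
    SMulCommClass k k' (PDO R) where
  smul_comm a b A := PDO.ext fun n => by
    simp only [PDO.coeff_smul]
    rw [smul_comm]

instance {k k' σ B : Type*} [CommRing k] [CommRing k'] [Ring B] [Module k B] [Module k' B]
    [SMulCommClass k k' B] : SMulCommClass k k' (MvPowerSeries σ B) where
  smul_comm a b A := MvPowerSeries.ext fun m => by
    simp only [coeff_smul']
    rw [smul_comm]

section NegOp

variable {ι S : Type*} [CommRing S]

theorem IsNegOp.coeffD_mul {A B : Op ι S} (hA : IsNegOp A) (hB : IsNegOp B) :
    coeffD (-1) (A * B) = 0 := by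
  classical
  rw [isNegOp_iff] at *
  refine MvPowerSeries.ext fun m => ?_
  rw [coeff_coeffD, MvPowerSeries.coeff_mul, PDO.coeff_sum, map_zero]
  exact sum_eq_zero fun p _ => PDO.coeff_mul_eq_zero (M := -1) (N := -1)
    (fun k hk => hA p.1 k (by omega)) (fun k hk => hB p.2 k (by omega)) _ (by omega)

theorem IsDiffOp.sub {A B : Op ι S} (hA : IsDiffOp A) (hB : IsDiffOp B) : IsDiffOp (A - B) :=
  fun k hk => by rw [coeffD_sub, hA k hk, hB k hk, sub_zero]

end NegOp

section DressingNeg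

variable {K : Type*} [Field K] {ι S : Type*} [CommRing S] [Algebra K S]

theorem isNegOp_pderivFun_dressing (s : K) {T : Fun ι S} (hT : IsUnit T) (α : ι) (v : ι × ℕ) :
    IsNegOp (MvPowerSeries.pderivFun v (dressing s T α)) := fun k hk => by
  obtain ⟨p, q, hp, -, -, -, hp0, hp1, -⟩ := exists_dressing_inverse s hT α
  rw [coeffD_pderivFun, hp, coeffD_toOp]
  rcases hk.eq_or_lt with h | h
  · rw [← h, hp0, MvPowerSeries.pderivFun_one]
  · rw [hp1 k h, ← pderiv_eq_pderivFun, map_zero]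

theorem isNegOp_inverse_dressing_sub_one (s : K) {T : Fun ι S} (hT : IsUnit T) (α : ι) :
    IsNegOp (Ring.inverse (dressing s T α) - 1) := fun k hk => by
  obtain ⟨p, q, -, hq, -, -, -, -, hq0, hq1⟩ := exists_dressing_inverse s hT α
  rw [coeffD_sub, hq, coeffD_toOp, coeffD_one]
  rcases hk.eq_or_lt with h | h
  · rw [← h, hq0, if_pos rfl, sub_self]
  · rw [hq1 k h, if_neg (by omega), sub_zero]

theorem IsNegOp.mul_inverse_dressing {A : Op ι S} (hA : IsNegOp A) (s : K) {T : Fun ι S}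
    (hT : IsUnit T) (α : ι) : IsNegOp (A * Ring.inverse (dressing s T α)) := fun k hk => by
  rw [← sub_add_cancel (Ring.inverse (dressing s T α)) 1, mul_add, mul_one, coeffD_add, hA k hk,
    (hA.mul (isNegOp_inverse_dressing_sub_one s hT α)) k hk, add_zero]

theorem IsNegOp.res_mul_inverse_dressing {A : Op ι S} (hA : IsNegOp A) (s : K) {T : Fun ι S}
    (hT : IsUnit T) (α : ι) : res (A * Ring.inverse (dressing s T α)) = res A := by
  rw [res, ← sub_add_cancel (Ring.inverse (dressing s T α)) 1, mul_add, mul_one, coeffD_add,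
    hA.coeffD_mul (isNegOp_inverse_dressing_sub_one s hT α), zero_add, res]

theorem coeff_one_gammaMinus (s : K) {σ R : Type*} [CommRing R] [Algebra K R] (v : ℕ → σ)
    (f : MvPowerSeries σ R) : PowerSeries.coeff 1 (gammaMinus s v R) f =
      -(s • MvPowerSeries.pderivFun (v 0) f) := by
  rw [gammaMinus, expSeries, PowerSeries.coeff_mk, sum_range_succ, sum_range_one, pow_zero,
    PowerSeries.coeff_one, if_neg one_ne_zero, smul_zero, zero_add, pow_one, PowerSeries.coeff_mk,
    if_pos odd_one, Nat.factorial_one, Nat.cast_one, inv_one, one_smul, LinearMap.smul_apply]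
  change _ • MvPowerSeries.pderiv R _ f = _
  rw [pderiv_eq_pderivFun, neg_smul]
  simp [cb]

/-- `P_α = 1 - (∂ log T / ∂q_{α,0}) ∂⁻¹ + …`. -/
theorem coeffD_dressing_neg_one {s : K} (hs : s ≠ 0) (T : Fun ι S) (α : ι) :
    coeffD (-1) (dressing s T α) = -logDeriv T (α, 0) := by
  rw [coeffD_dressing, if_pos (by omega), show (- -1 : ℤ).toNat = 1 from rfl, coeff_one_gammaMinus,
    logDeriv, neg_mul, smul_neg, smul_mul_assoc, smul_smul, zpow_neg, zpow_one, inv_mul_cancel₀ hs,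
    one_smul]

theorem pderivFun_inverse {σ R : Type*} [CommRing R] (v : σ) {T : MvPowerSeries σ R}
    (hT : IsUnit T) : MvPowerSeries.pderivFun v (Ring.inverse T) =
      -(MvPowerSeries.pderivFun v T * Ring.inverse T ^ 2) := by
  have h := congrArg (MvPowerSeries.pderivFun v) (Ring.mul_inverse_cancel T hT)
  rw [pderivFun_mul, MvPowerSeries.pderivFun_one] at h
  refine hT.mul_left_cancel ?_
  have h1 := Ring.mul_inverse_cancel T hT
  linear_combination h + MvPowerSeries.pderivFun v T * Ring.inverse T * h1

/-- `∂_v ∂_w T = T (∂_v (∂_w log T) + ∂_v log T · ∂_w log T)`. -/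
theorem pderivFun_pderivFun_mul_inverse {T : Fun ι S} (hT : IsUnit T) (v w : ι × ℕ) :
    MvPowerSeries.pderivFun v (MvPowerSeries.pderivFun w T) * Ring.inverse T =
      MvPowerSeries.pderivFun v (logDeriv T w) + logDeriv T v * logDeriv T w := by
  rw [logDeriv, logDeriv, pderivFun_mul, pderivFun_inverse v hT]
  ring

theorem pderivFun_logDeriv_comm {T : Fun ι S} (hT : IsUnit T) (v w : ι × ℕ) :
    MvPowerSeries.pderivFun v (logDeriv T w) = MvPowerSeries.pderivFun w (logDeriv T v) := by
  have h1 := pderivFun_pderivFun_mul_inverse hT v w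
  have h2 := pderivFun_pderivFun_mul_inverse hT w v
  rw [pderivFun_comm] at h1
  linear_combination h2 - h1

theorem twoPoint_comm {T : Fun ι S} (hT : IsUnit T) (s : K) (v w : ι × ℕ) :
    twoPoint s T v w = twoPoint s T w v := by
  rw [twoPoint, pderivFun_logDeriv_comm hT, twoPoint]

/-- The residue of `(∂_v P_α) P_α⁻¹` is the derivative of the coefficient of `∂⁻¹` in `P_α`, because
`∂_v P_α` is negative and `P_α⁻¹ = 1 + (lower order)`. -/
theorem twoPoint_eq_res {s : K} (hs : s ≠ 0) {T : Fun ι S} (hT : IsUnit T) (α : ι) (v : ι × ℕ) :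
    twoPoint s T (α, 0) v = -((s ^ 2) • res (MvPowerSeries.pderivFun v (dressing s T α) *
      Ring.inverse (dressing s T α))) := by
  rw [(isNegOp_pderivFun_dressing s hT α v).res_mul_inverse_dressing s hT, res, coeffD_pderivFun,
    coeffD_dressing_neg_one hs, twoPoint_comm hT, twoPoint, ← smul_neg]
  rw [pderivFun_neg, neg_neg]

end DressingNeg

section Dual

variable {K : Type*} [Field K] {ι : Type*}

/-- The function `f + ε g`. -/
noncomputable def dualFun (f g : Fun ι K) : Fun ι (DualNumber K) :=
  extFun f + (DualNumber.eps : DualNumber K) • extFun g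

/-- The operator `A + ε B`. -/
noncomputable def dualOp (A B : Op ι K) : Op ι (DualNumber K) :=
  extOp A + (DualNumber.eps : DualNumber K) • extOp B

theorem dualFun_mul (f g f' g' : Fun ι K) :
    dualFun f g * dualFun f' g' = dualFun (f * f') (f * g' + g * f') := by
  simp only [dualFun, mul_add, add_mul, smul_mul_assoc, mul_smul_comm, eps_smul_eps_smul,
    extFun_mul,
    extFun_add, smul_add]
  abel

theorem dualOp_mul (A B A' B' : Op ι K) :
    dualOp A B * dualOp A' B' = dualOp (A * A') (A * B' + B * A') := by
  simp only [dualOp, mul_add, add_mul, smul_mul_assoc, mul_smul_comm, eps_smul_eps_smul, extOp_mul,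
    extOp_add, smul_add]
  abel

theorem dualFun_add (f g f' g' : Fun ι K) :
    dualFun f g + dualFun f' g' = dualFun (f + f') (g + g') := by
  simp only [dualFun, extFun_add, smul_add]
  abel

theorem dualOp_smul (c : K) (A B : Op ι K) : c • dualOp A B = dualOp (c • A) (c • B) := by
  rw [dualOp, dualOp, extOp_smul, extOp_smul, smul_add, smul_comm c]

theorem dualFun_smul (c : K) (f g : Fun ι K) : c • dualFun f g = dualFun (c • f) (c • g) := by
  rw [dualFun, dualFun, extFun_smul, extFun_smul, smul_add, smul_comm c]

theorem dualOp_one : dualOp (1 : Op ι K) 0 = 1 := by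
  rw [dualOp, extOp_one, ← extOpHom_apply, map_zero, smul_zero, add_zero]

theorem dualFun_one : dualFun (1 : Fun ι K) 0 = 1 := by
  rw [dualFun, extFun_one, extFun_zero, smul_zero, add_zero]

theorem dualOp_sd (s : K) (n : ℤ) : dualOp (sd s n : Op ι K) 0 = sd s n := by
  rw [dualOp, extOp_sd, ← extOpHom_apply, map_zero, smul_zero, add_zero]

theorem dualOp_ofFun (f g : Fun ι K) : dualOp (ofFun f) (ofFun g) = ofFun (dualFun f g) := by
  refine op_ext fun k => ?_
  simp only [dualOp, extOp_ofFun, coeffD_add, coeffD_smul, coeffD_ofFun, dualFun]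
  split_ifs <;> simp

theorem minus_dualOp (A B : Op ι K) : minus (dualOp A B) = dualOp (minus A) (minus B) := by
  rw [dualOp, minus_add, minus_smul, minus_extOp, minus_extOp, dualOp]

theorem pderivFun_dualOp (v : ι × ℕ) (A B : Op ι K) :
    MvPowerSeries.pderivFun v (dualOp A B) =
      dualOp (MvPowerSeries.pderivFun v A) (MvPowerSeries.pderivFun v B) := by
  rw [dualOp, MvPowerSeries.pderivFun_add, pderivFun_smul, pderivFun_extOp, pderivFun_extOp, dualOp]

theorem pderivFun_dualFun (v : ι × ℕ) (f g : Fun ι K) :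
    MvPowerSeries.pderivFun v (dualFun f g) =
      dualFun (MvPowerSeries.pderivFun v f) (MvPowerSeries.pderivFun v g) := by
  rw [dualFun, MvPowerSeries.pderivFun_add, pderivFun_smul, pderivFun_extFun, pderivFun_extFun,
    dualFun]

theorem dx_dualFun (f g : Fun ι K) : dx (dualFun f g) = dualFun (dx f) (dx g) := by
  rw [dualFun, dx_add, dx_smul, dx_extFun, dx_extFun, dualFun]

theorem dualFun_mul_inverse {T : Fun ι K} (hT : IsUnit T) (T₁ : Fun ι K) :
    dualFun T T₁ * dualFun (Ring.inverse T) (-(T₁ * Ring.inverse T ^ 2)) = 1 := by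
  have h := Ring.mul_inverse_cancel T hT
  rw [dualFun_mul, h, show T * -(T₁ * Ring.inverse T ^ 2) + T₁ * Ring.inverse T = 0 by
    linear_combination (-T₁ * Ring.inverse T) * h, dualFun_one]

theorem isUnit_dualFun {T : Fun ι K} (hT : IsUnit T) (T₁ : Fun ι K) : IsUnit (dualFun T T₁) :=
  IsUnit.of_mul_eq_one _ (dualFun_mul_inverse hT T₁)

theorem inverse_dualFun {T : Fun ι K} (hT : IsUnit T) (T₁ : Fun ι K) :
    Ring.inverse (dualFun T T₁) = dualFun (Ring.inverse T) (-(T₁ * Ring.inverse T ^ 2)) := by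
  refine (isUnit_dualFun hT T₁).mul_left_cancel ?_
  rw [Ring.mul_inverse_cancel _ (isUnit_dualFun hT T₁), dualFun_mul_inverse hT]

/-- `∂_v log (T + ε T₁) = ∂_v log T + ε ∂_v (T₁ / T)`. -/
theorem logDeriv_dualFun {T : Fun ι K} (hT : IsUnit T) (T₁ : Fun ι K) (v : ι × ℕ) :
    logDeriv (dualFun T T₁) v =
      dualFun (logDeriv T v) (MvPowerSeries.pderivFun v (T₁ * Ring.inverse T)) := by
  rw [logDeriv, inverse_dualFun hT, pderivFun_dualFun, dualFun_mul, logDeriv, pderivFun_mul,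
    pderivFun_inverse v hT]
  congr 1
  ring

theorem preDressing_dualFun (s : K) (α : ι) (f g : Fun ι K) :
    preDressing s α (dualFun f g) = dualOp (preDressing s α f) (preDressing s α g) := by
  have hext : ∀ (n : ℕ) (f : Fun ι K), PowerSeries.coeff n (gammaMinus s (fun n => (α, n))
      (PowerSeries (DualNumber K))) (extFun f) =
      extFun (PowerSeries.coeff n (gammaMinus s (fun n => (α, n)) (PowerSeries K)) f) := by
    intro n f
    let Ψ : Fun ι K →ₗ[K] Fun ι (DualNumber K) :=
      { toFun := extFun
        map_add' := extFun_add
        map_smul' := extFun_smul }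
    exact (gammaMinus_intertwine s _ _ Ψ (fun n f => (pderivFun_extFun _ f).symm) n f).symm
  refine op_ext fun k => ?_
  rw [dualOp, coeffD_add, coeffD_smul, coeffD_extOp, coeffD_extOp]
  simp only [coeffD_preDressing]
  split_ifs
  · rw [dualFun, map_add, LinearMap.map_smul_of_tower, hext, hext, smul_add, extFun_smul,
      extFun_smul,
      smul_comm (s ^ k)]
  · rw [extFun_zero, smul_zero, add_zero]

end Dual

section DeformedDressing

variable {K : Type*} [Field K] [CharZero K] {ι : Type*} [Fintype ι] [DecidableEq ι]

omit [CharZero K] [Fintype ι] in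
theorem nablaOp_mul (s : K) (α : ι) (v : ι × ℕ) (A P : Op ι K) :
    nablaOp s α v (A * P) = MvPowerSeries.pderivFun v A * P + A * nablaOp s α v P := by
  rw [nablaOp, pderivFun_mul, nablaOp, mul_add, mul_smul_comm, mul_assoc, add_assoc]

omit [CharZero K] in
/-- If `∇_v P = B_v P` with differential operators `B_v`, then `r̂`, with `∇` in place of the
derivatives, maps `A P`, where `A` is a differential operator, to `C P` with a differential
operator `C`. -/
theorem exists_rHatNabla (s : K) (ℓ : ℕ) (r : Matrix ι ι K) (α : ι) {P : Op ι K}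
    {B : ι × ℕ → Op ι K} (hB : ∀ v, IsDiffOp (B v)) (hP : ∀ v, nablaOp s α v P = B v * P)
    {A : Op ι K} (hA : IsDiffOp A) :
    ∃ C : Op ι K, IsDiffOp C ∧ rHatNabla s ℓ r α (A * P) = C * P := by
  have h : ∀ v A, nablaOp s α v (A * P) = (MvPowerSeries.pderivFun v A + A * B v) * P :=
    fun v A => by
    rw [nablaOp_mul, hP, add_mul, mul_assoc]
  have hd : ∀ v A, IsDiffOp A → IsDiffOp (MvPowerSeries.pderivFun v A + A * B v) := fun v A hA =>
    (hA.pderivFun v).add (hA.mul (hB v))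
  refine ⟨∑ μ, ∑ ν, r μ ν • (fsum (fun i => ofFun (time K μ i) *
    (MvPowerSeries.pderivFun (ν, ℓ + i) A + A * B (ν, ℓ + i))) +
    (s ^ 2 / 2) • ∑ i ∈ range ℓ, ((-1 : K) ^ (i + 1)) •
      (MvPowerSeries.pderivFun (μ, i) (MvPowerSeries.pderivFun (ν, ℓ - 1 - i) A +
        A * B (ν, ℓ - 1 - i)) + (MvPowerSeries.pderivFun (ν, ℓ - 1 - i) A +
        A * B (ν, ℓ - 1 - i)) * B (μ, i))), ?_, ?_⟩
  · exact IsDiffOp.sum fun μ _ => IsDiffOp.sum fun ν _ => ((isDiffOp_fsum (locFin_ofFun_time_mul μ _)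
      fun i => (isDiffOp_ofFun _).mul (hd _ _ hA)).add ((IsDiffOp.sum fun i _ =>
        (hd _ _ (hd _ _ hA)).smul _).smul _)).smul _
  · simp only [rHatNabla, h, sum_mul]
    refine sum_congr rfl fun μ _ => sum_congr rfl fun ν _ => ?_
    rw [smul_mul_assoc, add_mul, smul_mul_assoc, sum_mul,
      (fsumCompat_mulRight P).eq (locFin_ofFun_time_mul μ _)]
    simp only [mul_assoc, smul_mul_assoc]

/-- The deformed dressing operator is `(1 - ε W₋) P` with `W = Q P⁻¹`. -/
theorem dressing_dualFun {s : K} (hs : s ≠ 0) {ℓ : ℕ} (hℓ : 0 < ℓ) {r : Matrix ι ι K}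
    (hr : ∀ α β, r α β = (-1) ^ (ℓ + 1) * r β α) (α : ι) {T : Fun ι K} (hT : IsUnit T)
    {B : ι × ℕ → Op ι K} (hB : ∀ v, IsDiffOp (B v))
    (hP : ∀ v, nablaOp s α v (dressing s T α) = B v * dressing s T α) :
    dressing s (dualFun T (rHatFun s ℓ r T)) α =
      dualOp (dressing s T α) (-(minus (opQP s ℓ r T α) * dressing s T α)) := by
  obtain ⟨C, hC, hCP⟩ := exists_rHatNabla s ℓ r α hB hP (isDiffOp_ofFun T)
  have key := preDressing_rHatFun_add hs hℓ hr α hT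
  rw [← ofFun_mul_dressing s hT, hCP] at key
  set T₁ := rHatFun s ℓ r T with hT₁
  set P := dressing s T α with hPdef
  have hPP : P * Ring.inverse P = 1 := dressing_mul_inverse s hT α
  have hPP' : Ring.inverse P * P = 1 := inverse_mul_dressing s hT α
  have hTT : ofFun T * ofFun (Ring.inverse T) = 1 := by
    rw [← ofFun_mul, Ring.mul_inverse_cancel _ hT, ofFun_one]
  have hTT' : ofFun (Ring.inverse T) * ofFun T = 1 := by
    rw [← ofFun_mul, Ring.inverse_mul_cancel _ hT, ofFun_one]
  -- `N P` is the first order term of the quotient of `Γ_{α,-} (T + ε T₁)` and `T + ε T₁`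
  set N := (ofFun (Ring.inverse T) * preDressing s α T₁ - ofFun (T₁ * Ring.inverse T) * P) *
    Ring.inverse P with hN
  have hNneg : IsNegOp N := by
    refine IsNegOp.mul_inverse_dressing (fun k hk => ?_) s hT α
    rw [coeffD_sub, coeffD_ofFun_mul, coeffD_ofFun_mul, coeffD_preDressing, hPdef, coeffD_dressing]
    rcases hk.eq_or_lt with h | h
    · rw [← h, if_pos le_rfl, if_pos le_rfl, zpow_zero, one_smul, one_smul, neg_zero,
        Int.toNat_zero,
        coeff_zero_gammaMinus, Module.End.one_apply, Module.End.one_apply,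
        Ring.mul_inverse_cancel _ hT, mul_one, mul_comm, sub_self]
    · rw [if_neg (by omega), if_neg (by omega), mul_zero, mul_zero, sub_zero]
  -- division of the identity `key` by `T` and `P` shows that `N + Q P⁻¹` is a differential operator
  have hNW : N + opQP s ℓ r T α = ofFun (Ring.inverse T) * C - ofFun (T₁ * Ring.inverse T) := by
    have e := congrArg (fun A => ofFun (Ring.inverse T) * A * Ring.inverse P) key
    simp only [mul_add, add_mul] at e
    rw [← mul_assoc _ (ofFun T), hTT', one_mul, ← mul_assoc _ C, mul_assoc _ P, hPP, mul_one] at e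
    rw [hN, sub_mul, mul_assoc _ P, hPP, mul_one, ← e, opQP]
    abel
  have hW : N = -minus (opQP s ℓ r T α) := by
    have h1 := congrArg minus hNW
    rw [minus_add, hNneg.minus_eq,
      (((isDiffOp_ofFun _).mul hC).sub (isDiffOp_ofFun _)).minus_eq_zero]
      at h1
    exact eq_neg_of_add_eq_zero_left h1
  have hGT : preDressing s α T₁ = ofFun T₁ * P + ofFun T * (N * P) := by
    rw [hN, mul_assoc _ _ P, hPP', mul_one, mul_sub, ← mul_assoc, hTT, one_mul, ← mul_assoc,
      ← ofFun_mul, mul_comm T, mul_assoc T₁, Ring.inverse_mul_cancel _ hT, mul_one]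
    abel
  have hu : IsUnit (ofFun (dualFun T T₁)) := (isUnit_dualFun hT T₁).map ofFunHom
  refine hu.mul_left_cancel ?_
  rw [ofFun_mul_dressing s (isUnit_dualFun hT T₁), preDressing_dualFun, ← dualOp_ofFun, dualOp_mul,
    ← neg_mul, ← hW, hGT, ← ofFun_mul_dressing s hT, add_comm (ofFun T₁ * P)]

end DeformedDressing

/-! ### The deformed Sato-Wilson equation and its residue -/

section DeformedSatoWilson

variable {K : Type*} [Field K] [CharZero K] {ι : Type*} [Fintype ι] [DecidableEq ι]

omit [DecidableEq ι] in
/-- The deformed tau function is `T + ε r̂ T`. -/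
theorem shift_deformedTau (s : K) (ℓ : ℕ) (r : Matrix ι ι K) (τ : MvPowerSeries (ι × ℕ) K) :
    shift K (deformedTau s ℓ r τ) = dualFun (shift K τ) (rHatFun s ℓ r (shift K τ)) := by
  have h : ∀ f : MvPowerSeries (ι × ℕ) K,
      shift K (MvPowerSeries.map (algebraMap K (DualNumber K)) f) = extFun (shift K f) := by
    intro f
    have h1 : ∀ k, shiftDeriv^[k] (MvPowerSeries.map (algebraMap K (DualNumber K)) f) =
        MvPowerSeries.map (algebraMap K (DualNumber K)) (shiftDeriv^[k] f) := by
      intro k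
      induction k with
      | zero => rfl
      | succ k ih =>
        rw [Function.iterate_succ_apply', Function.iterate_succ_apply', ih, shiftDeriv, shiftDeriv,
          map_sum]
        refine sum_congr rfl fun γ _ => MvPowerSeries.ext fun m => ?_
        simp [MvPowerSeries.coeff_pderivFun, MvPowerSeries.coeff_map]
    refine shift_ext fun m k => ?_
    rw [coeff_shift, h1, MvPowerSeries.coeff_map, ← extFunHom_apply, extFunHom,
      MvPowerSeries.coeff_map, PowerSeries.coeff_map, coeff_shift, smul_eq_mul, map_mul,
      Algebra.smul_def]
  rw [deformedTau, shift_add, shift_smul, h, h, shift_rHat, dualFun]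

omit [CharZero K] [Fintype ι] in
/-- The Sato-Wilson equation `(∂_v P_α) P_α⁻¹ = -δ s⁻¹ a_i (L_α^{i+1/2})₋`, `v = (β, i)`, `δ =
δ_{αβ}`: the negative part of `(∇_v P_α) P_α⁻¹ = B`. -/
theorem pderivFun_dressing_mul_inverse {s : K} {α : ι} {T : Fun ι K} (hT : IsUnit T) {v : ι × ℕ}
    {B : Op ι K} (hB : IsDiffOp B)
    (hP : nablaOp s α v (dressing s T α) = B * dressing s T α) :
    MvPowerSeries.pderivFun v (dressing s T α) * Ring.inverse (dressing s T α) =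
      -((if v.1 = α then s⁻¹ * ca K v.2 else 0) • minus (laxHalfPow s T α (2 * v.2 + 1))) := by
  have h := congrArg (fun A => minus (A * Ring.inverse (dressing s T α))) hP
  rw [mul_assoc B, dressing_mul_inverse s hT, mul_one, hB.minus_eq_zero, nablaOp, add_mul,
    smul_mul_assoc, minus_add, minus_smul, ((isNegOp_pderivFun_dressing s hT α
      v).mul_inverse_dressing s hT α).minus_eq] at h
  exact eq_neg_of_add_eq_zero_left h

/-- The deformed Sato-Wilson equation. -/
theorem deformed_satoWilson {s : K} (hs : s ≠ 0) {τ : ι → MvPowerSeries ℕ K}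
    (hτ : ∀ γ, IsKdVTau s (τ γ)) {ℓ : ℕ} (hℓ : 0 < ℓ) {r : Matrix ι ι K}
    (hr : ∀ α β, r α β = (-1) ^ (ℓ + 1) * r β α) (α β : ι) (p : ℕ) :
    MvPowerSeries.pderivFun (β, p) (dressing s (shift K (deformedTau s ℓ r (prodTau τ))) α) *
        Ring.inverse (dressing s (shift K (deformedTau s ℓ r (prodTau τ))) α) =
      satoWilsonRHS s ℓ r (prodTau τ) α β p := by
  have hT := isUnit_shift_prodTau hτ
  obtain ⟨⟨B, hB, hBP⟩, -⟩ := exists_satoWilson hs hτ α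
  have hR := dressing_dualFun hs hℓ hr α hT hB hBP
  have hM := pderivFun_dressing_mul_inverse hT (hB (β, p)) (hBP (β, p))
  have hTR := isUnit_dualFun hT (rHatFun s ℓ r (shift K (prodTau τ)))
  have hL0 := isNegOp_minus (laxHalfPow s (shift K (prodTau τ)) α (2 * p + 1))
  simp only [satoWilsonRHS, laxHalfPow, shift_deformedTau]
  have hPR := isUnit_dressing s hTR α
  rw [hR] at hPR ⊢
  set T := shift K (prodTau τ) with hTdef
  set W := opQP s ℓ r T α with hW
  have hPP := dressing_mul_inverse s hT α
  have hPP' := inverse_mul_dressing s hT α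
  have hL : laxHalfPow s T α (2 * p + 1) = dressing s T α * sd s (2 * p + 1) *
    Ring.inverse (dressing s T α) := rfl
  set P := dressing s T α with hP
  set L := laxHalfPow s T α (2 * p + 1) with hLdef
  have hinv : Ring.inverse (dualOp P (-(minus W * P))) =
      dualOp (Ring.inverse P) (Ring.inverse P * minus W) := by
    refine hPR.mul_left_cancel ?_
    rw [Ring.mul_inverse_cancel _ hPR, dualOp_mul, ← mul_assoc, hPP, one_mul, neg_mul, mul_assoc,
      hPP, mul_one, add_neg_cancel, dualOp_one]
  have hLR : dualOp P (-(minus W * P)) * sd s (2 * p + 1) *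
      Ring.inverse (dualOp P (-(minus W * P))) = dualOp L (L * minus W - minus W * L) := by
    rw [hinv, ← dualOp_sd, dualOp_mul, dualOp_mul, mul_zero, zero_add, hL]
    simp only [neg_mul, mul_assoc, sub_eq_add_neg]
  have hc : (if β = α then s⁻¹ * ca K p else 0) = (if α = β then 1 else 0) * (ca K p * s⁻¹) := by
    by_cases h : α = β
    · rw [if_pos h.symm, if_pos h]; ring
    · rw [if_neg (Ne.symm h), if_neg h, zero_mul]
  rw [hc] at hM
  set c : K := (if α = β then 1 else 0) * (ca K p * s⁻¹) with hcdef
  rw [hLR, hinv, pderivFun_dualOp, dualOp_mul, hM, minus_dualOp, dualOp_smul]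
  have e : ∀ X Y : Op ι K, dualOp X Y - (DualNumber.eps : DualNumber K) •
      extOp (minus (MvPowerSeries.pderivFun (β, p) W - c • (plus L * W - W * plus L))) =
      dualOp X (Y - minus (MvPowerSeries.pderivFun (β, p) W - c • (plus L * W - W * plus L))) := by
    intro X Y
    rw [dualOp, dualOp, extOp_sub Y, smul_sub (DualNumber.eps : DualNumber K), add_sub_assoc]
  rw [← hL, e]
  congr 1
  · rw [neg_smul]
  have h1 : MvPowerSeries.pderivFun (β, p) (-(minus W * P)) * Ring.inverse P =
      -(minus (MvPowerSeries.pderivFun (β, p) W)) + minus W * (c • minus L) := by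
    rw [pderivFun_neg, pderivFun_mul, neg_mul, add_mul, mul_assoc, hPP, mul_one, mul_assoc, hM,
      minus_pderivFun, mul_neg]
    abel
  rw [h1, ← mul_assoc, hM]
  -- a product of two differential operators has no negative part, and a product of two negative
  -- operators is its own negative part
  have hLs : L = plus L + minus L := (plus_add_minus L).symm
  have hWs : W = plus W + minus W := (plus_add_minus W).symm
  have hWm := isNegOp_minus W
  have hLWp : minus (plus L * W) = minus (plus L * minus W) := by
    conv_lhs => rw [hWs, mul_add, minus_add,
      ((isDiffOp_plus L).mul (isDiffOp_plus W)).minus_eq_zero, zero_add]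
  have hWLp : minus (W * plus L) = minus (minus W * plus L) := by
    conv_lhs => rw [hWs, add_mul, minus_add,
      ((isDiffOp_plus W).mul (isDiffOp_plus L)).minus_eq_zero, zero_add]
  have hLWm : minus (L * minus W) = minus (plus L * minus W) + minus L * minus W := by
    conv_lhs => rw [hLs, add_mul, minus_add, (hL0.mul hWm).minus_eq]
  have hWLm : minus (minus W * L) = minus (minus W * plus L) + minus W * minus L := by
    conv_lhs => rw [hLs, mul_add, minus_add, (hWm.mul hL0).minus_eq]
  rw [minus_sub, minus_sub, minus_smul, minus_sub, hLWp, hWLp, hLWm, hWLm]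
  simp only [neg_mul, smul_mul_assoc, mul_smul_comm, smul_sub, smul_add, neg_smul]
  abel

theorem deformed_twoPoint {s : K} (hs : s ≠ 0) {τ : ι → MvPowerSeries ℕ K}
    (hτ : ∀ γ, IsKdVTau s (τ γ)) {ℓ : ℕ} (hℓ : 0 < ℓ) {r : Matrix ι ι K}
    (hr : ∀ α β, r α β = (-1) ^ (ℓ + 1) * r β α) (α β : ι) (p : ℕ) :
    twoPoint s (shift K (deformedTau s ℓ r (prodTau τ))) (α, 0) (β, p) =
      -((s ^ 2) • res (satoWilsonRHS s ℓ r (prodTau τ) α β p)) := by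
  rw [← deformed_satoWilson hs hτ hℓ hr]
  refine twoPoint_eq_res hs ?_ _ _
  rw [shift_deformedTau]
  exact isUnit_dualFun (isUnit_shift_prodTau hτ) _

end DeformedSatoWilson

/-! ### Square roots and conjugation of pseudo-differential operators -/

namespace PDO

section Sqrt

variable {K R : Type*} [Field K] [CharZero K] [CommRing R] [Differential R] [Algebra K R]

/-- A square root with leading term `c ∂`, `c` an invertible constant, is unique. -/
theorem eq_of_mul_self_eq {A B : PDO R} {c : K} (hc : c ≠ 0) (hA1 : A.coeff 1 = algebraMap K R c)
    (hA : ∀ k, 1 < k → A.coeff k = 0) (hB1 : B.coeff 1 = algebraMap K R c)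
    (hB : ∀ k, 1 < k → B.coeff k = 0) (h : A * A = B * B) : A = B := by
  have hC : A * (A - B) + (A - B) * B = 0 := by
    rw [mul_sub, sub_mul, sub_add_sub_cancel, h, sub_self]
  have hn : ∀ (n : ℕ) (k : ℤ), 1 - (n : ℤ) < k → (A - B).coeff k = 0 := by
    intro n
    induction n with
    | zero => intro k hk; rw [coeff_sub, hA k (by omega), hB k (by omega), sub_zero]
    | succ n ih =>
      intro k hk
      rcases (show 1 - (n : ℤ) < k ∨ k = 1 - n by push_cast at hk; omega) with h1 | h1
      · exact ih k h1
      · have h2 := congrArg (fun A => A.coeff (1 + (1 - (n : ℤ)))) hC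
        rw [coeff_add, coeff_mul_top hA ih _ rfl, coeff_mul_top ih hB _ (by ring), hA1, hB1,
          coeff_zero] at h2
        have h3 : algebraMap K R (c * 2) * (A - B).coeff (1 - n) = 0 := by
          rw [map_mul, map_ofNat]
          linear_combination h2
        rw [h1]
        exact (((isUnit_iff_ne_zero.mpr (mul_ne_zero hc two_ne_zero)).map
          (algebraMap K R)).mul_right_eq_zero).mp h3
  refine PDO.ext fun k => sub_eq_zero.mp ?_
  rw [← coeff_sub]
  exact hn (2 - k).toNat k (by omega)

/-- Successive approximations of the square root of `L`, correct in degrees larger than `-n`. -/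
noncomputable def sqrtApprox (c : K) (L : PDO R) : ℕ → PDO R
  | 0 => mono 1 (algebraMap K R c)
  | n + 1 => sqrtApprox c L n - mono (-n) ((2 * c)⁻¹ •
      (sqrtApprox c L n * sqrtApprox c L n - L).coeff (1 - n))

omit [CharZero K] in
theorem sqrtApprox_succ (c : K) (L : PDO R) (n : ℕ) : sqrtApprox c L (n + 1) =
    sqrtApprox c L n - mono (-n) ((2 * c)⁻¹ •
      (sqrtApprox c L n * sqrtApprox c L n - L).coeff (1 - n)) := rfl

theorem sqrtApprox_spec {c : K} (hc : c ≠ 0) {L : PDO R} (h0 : (algebraMap K R c)′ = 0)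
    (hL2 : L.coeff 2 = algebraMap K R (c ^ 2))
    (hL : ∀ k, 2 < k → L.coeff k = 0) (n : ℕ) :
    (sqrtApprox c L n).coeff 1 = algebraMap K R c ∧
    (∀ k, 1 < k → (sqrtApprox c L n).coeff k = 0) ∧
    ∀ k, 1 - (n : ℤ) < k → (sqrtApprox c L n * sqrtApprox c L n - L).coeff k = 0 := by
  induction n with
  | zero =>
    refine ⟨by rw [sqrtApprox, coeff_mono, if_pos rfl], fun k hk => by
      rw [sqrtApprox, coeff_mono, if_neg (by omega)], fun k hk => ?_⟩
    rw [coeff_sub, sqrtApprox, coeff_mul_mono _ _ h0, coeff_mono]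
    rcases (show k = 2 ∨ 2 < k by push_cast at hk; omega) with h | h
    · rw [h, if_pos (by omega), hL2, pow_two, map_mul, sub_self]
    · rw [if_neg (by omega), hL k h, zero_mul, sub_zero]
  | succ n ih =>
    obtain ⟨h1, h2, h3⟩ := ih
    rw [sqrtApprox_succ]
    set A := sqrtApprox c L n
    set b := (2 * c)⁻¹ • (A * A - L).coeff (1 - n) with hb
    have hB : ∀ k, -(n : ℤ) < k → (mono (-n) b).coeff k = 0 := fun k hk => by
      rw [coeff_mono, if_neg (by omega)]
    refine ⟨?_, fun k hk => ?_, fun k hk => ?_⟩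
    · rw [coeff_sub, h1, hB _ (by omega), sub_zero]
    · rw [coeff_sub, h2 k hk, hB _ (by omega), sub_zero]
    · have e : (A - mono (-n) b) * (A - mono (-n) b) - L =
          (A * A - L) - A * mono (-n) b - mono (-n) b * A + mono (-n) b * mono (-n) b := by
        rw [sub_mul, mul_sub, mul_sub]
        abel
      rw [e, coeff_add, coeff_sub, coeff_sub, coeff_mul_eq_zero hB hB k (by push_cast at hk; omega),
        add_zero]
      rcases (show k = 1 - n ∨ 1 - (n : ℤ) < k by push_cast at hk; omega) with h | h
      · rw [coeff_mul_top h2 hB k (by omega), coeff_mul_top hB h2 k (by omega), h1, coeff_mono,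
          if_pos rfl, h, mul_comm b, ← Algebra.smul_def, hb, smul_smul, sub_sub, ← add_smul,
          show c * (2 * c)⁻¹ + c * (2 * c)⁻¹ = 1 by field_simp; norm_num, one_smul, sub_self]
      · rw [h3 k h, coeff_mul_eq_zero h2 hB k (by omega), coeff_mul_eq_zero hB h2 k (by omega)]
        simp

omit [CharZero K] in
theorem coeff_sqrtApprox (c : K) (L : PDO R) {n m : ℕ} (hnm : n ≤ m) (k : ℤ) (hk : -(n : ℤ) < k) :
    (sqrtApprox c L m).coeff k = (sqrtApprox c L n).coeff k := by
  induction m, hnm using Nat.le_induction with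
  | base => rfl
  | succ m hm ih => rw [sqrtApprox_succ, coeff_sub, ih, coeff_mono, if_neg (by omega), sub_zero]

/-- A monic operator of order two, up to a constant, has a square root. -/
theorem exists_sqrt {c : K} (hc : c ≠ 0) {L : PDO R} (h0 : (algebraMap K R c)′ = 0)
    (hL2 : L.coeff 2 = algebraMap K R (c ^ 2)) (hL : ∀ k, 2 < k → L.coeff k = 0) :
    ∃ A : PDO R, A * A = L ∧ A.coeff 1 = algebraMap K R c ∧ ∀ k, 1 < k → A.coeff k = 0 := by
  have hs := sqrtApprox_spec hc h0 hL2 hL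
  let A : PDO R := ⟨fun k => (sqrtApprox c L (1 - k).toNat).coeff k, 1, fun k hk => (hs _).2.1 k hk⟩
  have hAk : ∀ (n : ℕ) (k : ℤ), -(n : ℤ) < k → A.coeff k = (sqrtApprox c L n).coeff k := by
    intro n k hk
    change (sqrtApprox c L (1 - k).toNat).coeff k = _
    rcases le_total (1 - k).toNat n with h | h
    · exact (coeff_sqrtApprox c L h k (by omega)).symm
    · exact coeff_sqrtApprox c L h k hk
  have hA : ∀ k, 1 < k → A.coeff k = 0 := fun k hk => (hs _).2.1 k hk
  refine ⟨A, PDO.ext fun k => ?_, (hAk 0 1 (by omega)).trans (hs 0).1, hA⟩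
  set n := (3 - k).toNat
  rw [coeff_mul_congr_right hA k (B' := sqrtApprox c L n) fun j hj => hAk n j (by omega),
    coeff_mul_congr_left (hs n).2.1 k (A' := sqrtApprox c L n) fun j hj => hAk n j (by omega)]
  exact sub_eq_zero.mp ((coeff_sub _ _ _).symm.trans ((hs n).2.2 k (by omega)))

end Sqrt

section Conj

variable {R : Type*} [CommRing R] [Differential R]

/-- For `p = 1 + p₁ ∂⁻¹ + …`, the differential part of `p ∂² p⁻¹` is `∂² - 2 p₁′`. -/
theorem coeff_conj_sq {p q : PDO R} (hpq : p * q = 1) (hp0 : p.coeff 0 = 1)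
    (hp : ∀ k, 0 < k → p.coeff k = 0) (hq0 : q.coeff 0 = 1) (hq : ∀ k, 0 < k → q.coeff k = 0)
    (k : ℤ) (hk : 0 ≤ k) : (p * mono 2 1 * q).coeff k =
      if k = 2 then 1 else if k = 0 then -(2 * (p.coeff (-1))′) else 0 := by
  set D : PDO R := mono 1 1 with hD
  have hDD : mono 2 1 = D * D := (mono_mul_mono_one 1 1 1).symm
  set X := p * mono 2 1 - mono 2 1 * p with hX
  have hXk : ∀ k, X.coeff k = -(2 * (p.coeff (k - 1))′ + (p.coeff k)′′) := by
    intro k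
    rw [hX, coeff_sub, coeff_mul_mono_one, hDD, mul_assoc, coeff_D_mul, coeff_D_mul, coeff_D_mul,
      show k - 1 - 1 = k - 2 by ring, map_add]
    ring
  have hone : (1 : R)′ = 0 := deriv_one
  have hX0 : ∀ k, 0 < k → X.coeff k = 0 := by
    intro k hk
    rw [hXk, hp k hk]
    rcases (show k = 1 ∨ 1 < k by omega) with h | h
    · rw [h, sub_self, hp0, hone]; simp
    · rw [hp _ (by omega)]; simp
  have e : p * mono 2 1 * q = mono 2 1 + X * q := by
    rw [hX, sub_mul, mul_assoc (mono 2 1), hpq, mul_one]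
    abel
  rw [e, coeff_add, coeff_mono]
  rcases hk.eq_or_lt with h | h
  · rw [← h, if_neg (by omega), if_neg (by omega), if_pos rfl, zero_add,
      coeff_mul_top hX0 hq 0 (by omega), hq0, mul_one, hXk, hp0, hone, map_zero, add_zero]
    rfl
  · rw [coeff_mul_eq_zero hX0 hq k (by omega), add_zero, if_neg (c := k = 0) (by omega)]

theorem coeff_conj_D {p q : PDO R} (hp0 : p.coeff 0 = 1)
    (hp : ∀ k, 0 < k → p.coeff k = 0) (hq0 : q.coeff 0 = 1) (hq : ∀ k, 0 < k → q.coeff k = 0)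
    (k : ℤ) (hk : 1 ≤ k) : (p * mono 1 1 * q).coeff k = if k = 1 then 1 else 0 := by
  have h1 : ∀ k, 1 < k → (p * mono 1 1).coeff k = 0 := fun k hk => by
    rw [coeff_mul_mono_one, hp _ (by omega)]
  rcases hk.eq_or_lt with h | h
  · rw [← h, coeff_mul_top h1 hq 1 (by omega), coeff_mul_mono_one, sub_self, hp0, hq0, one_mul,
      if_pos rfl]
  · rw [coeff_mul_eq_zero h1 hq k (by omega), if_neg (by omega)]

end Conj

end PDO

/-! ### Two-point functions as differential polynomials -/

section ChainRule

variable {K σ R : Type*} [Field K] [CommRing R] [Algebra K R]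

/-- Induction for first order differentials of polynomials: a relation between polynomials and
values which is additive and obeys the Leibniz rule for multiplication by a variable holds between
`F` and `∑_v ∂F/∂X_v(x) z_v`. -/
theorem mvPolynomial_chain_induction (x z : σ → R) {p : MvPolynomial σ K → R → Prop}
    (hC : ∀ c, p (MvPolynomial.C c) 0) (hadd : ∀ F G a b, p F a → p G b → p (F + G) (a + b))
    (hX : ∀ F a n, p F a → p (F * MvPolynomial.X n) (a * x n + MvPolynomial.aeval x F * z n))
    (F : MvPolynomial σ K) {t : Finset σ} (ht : F.vars ⊆ t) :
    p F (∑ v ∈ t, MvPolynomial.aeval x (MvPolynomial.pderiv v F) * z v) := by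
  classical
  -- all sufficiently large sets of summation are admitted, as `vars` need not grow in the induction
  suffices h : ∃ t₀ : Finset σ, ∀ t, t₀ ⊆ t →
      p F (∑ v ∈ t, MvPolynomial.aeval x (MvPolynomial.pderiv v F) * z v) by
    obtain ⟨t₀, h⟩ := h
    have h1 := h (t₀ ∪ t) subset_union_left
    rwa [← sum_subset subset_union_right fun v _ hv => by
      rw [MvPolynomial.pderiv_eq_zero_of_notMem_vars fun h => hv (ht h), map_zero, zero_mul]] at h1
  clear ht
  induction F using MvPolynomial.induction_on with
  | C c => exact ⟨∅, fun t _ => by simpa using hC c⟩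
  | add F G hF hG =>
    obtain ⟨t₁, h1⟩ := hF
    obtain ⟨t₂, h2⟩ := hG
    refine ⟨t₁ ∪ t₂, fun t ht => ?_⟩
    have := hadd _ _ _ _ (h1 t (subset_union_left.trans ht)) (h2 t (subset_union_right.trans ht))
    simpa only [map_add, add_mul, sum_add_distrib] using this
  | mul_X F n hF =>
    obtain ⟨t₁, h1⟩ := hF
    refine ⟨insert n t₁, fun t ht => ?_⟩
    have := hX _ _ n (h1 t ((subset_insert _ _).trans ht))
    convert this using 1
    rw [sum_mul]
    have e : ∀ v ∈ t, MvPolynomial.aeval x (MvPolynomial.pderiv v (F * MvPolynomial.X n)) * z v =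
        MvPolynomial.aeval x (MvPolynomial.pderiv v F) * z v * x n +
          if v = n then MvPolynomial.aeval x F * z n else 0 := by
      intro v _
      rw [Derivation.leibniz, MvPolynomial.pderiv_X, map_add, smul_eq_mul, smul_eq_mul, map_mul,
        map_mul, MvPolynomial.aeval_X, Pi.single_apply]
      split_ifs with h h' h'
      · subst h; rw [map_one]; ring
      · exact absurd h.symm h'
      · exact absurd h'.symm h
      · rw [map_zero]; ring
    rw [sum_congr rfl e, sum_add_distrib, sum_ite_eq' t n, if_pos (ht (mem_insert_self n t₁))]

/-- The chain rule for a derivation and a polynomial. -/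
theorem derivation_aeval (d : R →+ R) (hd : ∀ a b, d (a * b) = a * d b + b * d a)
    (hK : ∀ c : K, d (algebraMap K R c) = 0) (x : σ → R) (F : MvPolynomial σ K) {t : Finset σ}
    (ht : F.vars ⊆ t) : d (MvPolynomial.aeval x F) =
      ∑ v ∈ t, MvPolynomial.aeval x (MvPolynomial.pderiv v F) * d (x v) := by
  refine mvPolynomial_chain_induction x (fun v => d (x v))
    (p := fun F a => d (MvPolynomial.aeval x F) = a) ?_ ?_ ?_ F ht
  · intro c
    rw [MvPolynomial.aeval_C, hK]
  · intro F G a b h1 h2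
    rw [map_add, map_add, h1, h2]
  · intro F a n h
    rw [map_mul, MvPolynomial.aeval_X, hd, h]
    ring

theorem vars_pderiv_subset (v : σ) (F : MvPolynomial σ K) :
    (MvPolynomial.pderiv v F).vars ⊆ F.vars := by
  classical
  intro w hw
  by_contra h
  rw [MvPolynomial.mem_vars_iff_mem_support] at hw
  obtain ⟨m, hm, hw⟩ := hw
  rw [MvPolynomial.mem_support_iff] at hm
  apply hm
  rw [MvPolynomial.coeff_pderiv]
  have : MvPolynomial.coeff (m + Finsupp.single v 1) F = 0 := by
    by_contra h0
    refine h ((MvPolynomial.mem_vars_iff_mem_support w).mpr ⟨_, MvPolynomial.mem_support_iff.mpr h0, ?_⟩)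
    rw [Finsupp.mem_support_iff] at hw ⊢
    rw [Finsupp.add_apply]
    omega
  rw [this]; simp

end ChainRule

section Lax

variable {K : Type*} [Field K] {ι S : Type*} [CommRing S] [Algebra K S]

theorem dx_one : dx (1 : Fun ι S) = 0 := PDO.deriv_one

theorem dx_zero : dx (0 : Fun ι S) = 0 := map_zero dxHom

theorem dx_algebraMap (c : K) : dx (algebraMap K (Fun ι S) c) = 0 := by
  rw [Algebra.algebraMap_eq_smul_one, dx_smul, dx_one, smul_zero]

theorem toOp_mono (s : K) (n : ℤ) :
    toOp (PDO.mono n (algebraMap K (Fun ι S) (s ^ n))) = sd s n := op_ext fun k => by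
  rw [coeffD_toOp, PDO.coeff_mono, coeffD_sd, smul_ite, smul_zero, Algebra.algebraMap_eq_smul_one]

theorem PDO.mul_mono_mul {R : Type*} [CommRing R] [Differential R] (p q : PDO R) {a : R}
    (ha : a′ = 0) (n : ℤ) :
    p * PDO.mono n a * q = PDO.mono 0 a * (p * PDO.mono n 1 * q) := by
  have h : p * PDO.mono 0 a = PDO.mono 0 a * p := PDO.ext fun k => by
    rw [PDO.coeff_mul_mono _ _ ha, PDO.coeff_mono_zero_mul, sub_zero, mul_comm]
  rw [← mul_assoc, ← mul_assoc, ← h, mul_assoc p (PDO.mono 0 a), PDO.mono_zero_mul_mono, mul_one]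

/-- The powers of the Lax operator as operators of bounded order. -/
theorem laxHalfPow_eq_toOp (s : K) {T : Fun ι S} {α : ι} {p q : PDO (Fun ι S)}
    (hp : dressing s T α = toOp p) (hq : Ring.inverse (dressing s T α) = toOp q) (n : ℤ) :
    laxHalfPow s T α n = toOp (p * PDO.mono n (algebraMap K (Fun ι S) (s ^ n)) * q) := by
  rw [laxHalfPow, hq, hp, map_mul, map_mul, toOp_mono]

/-- The differential part of the Lax operator. -/
theorem coeffD_laxHalfPow_two (s : K) {T : Fun ι S} (hT : IsUnit T) (α : ι) {k : ℤ} (hk : 0 ≤ k) :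
    coeffD k (laxHalfPow s T α 2) = (s ^ 2) •
      if k = 2 then 1 else if k = 0 then -(2 * dx (coeffD (-1) (dressing s T α))) else 0 := by
  obtain ⟨p, q, hp, hq, hpq, -, hp0, hp1, hq0, hq1⟩ := exists_dressing_inverse s hT α
  rw [laxHalfPow_eq_toOp s hp hq, coeffD_toOp, PDO.mul_mono_mul _ _ (dx_algebraMap _),
    PDO.coeff_mono_zero_mul, PDO.coeff_conj_sq hpq hp0 hp1 hq0 hq1 k hk, hp, coeffD_toOp, deriv_fun,
    ← Algebra.smul_def, zpow_ofNat]

theorem potential_eq [CharZero K] {s : K} (hs : s ≠ 0) {T : Fun ι S} (hT : IsUnit T) (α : ι) :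
    potential s T α = (s ^ 2) • dx (logDeriv T (α, 0)) := by
  have h : dx (-logDeriv T (α, 0)) = -dx (logDeriv T (α, 0)) := map_neg dxHom _
  rw [potential, coeffD_laxHalfPow_two s hT α le_rfl, if_neg (by omega), if_pos rfl,
    coeffD_dressing_neg_one hs, h, mul_neg, neg_neg, two_mul, ← two_smul K, smul_comm (2⁻¹ : K),
    smul_smul (2⁻¹ : K), inv_mul_cancel₀ two_ne_zero, one_smul]

theorem laxHalfPow_one_pow {s : K} (hs : s ≠ 0) {T : Fun ι S} (hT : IsUnit T) (α : ι) (n : ℕ) :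
    laxHalfPow s T α 1 ^ n = laxHalfPow s T α n := by
  induction n with
  | zero =>
    rw [pow_zero, laxHalfPow, Nat.cast_zero, sd_zero, mul_one, dressing_mul_inverse s hT]
  | succ n ih =>
    rw [pow_succ, ih, laxHalfPow, laxHalfPow, laxHalfPow, Nat.cast_succ, ← sd_mul_sd hs,
      mul_assoc _ (Ring.inverse _), ← mul_assoc (Ring.inverse _), ← mul_assoc (Ring.inverse _),
      inverse_mul_dressing s hT, one_mul]
    simp only [mul_assoc]

end Lax

section DifferentialPolynomial

variable {K : Type*} [Field K] [CharZero K]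

/-- The universal square root is a choice among the operators with these properties, so that their
existence has to be shown. -/
theorem univSqrt_spec {s : K} (hs : s ≠ 0) : univSqrt s * univSqrt s = univLax s ∧
    (univSqrt s).coeff 1 = MvPolynomial.C s ∧ ∀ k, 1 < k → (univSqrt s).coeff k = 0 := by
  refine Classical.epsilon_spec (p := fun A : PDO (MvPolynomial ℕ K) => A * A = univLax s ∧
    A.coeff 1 = MvPolynomial.C s ∧ ∀ k, 1 < k → A.coeff k = 0) (PDO.exists_sqrt hs ?_ ?_ ?_)
  · exact (totalDeriv K).map_algebraMap s
  · rw [univLax, PDO.coeff_add, PDO.coeff_mono, PDO.coeff_mono, if_pos rfl, if_neg (by omega),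
      add_zero]
    rfl
  · intro k hk
    rw [univLax, PDO.coeff_add, PDO.coeff_mono, PDO.coeff_mono, if_neg (by omega),
      if_neg (by omega), add_zero]

variable {ι : Type*}

omit [CharZero K] in
/-- Substitution of the jets of a function is a homomorphism of differential rings. -/
theorem aeval_jet_deriv (u : Fun ι K) (F : MvPolynomial ℕ K) :
    MvPolynomial.aeval (fun n => dx^[n] u) F′ = (MvPolynomial.aeval (fun n => dx^[n] u) F)′ := by
  change MvPolynomial.aeval _ (totalDeriv K F) = dx _
  induction F using MvPolynomial.induction_on with
  | C c =>
    rw [show totalDeriv K (MvPolynomial.C c) = 0 from (totalDeriv K).map_algebraMap c, map_zero,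
      MvPolynomial.aeval_C, dx_algebraMap]
  | add F G hF hG => rw [map_add, map_add, map_add, hF, hG, dx_add]
  | mul_X F n hF =>
    rw [Derivation.leibniz, map_add, smul_eq_mul, smul_eq_mul, map_mul, map_mul, hF, map_mul,
      dx_mul,
      totalDeriv, MvPolynomial.mkDerivation_X, MvPolynomial.aeval_X, MvPolynomial.aeval_X,
      Function.iterate_succ_apply']

/-- If the Lax operator is a differential operator, then it is `ħ∂² + 2u`, its square root is
obtained from the universal one, and so are the residues of its half-integer powers. -/
theorem aeval_omegaPoly {s : K} (hs : s ≠ 0) {T : Fun ι K} (hT : IsUnit T) {α : ι}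
    (hL : IsDiffOp (laxHalfPow s T α 2)) (n : ℕ) :
    MvPolynomial.aeval (fun n => dx^[n] (potential s T α)) (omegaPoly s n) =
      (s * ca K n) • res (laxHalfPow s T α (2 * n + 1)) := by
  obtain ⟨p, q, hp, hq, hpq, -, hp0, hp1, hq0, hq1⟩ := exists_dressing_inverse s hT α
  obtain ⟨hA, hA1, hA0⟩ := univSqrt_spec hs
  set u := potential s T α with hu
  set φ : MvPolynomial ℕ K →+* Fun ι K :=
    (MvPolynomial.aeval (R := K) fun n => dx^[n] u).toRingHom with hφ
  set Θ := PDO.mapHom φ (aeval_jet_deriv u) with hΘ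
  set y := p * PDO.mono 1 (algebraMap K (Fun ι K) (s ^ (1 : ℤ))) * q with hy
  have hyop : laxHalfPow s T α 1 = toOp y := laxHalfPow_eq_toOp s hp hq 1
  have hyk : ∀ k, 1 ≤ k → y.coeff k = if k = 1 then algebraMap K (Fun ι K) s else 0 := by
    intro k hk
    rw [hy, PDO.mul_mono_mul _ _ (dx_algebraMap _), PDO.coeff_mono_zero_mul,
      PDO.coeff_conj_D hp0 hp1 hq0 hq1 k hk, zpow_one, mul_ite, mul_one, mul_zero]
  have hyy : ∀ k, (y * y).coeff k = coeffD k (laxHalfPow s T α 2) := by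
    intro k
    rw [← Nat.cast_two, ← laxHalfPow_one_pow hs hT, hyop, ← map_pow, coeffD_toOp, pow_two]
  have hA' : Θ (univSqrt s) = y := by
    refine PDO.eq_of_mul_self_eq hs ?_ ?_ ?_ ?_ ?_
    · rw [PDO.coeff_mapHom, hA1]
      exact MvPolynomial.aeval_C _ _
    · intro k hk
      rw [PDO.coeff_mapHom, hA0 k hk, map_zero]
    · rw [hyk 1 le_rfl, if_pos rfl]
    · intro k hk
      rw [hyk k hk.le, if_neg (by omega)]
    · rw [← map_mul, hA]
      refine PDO.ext fun k => ?_
      rw [hyy, PDO.coeff_mapHom, univLax, PDO.coeff_add, PDO.coeff_mono, PDO.coeff_mono, map_add]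
      rcases lt_or_ge k 0 with hk | hk
      · rw [hL k hk, if_neg (by omega), if_neg (by omega), map_zero, add_zero]
      · by_cases h0 : k = 0
        · have h2 : coeffD 0 (laxHalfPow s T α 2) = (2 : K) • u := by
            rw [hu, potential, smul_smul, mul_inv_cancel₀ two_ne_zero, one_smul]
          rw [h0, h2, if_neg (by omega), if_pos rfl, map_zero, zero_add, map_mul, map_ofNat,
            two_smul, two_mul]
          have hX : φ (MvPolynomial.X 0) = u := MvPolynomial.aeval_X _ _
          rw [hX]
        · rw [coeffD_laxHalfPow_two s hT α hk, if_neg h0, if_neg h0, map_zero, add_zero]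
          split_ifs
          · change MvPolynomial.aeval _ (MvPolynomial.C (s ^ 2)) = _
            rw [MvPolynomial.aeval_C, Algebra.algebraMap_eq_smul_one]
          · rw [map_zero, smul_zero]
  rw [omegaPoly, map_smul, res, show (2 * (n : ℤ) + 1) = ((2 * n + 1 : ℕ) : ℤ) by push_cast; rfl,
    ← laxHalfPow_one_pow hs hT, hyop, ← map_pow, coeffD_toOp, ← hA', ← map_pow]
  rfl

variable [Fintype ι] [DecidableEq ι]

/-- The two-point functions `Ω_{α,0;β,p}` of several copies of KdV are differential polynomials. -/
theorem evalJet_omegaMulti {s : K} (hs : s ≠ 0) {τ : ι → MvPowerSeries ℕ K}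
    (hτ : ∀ γ, IsKdVTau s (τ γ)) (α β : ι) (p : ℕ) :
    evalJet (potential s (shift K (prodTau τ))) (omegaMulti s α β p) =
      twoPoint s (shift K (prodTau τ)) (α, 0) (β, p) := by
  have hT := isUnit_shift_prodTau hτ
  obtain ⟨⟨B, hB, hBP⟩, hL⟩ := exists_satoWilson hs hτ α
  have hneg : ∀ A : Op ι K, res (-A) = -res A := fun A => coeffD_neg _ _
  have hsm : ∀ (c : K) (A : Op ι K), res (c • A) = c • res A := fun c A => coeffD_smul _ _ _
  have hm : ∀ A : Op ι K, res (minus A) = res A := fun A => by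
    rw [res, coeffD_minus, if_neg (by omega), res]
  rw [twoPoint_eq_res hs hT, pderivFun_dressing_mul_inverse hT (hB _) (hBP _), hneg, hsm, hm,
    smul_neg,
    neg_neg, smul_smul, omegaMulti]
  by_cases h : α = β
  · subst h
    rw [if_pos rfl, if_pos rfl, evalJet, MvPolynomial.aeval_rename]
    change MvPolynomial.aeval (fun n => dx^[n] (potential s (shift K (prodTau τ)) α)) _ = _
    rw [aeval_omegaPoly hs hT hL]
    congr 1
    field_simp
  · rw [if_neg h, if_neg (Ne.symm h), mul_zero, zero_smul, evalJet, map_zero]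

end DifferentialPolynomial

/-! ### The second order operator `T⁻¹ r̂ T` -/

section TimeSum

variable {K : Type*} [Field K] {ι : Type*}

/-- `∂/∂q_v` as a linear map. -/
noncomputable def pderivLin (v : ι × ℕ) : Fun ι K →ₗ[K] Fun ι K where
  toFun f := MvPowerSeries.pderivFun v f
  map_add' f g := MvPowerSeries.pderivFun_add f g
  map_smul' c f := pderivFun_smul v c f

/-- `∂_x^n` as a linear map. -/
noncomputable def dxLin (n : ℕ) : Fun ι K →ₗ[K] Fun ι K where
  toFun f := dx^[n] f
  map_add' f g := by
    induction n generalizing f g with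
    | zero => rfl
    | succ n ih => rw [Function.iterate_succ_apply, dx_add, ih]; rfl
  map_smul' c f := by
    induction n generalizing f with
    | zero => rfl
    | succ n ih => rw [Function.iterate_succ_apply, dx_smul, ih]; rfl

theorem pderivLin_apply (v : ι × ℕ) (f : Fun ι K) : pderivLin v f = MvPowerSeries.pderivFun v f :=
    rfl

theorem dxLin_apply (n : ℕ) (f : Fun ι K) : dxLin n f = dx^[n] f := rfl

theorem pderivLin_mul (v : ι × ℕ) (f g : Fun ι K) :
    pderivLin v (f * g) = pderivLin v f * g + f * pderivLin v g := pderivFun_mul v f g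

theorem pderivLin_comm (v w : ι × ℕ) (f : Fun ι K) :
    pderivLin v (pderivLin w f) = pderivLin w (pderivLin v f) := pderivFun_comm v w f

theorem dxLin_add (n m : ℕ) (f : Fun ι K) : dxLin n (dxLin m f) = dxLin (n + m) f :=
  (Function.iterate_add_apply dx n m f).symm

theorem pderivFun_dx (v : ι × ℕ) (f : Fun ι K) :
    MvPowerSeries.pderivFun v (dx f) = dx (MvPowerSeries.pderivFun v f) :=
  MvPowerSeries.ext fun m => by
    rw [MvPowerSeries.coeff_pderivFun, coeff_dx, coeff_dx, MvPowerSeries.coeff_pderivFun,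
      ← Nat.cast_add_one, ← nsmul_eq_mul', ← nsmul_eq_mul', map_nsmul]

theorem pderivLin_dxLin (v : ι × ℕ) (n : ℕ) (f : Fun ι K) :
    pderivLin v (dxLin n f) = dxLin n (pderivLin v f) := by
  induction n generalizing f with
  | zero => rfl
  | succ n ih =>
    rw [← dxLin_add n 1, ih, ← dxLin_add n 1]
    congr 1
    exact pderivFun_dx v f

theorem dxLin_mul (n : ℕ) (f g : Fun ι K) :
    dxLin n (f * g) = ∑ k ∈ range (n + 1), (n.choose k : K) • (dxLin k f * dxLin (n - k) g) := by
  have h := PDO.iter_mul n f g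
  rw [Finset.Nat.sum_antidiagonal_eq_sum_range_succ_mk] at h
  simp only [Nat.cast_smul_eq_nsmul]
  exact h

theorem fsumCompat_dx : FsumCompat (fun f : Fun ι K => dx f) :=
  fsumCompat_of_coeff fun m => ⟨{m},
    fun _ => (PowerSeries.derivative K).toLinearMap.toAddMonoidHom, fun f => by
      rw [sum_singleton]; rfl⟩

theorem fsum_eq_single {σ R : Type*} [Ring R] {g : ℕ → MvPowerSeries σ R} (n : ℕ)
    (h : ∀ i, i ≠ n → g i = 0) : fsum g = g n :=
  MvPowerSeries.ext fun m => by
    rw [coeff_fsum]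
    exact finsum_eq_single _ n fun i hi => by rw [h i hi, map_zero]

variable [CharZero K]

theorem pderivLin_fsum_time [DecidableEq ι] (w : ι × ℕ) (μ : ι) (g : ℕ → Fun ι K) :
    pderivLin w (fsum fun i => time K μ i * g i) =
      (if μ = w.1 then g w.2 else 0) + fsum fun i => time K μ i * pderivLin w (g i) := by
  have h1 : pderivLin w (fsum fun i => time K μ i * g i) =
      fsum fun i => MvPowerSeries.pderivFun w (time K μ i * g i) :=
    (fsumCompat_pderivFun w).eq (locFin_time_mul μ g)
  have h2 : ∀ i, MvPowerSeries.pderivFun w (time K μ i * g i) =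
      (if w = (μ, i) then g i else 0) + time K μ i * pderivLin w (g i) := by
    intro i
    rw [pderivFun_mul, pderivFun_time]
    split_ifs
    · rw [map_one, one_mul]; rfl
    · rw [map_zero, zero_mul]; rfl
  have h3 : LocFin fun i => if w = (μ, i) then g i else 0 := fun m =>
    (Set.finite_singleton w.2).subset fun i hi => by
      by_contra h
      refine hi ?_
      dsimp only
      rw [if_neg, map_zero]
      rintro rfl
      exact h rfl
  rw [h1]
  simp only [h2]
  rw [fsum_add h3 (locFin_time_mul μ _), fsum_eq_single w.2]
  · congr 1
    exact if_congr (by rw [Prod.ext_iff]; simp [eq_comm]) rfl rfl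
  · intro i hi
    rw [if_neg]
    rintro rfl
    exact hi rfl

omit [CharZero K] in
theorem dx_time (μ : ι) (i : ℕ) : dx (time K μ i) = if i = 0 then 1 else 0 := by
  classical
  have h1 : dx (MvPowerSeries.X (μ, i) : Fun ι K) = 0 := MvPowerSeries.ext fun m => by
    rw [coeff_dx, MvPowerSeries.coeff_X, map_zero]
    split_ifs
    · exact PDO.deriv_one
    · exact map_zero _
  rw [time, dx_add, h1, zero_add]
  split_ifs with h
  · refine MvPowerSeries.ext fun m => ?_
    rw [coeff_dx, MvPowerSeries.coeff_C, MvPowerSeries.coeff_one]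
    split_ifs
    · exact PowerSeries.derivative_X
    · exact map_zero _
  · exact dx_zero

theorem dx_fsum_time (μ : ι) (g : ℕ → Fun ι K) :
    dxLin 1 (fsum fun i => time K μ i * g i) =
      g 0 + fsum fun i => time K μ i * dxLin 1 (g i) := by
  have h1 : dxLin 1 (fsum fun i => time K μ i * g i) = fsum fun i => dx (time K μ i * g i) :=
    fsumCompat_dx.eq (locFin_time_mul μ g)
  have h2 : ∀ i, dx (time K μ i * g i) =
      (if i = 0 then g i else 0) + time K μ i * dxLin 1 (g i) := by
    intro i
    rw [dx_mul, dx_time, add_comm]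
    split_ifs
    · rw [mul_one]; rfl
    · rw [mul_zero]; rfl
  have h3 : LocFin fun i => if i = 0 then g i else 0 := fun m =>
    (Set.finite_singleton 0).subset fun i hi => by
      by_contra h
      refine hi ?_
      dsimp only
      rw [if_neg (c := i = 0) (fun h0 => h h0), map_zero]
  rw [h1]
  simp only [h2]
  rw [fsum_add h3 (locFin_time_mul μ _), fsum_eq_single 0 (fun i hi => if_neg hi), if_pos rfl]

variable [Fintype ι]

/-- `∑_{μ,ν} r_{μν} ∑_i q_{μ,i} g_{ν,ℓ+i}`. -/
noncomputable def timeSum (ℓ : ℕ) (r : Matrix ι ι K) (g : ι × ℕ → Fun ι K) : Fun ι K :=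
  ∑ μ, ∑ ν, r μ ν • fsum fun i => time K μ i * g (ν, ℓ + i)

theorem timeSum_add (ℓ : ℕ) (r : Matrix ι ι K) (g h : ι × ℕ → Fun ι K) :
    timeSum ℓ r (fun v => g v + h v) = timeSum ℓ r g + timeSum ℓ r h := by
  simp only [timeSum, ← sum_add_distrib, ← smul_add]
  refine sum_congr rfl fun μ _ => sum_congr rfl fun ν _ => ?_
  rw [← fsum_add (locFin_time_mul μ _) (locFin_time_mul μ _)]
  simp only [mul_add]

theorem timeSum_mul (ℓ : ℕ) (r : Matrix ι ι K) (f : Fun ι K) (g : ι × ℕ → Fun ι K) :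
    timeSum ℓ r (fun v => f * g v) = f * timeSum ℓ r g := by
  simp only [timeSum, mul_sum, mul_smul_comm]
  refine sum_congr rfl fun μ _ => sum_congr rfl fun ν _ => ?_
  rw [(fsumCompat_mulLeft f).eq (locFin_time_mul μ _)]
  simp only [mul_left_comm f]

theorem timeSum_smul (ℓ : ℕ) (r : Matrix ι ι K) (c : K) (g : ι × ℕ → Fun ι K) :
    timeSum ℓ r (fun v => c • g v) = c • timeSum ℓ r g := by
  have := timeSum_mul ℓ r (c • (1 : Fun ι K)) g
  simpa only [smul_mul_assoc, one_mul] using this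

theorem pderivLin_timeSum [DecidableEq ι] (ℓ : ℕ) (r : Matrix ι ι K) (w : ι × ℕ)
    (g : ι × ℕ → Fun ι K) : pderivLin w (timeSum ℓ r g) =
      ∑ ν, r w.1 ν • g (ν, ℓ + w.2) + timeSum ℓ r fun v => pderivLin w (g v) := by
  simp only [timeSum, map_sum, map_smul, pderivLin_fsum_time, smul_add, sum_add_distrib, smul_ite,
    smul_zero]
  congr 1
  rw [sum_comm]
  refine sum_congr rfl fun ν _ => ?_
  rw [sum_ite_eq' univ w.1, if_pos (mem_univ _)]

theorem dxLin_timeSum (ℓ : ℕ) (r : Matrix ι ι K) (g : ι × ℕ → Fun ι K) :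
    dxLin 1 (timeSum ℓ r g) =
      ∑ μ, ∑ ν, r μ ν • g (ν, ℓ) + timeSum ℓ r fun v => dxLin 1 (g v) := by
  simp only [timeSum, map_sum, map_smul, dx_fsum_time, smul_add, sum_add_distrib, add_zero]

end TimeSum

section QuadSum

variable {K : Type*} [Field K] {ι : Type*} [Fintype ι]

/-- `∑_{i+j=ℓ-1} (-1)^{i+1} ∑_{μ,ν} r_{μν} g_{μ,i;ν,j}`. -/
noncomputable def quadSum (ℓ : ℕ) (r : Matrix ι ι K) (g : ι × ℕ → ι × ℕ → Fun ι K) : Fun ι K :=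
  ∑ i ∈ range ℓ, ∑ μ, ∑ ν, ((-1) ^ (i + 1) * r μ ν) • g (μ, i) (ν, ℓ - 1 - i)

theorem quadSum_add (ℓ : ℕ) (r : Matrix ι ι K) (g h : ι × ℕ → ι × ℕ → Fun ι K) :
    quadSum ℓ r (fun a b => g a b + h a b) = quadSum ℓ r g + quadSum ℓ r h := by
  simp only [quadSum, smul_add, sum_add_distrib]

theorem quadSum_smul (ℓ : ℕ) (r : Matrix ι ι K) (c : K) (g : ι × ℕ → ι × ℕ → Fun ι K) :
    quadSum ℓ r (fun a b => c • g a b) = c • quadSum ℓ r g := by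
  simp only [quadSum, smul_sum, smul_comm c]

theorem quadSum_mul (ℓ : ℕ) (r : Matrix ι ι K) (f : Fun ι K) (g : ι × ℕ → ι × ℕ → Fun ι K) :
    quadSum ℓ r (fun a b => f * g a b) = f * quadSum ℓ r g := by
  simp only [quadSum, mul_sum, mul_smul_comm]

theorem quadSum_sum {A : Type*} (ℓ : ℕ) (r : Matrix ι ι K) (t : Finset A)
    (g : A → ι × ℕ → ι × ℕ → Fun ι K) :
    quadSum ℓ r (fun a b => ∑ x ∈ t, g x a b) = ∑ x ∈ t, quadSum ℓ r (g x) := by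
  classical
  induction t using Finset.induction_on with
  | empty => simp [quadSum]
  | insert x t hx ih => simp only [sum_insert hx, quadSum_add, ih]

theorem map_quadSum (L : Fun ι K →ₗ[K] Fun ι K) (ℓ : ℕ) (r : Matrix ι ι K)
    (g : ι × ℕ → ι × ℕ → Fun ι K) :
    L (quadSum ℓ r g) = quadSum ℓ r fun a b => L (g a b) := by
  simp only [quadSum, map_sum, map_smul]

/-- The symmetry of `r` makes the quadratic form symmetric. -/
theorem quadSum_swap {ℓ : ℕ} {r : Matrix ι ι K} (hr : ∀ α β, r α β = (-1) ^ (ℓ + 1) * r β α)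
    (g : ι × ℕ → ι × ℕ → Fun ι K) : quadSum ℓ r g = quadSum ℓ r fun a b => g b a := by
  rw [quadSum, quadSum, ← sum_range_reflect]
  refine sum_congr rfl fun i hi => ?_
  rw [mem_range] at hi
  rw [sum_comm]
  refine sum_congr rfl fun ν _ => sum_congr rfl fun μ _ => ?_
  rw [show ℓ - 1 - (ℓ - 1 - i) = i by omega, hr μ ν, ← mul_assoc,
    mul_comm ((-1) ^ _) ((-1) ^ (ℓ + 1)),
    neg_one_pow_add_eq hi]

end QuadSum

section SecondOrder

variable {K : Type*} [Field K] [CharZero K] {ι : Type*} [Fintype ι]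

/-- The operator `T⁻¹ r̂ T` without its terms of order zero, in terms of the logarithmic derivatives
`l_v = ∂_v log T`. -/
noncomputable def conjOp (s : K) (ℓ : ℕ) (r : Matrix ι ι K) (l : ι × ℕ → Fun ι K) (f : Fun ι K) :
    Fun ι K :=
  timeSum ℓ r (fun v => pderivLin v f) +
    (s ^ 2 / 2) • quadSum ℓ r (fun a b => pderivLin a (pderivLin b f)) +
    (s ^ 2) • quadSum ℓ r fun a b => pderivLin a f * l b

theorem conjOp_add (s : K) (ℓ : ℕ) (r : Matrix ι ι K) (l : ι × ℕ → Fun ι K) (f g : Fun ι K) :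
    conjOp s ℓ r l (f + g) = conjOp s ℓ r l f + conjOp s ℓ r l g := by
  simp only [conjOp, map_add, timeSum_add, quadSum_add, add_mul, smul_add]
  abel

theorem conjOp_smul (s : K) (ℓ : ℕ) (r : Matrix ι ι K) (l : ι × ℕ → Fun ι K) (c : K) (f : Fun ι K) :
    conjOp s ℓ r l (c • f) = c • conjOp s ℓ r l f := by
  simp only [conjOp, map_smul, timeSum_smul, quadSum_smul, smul_mul_assoc, smul_add, smul_comm c]

theorem conjOp_sum {A : Type*} (s : K) (ℓ : ℕ) (r : Matrix ι ι K) (l : ι × ℕ → Fun ι K)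
    (t : Finset A) (f : A → Fun ι K) :
    conjOp s ℓ r l (∑ x ∈ t, f x) = ∑ x ∈ t, conjOp s ℓ r l (f x) := by
  classical
  induction t using Finset.induction_on with
  | empty =>
    rw [sum_empty, sum_empty, ← zero_smul K (0 : Fun ι K), conjOp_smul, zero_smul, zero_smul]
  | insert x t hx ih => rw [sum_insert hx, sum_insert hx, conjOp_add, ih]

/-- Second derivatives of `r̂ T / T`. -/
theorem pderivLin_pderivLin_timeSum_add [DecidableEq ι] (s : K) {ℓ : ℕ} {r : Matrix ι ι K}
    (hr : ∀ α β, r α β = (-1) ^ (ℓ + 1) * r β α) {l : ι × ℕ → Fun ι K}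
    (hl : ∀ v w, pderivLin v (l w) = pderivLin w (l v)) (v w : ι × ℕ) :
    (s ^ 2) • pderivLin v (pderivLin w (timeSum ℓ r l +
        (s ^ 2 / 2) • quadSum ℓ r fun a b => pderivLin a (l b) + l a * l b)) =
      conjOp s ℓ r l ((s ^ 2) • pderivLin v (l w)) +
      ∑ ν, r w.1 ν • ((s ^ 2) • pderivLin v (l (ν, ℓ + w.2))) +
      ∑ ν, r v.1 ν • ((s ^ 2) • pderivLin (ν, ℓ + v.2) (l w)) +
      quadSum ℓ r fun a b => ((s ^ 2) • pderivLin v (l a)) * ((s ^ 2) • pderivLin b (l w)) := by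
  have e1 : pderivLin v (pderivLin w (timeSum ℓ r l)) =
      ∑ ν, r w.1 ν • pderivLin v (l (ν, ℓ + w.2)) +
      ∑ ν, r v.1 ν • pderivLin (ν, ℓ + v.2) (l w) +
      timeSum ℓ r fun a => pderivLin a (pderivLin v (l w)) := by
    rw [pderivLin_timeSum, map_add, map_sum]
    simp only [map_smul, hl w]
    rw [pderivLin_timeSum, add_assoc]
    simp only [pderivLin_comm v]
  have e2 : ∀ a b, pderivLin v (pderivLin w (pderivLin a (l b) + l a * l b)) =
      pderivLin a (pderivLin b (pderivLin v (l w))) +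
      (pderivLin a (pderivLin v (l w)) * l b + l a * pderivLin b (pderivLin v (l w))) +
      (pderivLin a (l w) * pderivLin v (l b) + pderivLin v (l a) * pderivLin b (l w)) := by
    intro a b
    rw [map_add, map_add, pderivLin_comm w a, hl w b, pderivLin_comm v a, pderivLin_comm v b,
      pderivLin_mul, hl w a, hl w b, map_add, pderivLin_mul, pderivLin_mul, pderivLin_comm v a,
      pderivLin_comm v b]
    ring
  have e3 : quadSum ℓ r (fun a b => l a * pderivLin b (pderivLin v (l w))) =
      quadSum ℓ r fun a b => pderivLin a (pderivLin v (l w)) * l b := by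
    rw [quadSum_swap hr]
    simp only [mul_comm]
  have e4 : quadSum ℓ r (fun a b => pderivLin a (l w) * pderivLin v (l b)) =
      quadSum ℓ r fun a b => pderivLin v (l a) * pderivLin b (l w) := by
    rw [quadSum_swap hr]
    simp only [mul_comm]
  rw [map_add, map_add, e1, map_smul, map_smul, map_quadSum, map_quadSum]
  simp only [e2, quadSum_add, e3, e4, conjOp_smul, smul_mul_smul_comm, quadSum_smul]
  rw [conjOp]
  have e5 : ∀ X : Fun ι K, X + X = (2 : K) • X := fun X => (two_smul K X).symm
  simp only [e5, smul_add, smul_smul, smul_sum]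
  have e6 : s ^ 2 * (s ^ 2 / 2 * 2) = s ^ 2 * s ^ 2 := by field_simp
  simp only [e6, mul_comm (s ^ 2) (r _ _)]
  abel

/-- The commutator of `∂_x^n` and `T⁻¹ r̂ T`. -/
theorem dxLin_conjOp (s : K) {ℓ : ℕ} (r : Matrix ι ι K) (l : ι × ℕ → Fun ι K) (n : ℕ)
    (f : Fun ι K) :
    dxLin n (conjOp s ℓ r l f) = conjOp s ℓ r l (dxLin n f) +
      (n : K) • ∑ μ, ∑ ν, r μ ν • dxLin (n - 1) (pderivLin (ν, ℓ) f) +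
      ∑ k ∈ range n, (n.choose k : K) • quadSum ℓ r fun a b =>
        dxLin k (pderivLin a f) * dxLin (n - k) ((s ^ 2) • l b) := by
  have e1 : dxLin n (timeSum ℓ r fun v => pderivLin v f) =
      timeSum ℓ r (fun v => pderivLin v (dxLin n f)) +
        (n : K) • ∑ μ, ∑ ν, r μ ν • dxLin (n - 1) (pderivLin (ν, ℓ) f) := by
    induction n with
    | zero => rw [Nat.cast_zero, zero_smul, add_zero]; rfl
    | succ n ih =>
      rw [add_comm n 1, ← dxLin_add, ih, map_add, dxLin_timeSum, map_smul, map_sum,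
        add_comm 1 n, Nat.cast_succ, add_smul, one_smul, Nat.add_sub_cancel]
      have h1 : (n : K) • ∑ μ, dxLin 1 (∑ ν, r μ ν • dxLin (n - 1) (pderivLin (ν, ℓ) f)) =
          (n : K) • ∑ μ, ∑ ν, r μ ν • dxLin n (pderivLin (ν, ℓ) f) := by
        rcases n with _ | n
        · rw [Nat.cast_zero, zero_smul, zero_smul]
        · simp only [map_sum, map_smul, dxLin_add, Nat.add_sub_cancel, add_comm 1 n]
      rw [h1]
      simp only [← pderivLin_dxLin, dxLin_add, add_comm 1 n]
      abel
  have e2 : ∀ a b, dxLin n (pderivLin a f * l b) = ∑ k ∈ range n, (n.choose k : K) •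
      (dxLin k (pderivLin a f) * dxLin (n - k) (l b)) + dxLin n (pderivLin a f) * l b := by
    intro a b
    rw [dxLin_mul, sum_range_succ, Nat.choose_self, Nat.cast_one, one_smul, Nat.sub_self]
    rfl
  rw [conjOp, map_add, map_add, e1, map_smul, map_smul, map_quadSum, map_quadSum]
  simp only [e2, quadSum_add, quadSum_sum, quadSum_smul, ← pderivLin_dxLin, map_smul,
    mul_smul_comm, conjOp, smul_add, smul_sum]
  simp only [smul_comm (s ^ 2)]
  abel

omit [CharZero K] [Fintype ι] in
theorem pderivLin_algebraMap (v : ι × ℕ) (c : K) : pderivLin v (algebraMap K (Fun ι K) c) = 0 := by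
  rw [Algebra.algebraMap_eq_smul_one, map_smul, pderivLin_apply, MvPowerSeries.pderivFun_one,
    smul_zero]

/-- The chain rule for the second order operator `T⁻¹ r̂ T` and a polynomial. -/
theorem conjOp_aeval (s : K) (ℓ : ℕ) (r : Matrix ι ι K) (l : ι × ℕ → Fun ι K)
    {σ : Type*} (x : σ → Fun ι K) (F : MvPolynomial σ K) :
    conjOp s ℓ r l (MvPolynomial.aeval x F) =
      ∑ v ∈ F.vars, MvPolynomial.aeval x (MvPolynomial.pderiv v F) * conjOp s ℓ r l (x v) +
      (s ^ 2 / 2) • ∑ v ∈ F.vars, ∑ w ∈ F.vars,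
        MvPolynomial.aeval x (MvPolynomial.pderiv v (MvPolynomial.pderiv w F)) *
          quadSum ℓ r fun a b => pderivLin a (x v) * pderivLin b (x w) := by
  have hp : ∀ (G : MvPolynomial σ K), G.vars ⊆ F.vars → ∀ v, pderivLin v (MvPolynomial.aeval x G) =
      ∑ w ∈ F.vars, MvPolynomial.aeval x (MvPolynomial.pderiv w G) * pderivLin v (x w) :=
    fun G hG v => derivation_aeval (pderivLin v).toAddMonoidHom
      (fun a b => (pderivLin_mul v a b).trans (by rw [add_comm, mul_comm b]; rfl))
      (pderivLin_algebraMap v) x G hG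
  have hp2 : ∀ a b, pderivLin a (pderivLin b (MvPolynomial.aeval x F)) =
      ∑ w ∈ F.vars,
        MvPolynomial.aeval x (MvPolynomial.pderiv w F) * pderivLin a (pderivLin b (x w)) +
      ∑ v ∈ F.vars, ∑ w ∈ F.vars,
        MvPolynomial.aeval x (MvPolynomial.pderiv v (MvPolynomial.pderiv w F)) *
          (pderivLin a (x v) * pderivLin b (x w)) := by
    intro a b
    rw [hp F subset_rfl, map_sum, sum_comm, ← sum_add_distrib]
    refine sum_congr rfl fun w _ => ?_
    rw [pderivLin_mul, hp _ (vars_pderiv_subset w F), sum_mul, add_comm]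
    simp only [mul_assoc]
  simp only [conjOp, hp2]
  simp only [hp F subset_rfl, quadSum_add, quadSum_sum, quadSum_mul, sum_mul, mul_assoc,
    mul_add, sum_add_distrib, mul_smul_comm, smul_add, smul_sum]
  have ht : timeSum ℓ r (fun v => ∑ w ∈ F.vars, MvPolynomial.aeval x (MvPolynomial.pderiv w F) *
      pderivLin v (x w)) = ∑ w ∈ F.vars, MvPolynomial.aeval x (MvPolynomial.pderiv w F) *
        timeSum ℓ r fun v => pderivLin v (x w) := by
    simp only [← timeSum_mul]
    induction F.vars using Finset.cons_induction with
    | empty => simpa using timeSum_smul ℓ r (0 : K) (fun _ => 0)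
    | cons w t hw ih => simp only [sum_cons, timeSum_add, ih]
  rw [ht]
  abel

end SecondOrder

/-! ### The Hamiltonian form of the deformation -/

section DualEval

variable {K : Type*} [Field K] {ι : Type*}

theorem dx_iter_dualFun (n : ℕ) (f g : Fun ι K) :
    dx^[n] (dualFun f g) = dualFun (dx^[n] f) (dx^[n] g) := by
  induction n with
  | zero => rfl
  | succ n ih => simp only [Function.iterate_succ_apply', ih, dx_dualFun]

/-- Taylor's formula over the dual numbers. -/
theorem evalJet_dualFun (u w : ι → Fun ι K) (F : MvPolynomial (ι × ℕ) K) :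
    evalJet (fun γ => dualFun (u γ) (w γ)) F = dualFun (evalJet u F)
      (∑ v ∈ F.vars, evalJet u (MvPolynomial.pderiv v F) * dx^[v.2] (w v.1)) := by
  simp only [evalJet, dx_iter_dualFun]
  refine mvPolynomial_chain_induction (fun v : ι × ℕ => dx^[v.2] (u v.1))
    (fun v : ι × ℕ => dx^[v.2] (w v.1))
    (p := fun F a => MvPolynomial.aeval (fun v : ι × ℕ =>
        dualFun (dx^[v.2] (u v.1)) (dx^[v.2] (w v.1))) F =
      dualFun (MvPolynomial.aeval (fun v : ι × ℕ => dx^[v.2] (u v.1)) F) a) ?_ ?_ ?_ F subset_rfl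
  · intro c
    rw [MvPolynomial.aeval_C, MvPolynomial.aeval_C, Algebra.algebraMap_eq_smul_one,
      Algebra.algebraMap_eq_smul_one, ← dualFun_one, dualFun_smul, smul_zero]
  · intro F G a b hF hG
    rw [map_add, map_add, hF, hG, dualFun_add]
  · intro F a n hF
    rw [map_mul, map_mul, hF, MvPolynomial.aeval_X, MvPolynomial.aeval_X, dualFun_mul, add_comm]

theorem twoPoint_dualFun (s : K) {T : Fun ι K} (hT : IsUnit T) (T₁ : Fun ι K) (v w : ι × ℕ) :
    twoPoint s (dualFun T T₁) v w = dualFun (twoPoint s T v w)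
      ((s ^ 2) • MvPowerSeries.pderivFun v (MvPowerSeries.pderivFun w (T₁ * Ring.inverse T))) := by
  rw [twoPoint, logDeriv_dualFun hT, pderivFun_dualFun, dualFun_smul, twoPoint]

theorem potential_dualFun [CharZero K] {s : K} (hs : s ≠ 0) {T : Fun ι K} (hT : IsUnit T)
    (T₁ : Fun ι K) (γ : ι) :
    potential s (dualFun T T₁) γ = dualFun (potential s T γ)
      ((s ^ 2) • dx (MvPowerSeries.pderivFun (γ, 0) (T₁ * Ring.inverse T))) := by
  rw [potential_eq hs (isUnit_dualFun hT T₁), logDeriv_dualFun hT, dx_dualFun, dualFun_smul,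
    potential_eq hs hT]

end DualEval

section Hamiltonian

variable {K : Type*} [Field K] [CharZero K] {ι : Type*} [Fintype ι]

theorem shift_inverse {f : MvPowerSeries (ι × ℕ) K} (hf : IsUnit f) :
    Ring.inverse (shift K f) = shift K (Ring.inverse f) := by
  have hT := isUnit_shift (K := K) hf
  refine hT.mul_left_cancel ?_
  rw [Ring.mul_inverse_cancel _ hT, ← shift_mul, Ring.mul_inverse_cancel _ hf, shift_one]

theorem logDeriv_shift {f : MvPowerSeries (ι × ℕ) K} (hf : IsUnit f) (v : ι × ℕ) :
    logDeriv (shift K f) v = shift K (MvPowerSeries.pderivFun v f * Ring.inverse f) := by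
  rw [logDeriv, shift_inverse hf, pderivFun_shift, shift_mul]

theorem dx_logDeriv_shift {f : MvPowerSeries (ι × ℕ) K} (hf : IsUnit f) (v : ι × ℕ) :
    dx (logDeriv (shift K f) v) =
      ∑ κ, MvPowerSeries.pderivFun (κ, 0) (logDeriv (shift K f) v) := by
  rw [logDeriv_shift hf, dx_shift]

/-- `r̂ T / T` in terms of the logarithmic derivatives of `T`. -/
theorem rHatFun_mul_inverse (s : K) {ℓ : ℕ} (r : Matrix ι ι K) {T : Fun ι K} (hT : IsUnit T) :
    rHatFun s ℓ r T * Ring.inverse T = timeSum ℓ r (logDeriv T) +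
      (s ^ 2 / 2) • quadSum ℓ r fun a b =>
        pderivLin a (logDeriv T b) + logDeriv T a * logDeriv T b := by
  have e : rHatFun s ℓ r T = timeSum ℓ r (fun v => MvPowerSeries.pderivFun v T) +
      (s ^ 2 / 2) • quadSum ℓ r fun a b =>
        MvPowerSeries.pderivFun a (MvPowerSeries.pderivFun b T) := by
    simp only [rHatFun, timeSum, quadSum, smul_add, sum_add_distrib, smul_sum]
    congr 1
    rw [sum_congr rfl fun μ _ => sum_comm, sum_comm]
    refine sum_congr rfl fun i _ => sum_congr rfl fun μ _ => sum_congr rfl fun ν _ => ?_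
    rw [smul_smul, smul_smul, smul_smul]
    congr 1
    ring
  rw [e, mul_comm, mul_add, ← timeSum_mul, mul_smul_comm, ← quadSum_mul]
  congr 2
  · funext v
    rw [logDeriv, mul_comm]
  · congr 1
    funext a b
    rw [mul_comm, pderivFun_pderivFun_mul_inverse hT]
    rfl

/-- The difference between `∂_x^n` of the deformation of `u_γ` and the action of `T⁻¹ r̂ T` on
`∂_x^n u_γ`, where `v = (γ, n)`. -/
noncomputable def jetTerm (s : K) (ℓ : ℕ) (r : Matrix ι ι K) (T : Fun ι K) (v : ι × ℕ) : Fun ι K :=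
  ∑ μ, r v.1 μ • dxLin v.2 (∑ κ, twoPoint s T (μ, ℓ) (κ, 0)) +
  ((v.2 : K) + 1) • ∑ μ, ∑ ν, r ν μ • dxLin v.2 (twoPoint s T (v.1, 0) (μ, ℓ)) +
  ∑ k ∈ range v.2, (v.2.choose k : K) • quadSum ℓ r (fun a b =>
    dxLin (k + 1) (twoPoint s T (v.1, 0) a) * dxLin (v.2 - k - 1) (∑ κ, twoPoint s T b (κ, 0))) +
  quadSum ℓ r fun a b => dxLin v.2 (twoPoint s T (v.1, 0) a * ∑ κ, twoPoint s T b (κ, 0))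

omit [CharZero K] [Fintype ι] in
theorem smul_twoPoint (s : K) (T : Fun ι K) (v w : ι × ℕ) :
    (s ^ 2) • pderivLin v (logDeriv T w) = twoPoint s T v w := rfl

theorem sum_twoPoint_eq (s : K) {f : MvPowerSeries (ι × ℕ) K} (hf : IsUnit f) (v : ι × ℕ) :
    ∑ κ, twoPoint s (shift K f) v (κ, 0) = dxLin 1 ((s ^ 2) • logDeriv (shift K f) v) := by
  rw [map_smul]
  change _ = (s ^ 2) • dx _
  rw [dx_logDeriv_shift hf, smul_sum]
  exact sum_congr rfl fun κ _ => twoPoint_comm (isUnit_shift hf) s v (κ, 0)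

/-- `u_γ = Ω_{γ,0;𝟙,0}`, because `∂/∂x` is the sum of the `∂/∂q_{κ,0}`. -/
theorem potential_shift {s : K} (hs : s ≠ 0) {f : MvPowerSeries (ι × ℕ) K} (hf : IsUnit f) (γ : ι) :
    potential s (shift K f) γ = ∑ κ, twoPoint s (shift K f) (γ, 0) (κ, 0) := by
  rw [potential_eq hs (isUnit_shift hf), sum_twoPoint_eq s hf, map_smul]
  rfl

theorem pderivLin_potential {s : K} (hs : s ≠ 0) {f : MvPowerSeries (ι × ℕ) K} (hf : IsUnit f)
    (v : ι × ℕ) (γ : ι) : pderivLin v (potential s (shift K f) γ) =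
      dxLin 1 (twoPoint s (shift K f) (γ, 0) v) := by
  rw [potential_shift hs hf, sum_twoPoint_eq s hf, pderivLin_dxLin, map_smul, smul_twoPoint,
    twoPoint_comm (isUnit_shift hf)]

variable [DecidableEq ι]

/-- The deformation `ħ ∂_v ∂_w (r̂ T / T)` of `Ω_{v;w}`, in terms of the operator `T⁻¹ r̂ T`. -/
theorem smul_pderivLin_pderivLin_rHatFun (s : K) {ℓ : ℕ} {r : Matrix ι ι K}
    (hr : ∀ α β, r α β = (-1) ^ (ℓ + 1) * r β α) {T : Fun ι K} (hT : IsUnit T) (v w : ι × ℕ) :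
    (s ^ 2) • pderivLin v (pderivLin w (rHatFun s ℓ r T * Ring.inverse T)) =
      conjOp s ℓ r (logDeriv T) (twoPoint s T v w) +
      ∑ ν, r w.1 ν • twoPoint s T v (ν, ℓ + w.2) +
      ∑ ν, r v.1 ν • twoPoint s T (ν, ℓ + v.2) w +
      quadSum ℓ r fun a b => twoPoint s T v a * twoPoint s T b w := by
  rw [rHatFun_mul_inverse s r hT]
  exact pderivLin_pderivLin_timeSum_add s hr (fun v w => pderivFun_logDeriv_comm hT v w) v w

/-- The deformation of `∂_x^n u_γ`. -/
theorem dxLin_deformation {s : K} (hs : s ≠ 0) {ℓ : ℕ} {r : Matrix ι ι K}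
    (hr : ∀ α β, r α β = (-1) ^ (ℓ + 1) * r β α) {f : MvPowerSeries (ι × ℕ) K} (hf : IsUnit f)
    (v : ι × ℕ) :
    dxLin v.2 ((s ^ 2) • dx (pderivLin (v.1, 0)
        (rHatFun s ℓ r (shift K f) * Ring.inverse (shift K f)))) =
      conjOp s ℓ r (logDeriv (shift K f)) (dxLin v.2 (potential s (shift K f) v.1)) +
        jetTerm s ℓ r (shift K f) v := by
  obtain ⟨γ, n⟩ := v
  have hT := isUnit_shift (K := K) hf
  have hpot := potential_shift hs hf γ
  have hpp := fun v => pderivLin_potential hs hf v γ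
  have hsum := sum_twoPoint_eq s hf
  set T := shift K f with hTf
  have hdx : dx (pderivLin (γ, 0) (rHatFun s ℓ r T * Ring.inverse T)) =
      ∑ κ, pderivLin (γ, 0) (pderivLin (κ, 0) (rHatFun s ℓ r T * Ring.inverse T)) := by
    have h : pderivLin (γ, 0) (rHatFun s ℓ r T * Ring.inverse T) =
        shift K (MvPowerSeries.pderivFun (γ, 0) (rHat s ℓ r f * Ring.inverse f)) := by
      rw [hTf, shift_inverse hf, ← shift_rHat, ← shift_mul]
      exact pderivFun_shift _ _
    rw [h, dx_shift, ← h]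
    exact sum_congr rfl fun κ _ => pderivLin_comm _ _ _
  have hd1 : ∀ κ : ι,
    (s ^ 2) • pderivLin (γ, 0) (pderivLin (κ, 0) (rHatFun s ℓ r T * Ring.inverse T)) =
      conjOp s ℓ r (logDeriv T) (twoPoint s T (γ, 0) (κ, 0)) +
      ∑ ν, r κ ν • twoPoint s T (γ, 0) (ν, ℓ) +
      ∑ ν, r γ ν • twoPoint s T (ν, ℓ) (κ, 0) +
      quadSum ℓ r fun a b => twoPoint s T (γ, 0) a * twoPoint s T b (κ, 0) := fun κ =>
    smul_pderivLin_pderivLin_rHatFun s hr hT (γ, 0) (κ, 0)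
  have h1 : (s ^ 2) • dx (pderivLin (γ, 0) (rHatFun s ℓ r T * Ring.inverse T)) =
      conjOp s ℓ r (logDeriv T) (potential s T γ) +
      ∑ μ, ∑ ν, r ν μ • twoPoint s T (γ, 0) (μ, ℓ) +
      ∑ μ, r γ μ • ∑ κ, twoPoint s T (μ, ℓ) (κ, 0) +
      quadSum ℓ r fun a b => twoPoint s T (γ, 0) a * ∑ κ, twoPoint s T b (κ, 0) := by
    rw [hdx, smul_sum]
    simp only [hd1, sum_add_distrib, ← conjOp_sum]
    rw [← hpot, sum_comm (f := fun κ ν => r κ ν • twoPoint s T (γ, 0) (ν, ℓ)),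
      sum_comm (f := fun κ ν => r γ ν • twoPoint s T (ν, ℓ) (κ, 0))]
    simp only [mul_sum, smul_sum, quadSum_sum]
  have hn : (n : K) • ∑ μ, ∑ ν, r μ ν • dxLin (n - 1) (pderivLin (ν, ℓ) (potential s T γ)) =
      (n : K) • ∑ μ, ∑ ν, r ν μ • dxLin n (twoPoint s T (γ, 0) (μ, ℓ)) := by
    rcases n with _ | n
    · rw [Nat.cast_zero, zero_smul, zero_smul]
    · simp only [hpp, dxLin_add, Nat.add_sub_cancel]
      rw [sum_comm]
  have hq : ∀ k ∈ range n, (n.choose k : K) • quadSum ℓ r (fun a b =>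
        dxLin k (pderivLin a (potential s T γ)) * dxLin (n - k) ((s ^ 2) • logDeriv T b)) =
      (n.choose k : K) • quadSum ℓ r (fun a b => dxLin (k + 1) (twoPoint s T (γ, 0) a) *
        dxLin (n - k - 1) (∑ κ, twoPoint s T b (κ, 0))) := by
    intro k hk
    rw [mem_range] at hk
    simp only [hpp, dxLin_add, hsum,
      show n - k - 1 + 1 = n - k by omega]
  rw [h1, map_add, map_add, map_add, dxLin_conjOp, hn, sum_congr rfl hq, map_quadSum, jetTerm]
  simp only [map_sum, map_smul, add_smul, one_smul]
  abel

/-- The Hamiltonian deformation formula for the matrix `rᵀ`, with `F = F_{αβ,p}`. -/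
noncomputable def hamCore (s : K) (ℓ : ℕ) (r : Matrix ι ι K) (T : Fun ι K) (α β : ι) (p : ℕ)
    (F : MvPolynomial (ι × ℕ) K) : Fun ι K :=
  ∑ μ, r α μ • twoPoint s T (μ, ℓ) (β, p) + ∑ μ, r β μ • twoPoint s T (α, 0) (μ, p + ℓ) +
  (quadSum ℓ r fun a b => twoPoint s T (α, 0) a * twoPoint s T b (β, p)) -
  ∑ v ∈ F.vars, evalJet (potential s T) (MvPolynomial.pderiv v F) * jetTerm s ℓ r T v +
  (s ^ 2 / 2) • ∑ v ∈ F.vars, ∑ w ∈ F.vars,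
    evalJet (potential s T) (MvPolynomial.pderiv v (MvPolynomial.pderiv w F)) *
      quadSum ℓ r fun a b => dxLin (v.2 + 1) (twoPoint s T (v.1, 0) a) *
        dxLin (w.2 + 1) (twoPoint s T b (w.1, 0))

omit [CharZero K] [DecidableEq ι] in
theorem quadSum_smul_matrix (ℓ : ℕ) (c : K) (r : Matrix ι ι K) (g : ι × ℕ → ι × ℕ → Fun ι K) :
    quadSum ℓ (c • r) g = c • quadSum ℓ r g := by
  simp only [quadSum, smul_sum, Matrix.smul_apply, smul_eq_mul, smul_smul, mul_left_comm c]

omit [CharZero K] [DecidableEq ι] in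
theorem jetTerm_smul (s : K) (ℓ : ℕ) (c : K) (r : Matrix ι ι K) (T : Fun ι K) (v : ι × ℕ) :
    jetTerm s ℓ (c • r) T v = c • jetTerm s ℓ r T v := by
  simp only [jetTerm, quadSum_smul_matrix, smul_add, smul_sum, Matrix.smul_apply, smul_eq_mul,
    mul_smul, smul_comm c]

omit [CharZero K] [DecidableEq ι] in
theorem hamCore_smul (s : K) (ℓ : ℕ) (c : K) (r : Matrix ι ι K) (T : Fun ι K) (α β : ι) (p : ℕ)
    (F : MvPolynomial (ι × ℕ) K) :
    hamCore s ℓ (c • r) T α β p F = c • hamCore s ℓ r T α β p F := by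
  simp only [hamCore, quadSum_smul_matrix, jetTerm_smul, smul_add, smul_sub, smul_sum,
    Matrix.smul_apply, smul_eq_mul, mul_smul, mul_smul_comm, smul_comm c]

omit [CharZero K] in
/-- The indices of `r` in the Hamiltonian deformation formula are exchanged with respect to those in
`r̂`. -/
theorem hamDeformation_eq (s : K) (ℓ : ℕ) (r : Matrix ι ι K) (T : Fun ι K) (α β : ι) (p : ℕ) :
    hamDeformation s ℓ r T α β p =
      hamCore s ℓ r.transpose T α β p (omegaMulti s α β p) := by
  have hk : ∀ v : ι × ℕ, ∑ i ∈ range ℓ, ∑ k ∈ range v.2, ∑ μ, ∑ ν,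
      ((v.2.choose k : K) * (-1) ^ (i + 1) * r ν μ) •
        (dx^[k + 1] (twoPoint s T (v.1, 0) (μ, i)) *
          dx^[v.2 - k - 1] (∑ κ, twoPoint s T (ν, ℓ - 1 - i) (κ, 0))) =
      ∑ k ∈ range v.2, (v.2.choose k : K) • quadSum ℓ r.transpose (fun a b =>
        dxLin (k + 1) (twoPoint s T (v.1, 0) a) *
          dxLin (v.2 - k - 1) (∑ κ, twoPoint s T b (κ, 0))) := by
    intro v
    rw [sum_comm]
    simp only [quadSum, smul_sum, smul_smul, mul_assoc, dxLin_apply, Matrix.transpose_apply]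
  simp only [hamDeformation, hk, sum_smul]
  rfl

/-- The deformation of the two-point functions, given by the second derivatives of `r̂ T / T`,
is the sum of the deformation through the `u_γ` and of the Hamiltonian deformation formula. -/
theorem smul_pderivFun_pderivFun_eq {s : K} (hs : s ≠ 0) {ℓ : ℕ} {r : Matrix ι ι K}
    (hr : ∀ α β, r α β = (-1) ^ (ℓ + 1) * r β α) {f : MvPowerSeries (ι × ℕ) K} (hf : IsUnit f)
    {α β : ι} {p : ℕ} {F : MvPolynomial (ι × ℕ) K}
    (hF : evalJet (potential s (shift K f)) F = twoPoint s (shift K f) (α, 0) (β, p)) :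
    (s ^ 2) • MvPowerSeries.pderivFun (α, 0) (MvPowerSeries.pderivFun (β, p)
        (rHatFun s ℓ r (shift K f) * Ring.inverse (shift K f))) =
      ∑ v ∈ F.vars, evalJet (potential s (shift K f)) (MvPolynomial.pderiv v F) *
        dx^[v.2] ((s ^ 2) • dx (MvPowerSeries.pderivFun (v.1, 0)
          (rHatFun s ℓ r (shift K f) * Ring.inverse (shift K f)))) +
      hamCore s ℓ r (shift K f) α β p F := by
  have hT := isUnit_shift (K := K) hf
  have h1 := smul_pderivLin_pderivLin_rHatFun s hr hT (α, 0) (β, p)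
  have h2 : ∀ v : ι × ℕ, dx^[v.2] ((s ^ 2) • dx (MvPowerSeries.pderivFun (v.1, 0)
      (rHatFun s ℓ r (shift K f) * Ring.inverse (shift K f)))) = _ :=
    fun v => dxLin_deformation hs hr hf v
  have h3 := conjOp_aeval s ℓ r (logDeriv (shift K f))
    (fun v : ι × ℕ => dxLin v.2 (potential s (shift K f) v.1)) F
  have h4 : MvPolynomial.aeval (fun v : ι × ℕ => dxLin v.2 (potential s (shift K f) v.1)) F =
      twoPoint s (shift K f) (α, 0) (β, p) := hF
  have h5 : ∀ G : MvPolynomial (ι × ℕ) K,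
      MvPolynomial.aeval (fun v : ι × ℕ => dxLin v.2 (potential s (shift K f) v.1)) G =
        evalJet (potential s (shift K f)) G := fun G => rfl
  have h6 : ∀ a b (v w : ι × ℕ), pderivLin a (dxLin v.2 (potential s (shift K f) v.1)) *
      pderivLin b (dxLin w.2 (potential s (shift K f) w.1)) =
      dxLin (v.2 + 1) (twoPoint s (shift K f) (v.1, 0) a) *
        dxLin (w.2 + 1) (twoPoint s (shift K f) b (w.1, 0)) := by
    intro a b v w
    rw [pderivLin_dxLin, pderivLin_dxLin, pderivLin_potential hs hf, pderivLin_potential hs hf,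
      dxLin_add, dxLin_add, twoPoint_comm hT s b]
  rw [h4] at h3
  simp only [h5, h6] at h3
  have h1' : (s ^ 2) • MvPowerSeries.pderivFun (α, 0) (MvPowerSeries.pderivFun (β, p)
        (rHatFun s ℓ r (shift K f) * Ring.inverse (shift K f))) = _ := h1
  rw [h1', h3, hamCore]
  simp only [h2, mul_add, sum_add_distrib, add_zero, add_comm p ℓ]
  abel

end Hamiltonian

section Comparison

variable {K : Type*} [Field K] [CharZero K] {ι : Type*} [Fintype ι] [DecidableEq ι]

omit [CharZero K] [DecidableEq ι] in
theorem isUnit_prodTau {s : K} {τ : ι → MvPowerSeries ℕ K} (hτ : ∀ γ, IsKdVTau s (τ γ)) :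
    IsUnit (prodTau τ) := by
  refine IsUnit.prod_univ_iff.mpr fun γ => ?_
  rw [MvPowerSeries.isUnit_iff_constantCoeff, MvPowerSeries.constantCoeff_rename]
  exact isUnit_iff_ne_zero.mpr (hτ γ).1

/-- The deformed two-point functions are the differential polynomials `F_{αβ,p}` in the deformed
`u_γ`, corrected by the Hamiltonian deformation formula. -/
theorem twoPoint_deformedTau {s : K} (hs : s ≠ 0) {τ : ι → MvPowerSeries ℕ K}
    (hτ : ∀ γ, IsKdVTau s (τ γ)) {ℓ : ℕ} (hℓ : 0 < ℓ) {r : Matrix ι ι K}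
    (hr : ∀ α β, r α β = (-1) ^ (ℓ + 1) * r β α) (α β : ι) (p : ℕ) :
    twoPoint s (shift K (deformedTau s ℓ r (prodTau τ))) (α, 0) (β, p) =
      evalJet (potential s (shift K (deformedTau s ℓ r (prodTau τ)))) (omegaMulti s α β p) +
        (DualNumber.eps : DualNumber K) • extFun
          ((-1 : K) ^ (ℓ - 1) • hamDeformation s ℓ r (shift K (prodTau τ)) α β p) := by
  have hf := isUnit_prodTau hτ
  have hT := isUnit_shift (K := K) hf
  have hF := evalJet_omegaMulti hs hτ α β p
  have hrt : r.transpose = (-1 : K) ^ (ℓ + 1) • r := by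
    ext i j
    exact hr j i
  have hsign : (-1 : K) ^ (ℓ - 1) * (-1) ^ (ℓ + 1) = 1 := by
    rw [← pow_add, show ℓ - 1 + (ℓ + 1) = 2 * ℓ by omega, pow_mul]
    simp
  rw [shift_deformedTau, twoPoint_dualFun s hT,
    show potential s (dualFun (shift K (prodTau τ)) _) = _ from
      funext fun γ => potential_dualFun hs hT _ γ,
    evalJet_dualFun, hF, smul_pderivFun_pderivFun_eq hs hr hf hF, hamDeformation_eq, hrt,
    hamCore_smul, smul_smul, hsign, one_smul]
  rw [dualFun, dualFun, extFun_add, smul_add, add_assoc]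

end Comparison

end KdVGivental

theorem mainTheorem1 {K : Type*} [Field K] [CharZero K] {ι : Type*} [Fintype ι] [DecidableEq ι]
    (s : K) (hs : s ≠ 0)
    (τ : ι → MvPowerSeries ℕ K) (hτ : ∀ γ, KdVGivental.IsKdVTau s (τ γ))
    (ℓ : ℕ) (hℓ : 0 < ℓ) (r : Matrix ι ι K) (hr : ∀ α β, r α β = (-1) ^ (ℓ + 1) * r β α)
    (T : KdVGivental.Fun ι K) (hT : T = KdVGivental.shift K (KdVGivental.prodTau τ))
    (TR : KdVGivental.Fun ι (DualNumber K))
    (hTR : TR = KdVGivental.shift K (KdVGivental.deformedTau s ℓ r (KdVGivental.prodTau τ)))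
    (α β : ι) (p : ℕ) :
    -- the deformed Sato-Wilson equation
    MvPowerSeries.pderivFun (β, p) (KdVGivental.dressing s TR α) *
        Ring.inverse (KdVGivental.dressing s TR α) =
      KdVGivental.satoWilsonRHS s ℓ r (KdVGivental.prodTau τ) α β p ∧
    -- its residue gives the deformed two-point function
    KdVGivental.twoPoint s TR (α, 0) (β, p) =
      -((s ^ 2) • KdVGivental.res
        (KdVGivental.satoWilsonRHS s ℓ r (KdVGivental.prodTau τ) α β p)) ∧
    -- and coincides with the deformation in Hamiltonian form up to the sign `(-1)^(ℓ-1)`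
    -((s ^ 2) • KdVGivental.res
        (KdVGivental.satoWilsonRHS s ℓ r (KdVGivental.prodTau τ) α β p)) =
      KdVGivental.evalJet (KdVGivental.potential s TR) (KdVGivental.omegaMulti s α β p) +
        (DualNumber.eps : DualNumber K) • KdVGivental.extFun
          ((-1 : K) ^ (ℓ - 1) • KdVGivental.hamDeformation s ℓ r T α β p) := by
  subst hT hTR
  have h2 := KdVGivental.deformed_twoPoint hs hτ hℓ hr α β p
  exact ⟨KdVGivental.deformed_satoWilson hs hτ hℓ hr α β p, h2,
    h2.symm.trans (KdVGivental.twoPoint_deformedTau hs hτ hℓ hr α β p)⟩
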